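/- All multigraphs are loopless (parallel edges allowed), countable and possibly infinite; rooted multigraphs are considered up to root-preserving isomorphism. Let $\lambda>0$. Given a rooted connected multigraph $(G,o)$, the full process with parameter $\lambda$ started at $(G,o)$ is the following continuous-time evolution. Each vertex lives for an exponential time of rate $1$ and then splits, that is, it is replaced by two new vertices $v_1,v_2$; a number of edges with distribution $\mathrm{Poisson}(\lambda/2)$ is added between $v_1$ and $v_2$; each edge $uv$ at the split vertex $v$ is replaced with one of $uv_1,uv_2$ chosen uniformly at random; and if $v$ was the root, the new root is $v_1$ or $v_2$ with probability $1/2$ each. All these random choices are independent (and independent of $(G,o)$, if that is random). The cluster process $(G_t,o_t)_{t\ge 0}$ is the component of the root in the full process at time $t$, rooted at the current root. Theorem. For every $\lambda>0$, let $(M(\lambda),o)$ be the random rooted connected multigraph with finite expected root degree that is invariant under the cluster process, in the sense that $(M(\lambda)_t,o_t)$ has the same distribution as $(M(\lambda),o)$ for every $t\ge 0$; it exists and is unique in distribution. Then its expected number of vertices is finite: $\mathbb{E}\,|M(\lambda)|<\infty$. -/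

import Mathlib

open MeasureTheory ProbabilityTheory
open scoped NNReal ENNReal

noncomputable section

/-- A rooted connected multigraph: parallel edges are allowed, loops are not. The graph may be
infinite, and vertices may have infinite degree. -/
structure RootedMultigraph (α β : Type) where
  graph : Graph α β
  root : α
  root_mem : root ∈ graph.vertexSet
  loopless : graph.Loopless
  connected : ∀ x ∈ graph.vertexSet, Relation.ReflTransGen graph.Adj root x

namespace RootedMultigraph

variable {α β α' β' : Type}

/-- Isomorphism of rooted multigraphs: a root-preserving bijection between the vertices together
with a bijection between the edges that respects incidence. -/
def Isomorphic (G : RootedMultigraph α β) (H : RootedMultigraph α' β') : Prop :=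
  ∃ (f : G.graph.vertexSet ≃ H.graph.vertexSet) (g : G.graph.edgeSet ≃ H.graph.edgeSet),
    (f ⟨G.root, G.root_mem⟩ : α') = H.root ∧
    ∀ (e : G.graph.edgeSet) (x y : G.graph.vertexSet),
      G.graph.IsLink e x y ↔ H.graph.IsLink (g e) (f x) (f y)

/-- The number of vertices, possibly infinite. -/
def size (G : RootedMultigraph α β) : ℕ∞ := G.graph.vertexSet.encard

/-- The degree of the root (the number of edges at the root, counted with multiplicity). -/
def rootDegree (G : RootedMultigraph α β) : ℕ∞ := {e | G.graph.Inc e G.root}.encard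

/-- The σ-algebra generated by the root, by the events "`x` is a vertex" and by the events
"`e` is an edge joining `x` and `y`". Every countable rooted multigraph is isomorphic to one whose
vertices and edges are labelled by natural numbers. -/
instance : MeasurableSpace (RootedMultigraph ℕ ℕ) :=
  MeasurableSpace.comap
    (fun G => (G.root, (fun x => x ∈ G.graph.vertexSet : ℕ → Prop),
      (fun e x y => G.graph.IsLink e x y : ℕ → ℕ → ℕ → Prop)))
    inferInstance

/-- Events that concern rooted multigraphs up to isomorphism. -/
def IsoInvariant (A : Set (RootedMultigraph ℕ ℕ)) : Prop :=
  ∀ G H, Isomorphic G H → G ∈ A → H ∈ A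

/-- Two laws of random rooted multigraphs agree (as laws of multigraphs up to isomorphism). -/
def SameLaw (μ ν : Measure (RootedMultigraph ℕ ℕ)) : Prop :=
  ∀ A, MeasurableSet A → IsoInvariant A → μ A = ν A

/-- The component of the vertex `o` in a loopless multigraph, rooted at `o`. -/
def component (G : Graph α β) (hG : G.Loopless) (o : α) : RootedMultigraph α β where
  graph :=
    { vertexSet := {x | Relation.ReflTransGen G.Adj o x}
      IsLink := fun e x y => G.IsLink e x y ∧ Relation.ReflTransGen G.Adj o x
      isLink_symm := by
        intro e _
        exact ⟨fun x y h => ⟨h.1.symm, h.2.tail ⟨e, h.1⟩⟩⟩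
      eq_or_eq_of_isLink_of_isLink := by
        intro e x y v w h h'
        exact h.1.left_eq_or_eq h'.1
      left_mem_of_isLink := by
        intro e x y h
        exact h.2 }
  root := o
  root_mem := Relation.ReflTransGen.refl
  loopless := ⟨fun e x h => hG.not_isLoopAt e x h.1⟩
  connected := by
    intro x hx
    induction hx with
    | refl => exact Relation.ReflTransGen.refl
    | tail h h' ih =>
      obtain ⟨e, he⟩ := h'
      exact ih.tail ⟨e, he, h⟩

end RootedMultigraph

/-! ### The splitting process

The descendants of a starting vertex `v` are labelled `(v, w)` with `w` a word in two letters: the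
vertex itself is `(v, [])`, and the two vertices replacing `(v, w)` are `(v, w ++ [false])` and
`(v, w ++ [true])`. Each edge keeps its label for ever, and only its ends move; the edges created
when the vertex `p = (v, w)` splits are labelled `(p, 0), (p, 1), …`. -/

/-- Labels of the vertices that occur in the process. -/
abbrev Descendant (α : Type) : Type := α × List Bool

/-- Labels of the edges that occur in the process: edges of the starting graph, and new edges. -/
abbrev EdgeLabel (α β : Type) : Type := β ⊕ (Descendant α × ℕ)

/-- All the random choices of the process: lifetimes of the vertices, numbers of edges added when
a vertex splits, the successive choices of the root, the successive choices made by the end at `u`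
of the starting edge `e` (at the index `(e, u)`), and the successive choices made by each of the
two ends of the new edges. -/
abbrev Choices (α β : Type) : Type :=
  (Descendant α → ℝ) × (Descendant α → ℕ) × (ℕ → Bool) × (β × α → ℕ → Bool) ×
    ((Descendant α × ℕ) × Bool → ℕ → Bool)

/-- An infinite sequence of independent fair coin tosses. -/
def coinTosses : Measure (ℕ → Bool) :=
  Measure.infinitePi fun _ => (PMF.uniformOfFintype Bool).toMeasure

/-- The joint law of the random choices: they are independent, lifetimes are exponential of rate
`1`, numbers of new edges are Poisson of mean `lam / 2`, and the other choices are fair coins. -/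
def choiceLaw (α β : Type) (lam : ℝ≥0) : Measure (Choices α β) :=
  (Measure.infinitePi fun _ => expMeasure 1).prod <|
    (Measure.infinitePi fun _ => poissonMeasure (lam / 2)).prod <|
      coinTosses.prod <|
        (Measure.infinitePi fun _ => coinTosses).prod (Measure.infinitePi fun _ => coinTosses)

namespace Choices

variable {α β : Type} (c : Choices α β)

/-- The lifetime of a vertex, from its birth to its splitting. -/
def lifetime : Descendant α → ℝ := c.1

/-- The number of edges added between the two offspring of a vertex when it splits. -/
def newEdges : Descendant α → ℕ := c.2.1

def rootCoins : ℕ → Bool := c.2.2.1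

def oldEndCoins : β × α → ℕ → Bool := c.2.2.2.1

def newEndCoins : (Descendant α × ℕ) × Bool → ℕ → Bool := c.2.2.2.2

/-- The time at which a vertex appears: the sum of the lifetimes of its proper ancestors. -/
def birth (p : Descendant α) : ℝ :=
  ∑ k ∈ Finset.range p.2.length, c.lifetime (p.1, p.2.take k)

/-- The time at which a vertex splits. -/
def splitTime (p : Descendant α) : ℝ := c.birth p + c.lifetime p

/-- The vertices present at time `t`. -/
def Present (t : ℝ) (p : Descendant α) : Prop := c.birth p ≤ t ∧ t < c.splitTime p

/-- The location at time `t` of a marker (the root or the end of an edge) that starts at the vertex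
`p` and follows the coins `ξ`, one for each split of the vertex carrying it. -/
def position (t : ℝ) (p : Descendant α) (ξ : ℕ → Bool) : Descendant α :=
  (p.1, p.2 ++ (List.range (sInf {n : ℕ |
    t < c.splitTime (p.1, p.2 ++ (List.range n).map ξ)})).map ξ)

/-- The location at time `t` of the end of the starting edge `e` that was at `u` at time `0`. -/
def oldEnd (t : ℝ) (e : β) (u : α) : Descendant α := c.position t (u, []) (c.oldEndCoins (e, u))

/-- The location at time `t` of one end of the `i`-th edge created when the vertex `p` split; the
two ends start at the two offspring of `p`. -/
def newEnd (t : ℝ) (p : Descendant α) (i : ℕ) (b : Bool) : Descendant α :=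
  c.position t (p.1, p.2 ++ [b]) (c.newEndCoins ((p, i), b))

/-- The location of the root at time `t`, if the starting root is `o`. -/
def rootAt (t : ℝ) (o : α) : Descendant α := c.position t (o, []) c.rootCoins

end Choices

namespace RootedMultigraph

variable {α β : Type}

/-- `e` joins `x` and `y` in the full process at time `t`. -/
def fullLink (G : RootedMultigraph α β) (c : Choices α β) (t : ℝ) :
    EdgeLabel α β → Descendant α → Descendant α → Prop
  | .inl e, x, y => c.Present t x ∧ c.Present t y ∧
      ∃ u v, G.graph.IsLink e u v ∧ x = c.oldEnd t e u ∧ y = c.oldEnd t e v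
  | .inr (p, i), x, y => c.Present t x ∧ c.Present t y ∧
      p.1 ∈ G.graph.vertexSet ∧ c.splitTime p ≤ t ∧ i < c.newEdges p ∧
        ∃ b, x = c.newEnd t p i b ∧ y = c.newEnd t p i (!b)

/-- The full process started from `G`, at time `t`. -/
def fullGraph (G : RootedMultigraph α β) (c : Choices α β) (t : ℝ) :
    Graph (Descendant α) (EdgeLabel α β) where
  vertexSet := {p | p.1 ∈ G.graph.vertexSet ∧ c.Present t p}
  IsLink := G.fullLink c t
  isLink_symm := by
    rintro (e | ⟨p, i⟩) _
    · refine ⟨?_⟩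
      rintro x y ⟨hx, hy, u, v, h, rfl, rfl⟩
      exact ⟨hy, hx, v, u, h.symm, rfl, rfl⟩
    · refine ⟨?_⟩
      rintro x y ⟨hx, hy, h1, h2, h3, b, rfl, rfl⟩
      exact ⟨hy, hx, h1, h2, h3, !b, rfl, by simp⟩
  eq_or_eq_of_isLink_of_isLink := by
    rintro (e | ⟨p, i⟩) x y v w
    · rintro ⟨-, -, a, b, h, rfl, rfl⟩ ⟨-, -, a', b', h', rfl, rfl⟩
      rcases h.left_eq_or_eq h' with rfl | rfl
      · exact Or.inl rfl
      · exact Or.inr rfl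
    · rintro ⟨-, -, -, -, -, b, rfl, rfl⟩ ⟨-, -, -, -, -, b', rfl, rfl⟩
      cases b <;> cases b' <;> simp
  left_mem_of_isLink := by
    rintro (e | ⟨p, i⟩) x y
    · rintro ⟨hx, -, u, v, h, rfl, rfl⟩
      exact ⟨h.left_mem, hx⟩
    · rintro ⟨hx, -, h, -, -, b, rfl, rfl⟩
      exact ⟨h, hx⟩

theorem fullGraph_loopless (G : RootedMultigraph α β) (c : Choices α β) (t : ℝ) :
    (G.fullGraph c t).Loopless := by
  refine ⟨?_⟩
  rintro (e | ⟨p, i⟩) x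
  · rintro ⟨-, -, u, v, h, hu, hv⟩
    have huv : u = v := congrArg Prod.fst (hu.symm.trans hv)
    subst huv
    exact G.loopless.not_isLoopAt e u h
  · rintro ⟨-, -, -, -, -, b, hb, hb'⟩
    have h := congrArg Prod.snd (hb.symm.trans hb')
    cases b <;> simp [Choices.newEnd, Choices.position] at h

/-- The cluster process started from `G`, at time `t`: the component of the root in the full
process. -/
def cluster (G : RootedMultigraph α β) (c : Choices α β) (t : ℝ) :
    RootedMultigraph (Descendant α) (EdgeLabel α β) :=
  component (G.fullGraph c t) (G.fullGraph_loopless c t) (c.rootAt t G.root)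

/-- The law `μ` of a random rooted connected multigraph with finite expected root degree is
invariant under the cluster process with parameter `lam`: for every `t ≥ 0`, the cluster process at
time `t`, started from a random multigraph with law `μ` that is independent of the random choices
of the process, has law `μ` (up to isomorphism). -/
structure IsInvariantLaw (lam : ℝ≥0) (μ : Measure (RootedMultigraph ℕ ℕ)) : Prop where
  isProbabilityMeasure : IsProbabilityMeasure μ
  expected_rootDegree : ∫⁻ G, (G.rootDegree : ℝ≥0∞) ∂μ < ∞
  invariant : ∀ t : ℝ, 0 ≤ t → ∀ A, MeasurableSet A → IsoInvariant A →
    (μ.prod (choiceLaw ℕ ℕ lam))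
      {p | ∃ H ∈ A, Isomorphic (p.1.cluster p.2 t) H} = μ A

end RootedMultigraph

end

open MeasureTheory ProbabilityTheory
open scoped NNReal ENNReal

noncomputable section

/-! Consider the process from a single vertex. A marker (the root, or an end of an edge) descends
the binary tree of splits by fair coins. At the first split it enters one of two independent copies
of the whole environment, run for the remaining time, so every expectation satisfies a renewal
relation at that split. Let `weight` be the conditional probability that an independent marker lies
in the component of the given one, and let p(t), called `connProb`, be its mean.

The key fact is that p is integrable over time. Suppose that, within the copy entered by the marker,
its component has weight w. Each of the Poisson(λ/2) new edges has an independent marker on that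
side, so none of them meets the component with probability a = exp(-λw/2). In that case the weight
becomes at most w/2, because an independent marker must also choose the right side; otherwise the
weight is only bounded by 1. For the potential 1 - exp(-λw) these two cases combine exactly: the
mean potential falls by at least e^{-λ}(1 - a), which is at least e^{-λ}(1 - e^{-λ/2})w by convexity
(`lintegral_potential_split_le`). The potential is at most 1, so integrating the resulting renewal
inequality over time bounds the integral of p (`exists_lintegral_connProb_le`).

This controls the expected size N. A vertex of the component after a split is reached inside the
marker's own copy, or across a new edge that meets the marker's component, or by leaving and
returning through two distinct new edges whose far ends are connected in the other copy
(`conn_cons`). The last two cases each cost a factor p, so N(t) ≤ E[(1 + 2m p(t-T)) N(t-T); T ≤ t] +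
P(T > t), where T is an exponential lifetime and m is the third moment of the number of new edges.
The function exp(2m∫₀ᵗp) solves this with equality and is bounded. Comparison by induction on a
depth cut-off bounds the expected size uniformly in time, and likewise the expected root degree
(`exists_expCluster_le`).

The initial graph is forgotten. The cluster process from G agrees with the one from the single root
vertex unless the root-side end of some edge at the starting root falls into the component of the
root; this has probability at most deg(root)·p(t) (`clusterLaw_le`). As p is integrable, it is
arbitrarily small at suitable times, so invariant laws of finite mean degree coincide. For
existence, the Markov property (`lintegral_clusterLaw_cluster_single`) turns the same estimate into
a Cauchy property of the laws from a single vertex, uniform over isomorphism-invariant events. Their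
limit is a measure (`exists_measure_of_cauchy`); it is invariant and inherits the bounds on degree
and size (`exists_invariantLaw`). -/

/-! ### Product measures -/

section ProductMeasure

variable {ι κ E F H : Type*} [MeasurableSpace E] [MeasurableSpace F] [MeasurableSpace H]

/-- Boxes suffice: if `i` is constrained, its factor comes from the fresh sample and the other
factors from the family with `i` erased; otherwise the fresh sample is irrelevant. -/
theorem measurePreserving_update_infinitePi [DecidableEq ι] (μ : Measure E)
    [IsProbabilityMeasure μ] (i : ι) :
    MeasurePreserving (fun p : (ι → E) × E => Function.update p.1 i p.2)
      ((Measure.infinitePi fun _ => μ).prod μ) (Measure.infinitePi fun _ => μ) := by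
  have hm : Measurable (fun p : (ι → E) × E => Function.update p.1 i p.2) := by
    refine measurable_pi_lambda _ fun j => ?_
    by_cases h : j = i
    · subst h; simpa using measurable_snd
    · simp only [Function.update_of_ne h]
      exact (measurable_pi_apply j).comp measurable_fst
  refine ⟨hm, Measure.eq_infinitePi _ fun s t ht => ?_⟩
  rw [Measure.map_apply hm (.pi s.countable_toSet fun _ _ => ht _)]
  by_cases hi : i ∈ s
  · have : (fun p : (ι → E) × E => Function.update p.1 i p.2) ⁻¹' (Set.pi s t)
        = (Set.pi (s.erase i) t) ×ˢ (t i) := by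
      ext ⟨x, a⟩
      simp only [Set.mem_preimage, Set.mem_pi, Set.mem_prod, Finset.coe_erase]
      constructor
      · intro h
        refine ⟨fun j hj => ?_, by simpa using h i hi⟩
        have := h j hj.1
        rwa [Function.update_of_ne hj.2] at this
      · rintro ⟨h1, h2⟩ j hj
        by_cases hji : j = i
        · subst hji; simpa using h2
        · rw [Function.update_of_ne hji]; exact h1 j ⟨hj, hji⟩
    rw [this, Measure.prod_prod, Measure.infinitePi_pi _ (fun j _ => ht j),
      Finset.prod_erase_mul _ _ hi]
  · have : (fun p : (ι → E) × E => Function.update p.1 i p.2) ⁻¹' (Set.pi s t)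
        = (Set.pi s t) ×ˢ Set.univ := by
      ext ⟨x, a⟩
      simp only [Set.mem_preimage, Set.mem_pi, Set.mem_prod, Set.mem_univ, and_true]
      refine forall₂_congr fun j hj => ?_
      rw [Function.update_of_ne (ne_of_mem_of_not_mem hj hi)]
    rw [this, Measure.prod_prod, Measure.infinitePi_pi _ (fun j _ => ht j), measure_univ, mul_one]

/-- Resampling the `i`-th coordinates of two independent families. -/
theorem lintegral_update_update [DecidableEq ι] (μ : Measure E) (ν : Measure F)
    [IsProbabilityMeasure μ] [IsProbabilityMeasure ν] (i : ι)
    {f : (ι → E) × (ι → F) → ℝ≥0∞} (hf : Measurable f) :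
    ∫⁻ p, f p ∂((Measure.infinitePi fun _ => μ).prod (Measure.infinitePi fun _ => ν)) =
      ∫⁻ p, ∫⁻ q, f (Function.update p.1 i q.1, Function.update p.2 i q.2) ∂(μ.prod ν)
        ∂((Measure.infinitePi fun _ => μ).prod (Measure.infinitePi fun _ => ν)) := by
  have hX := measurePreserving_update_infinitePi μ i
  have hY := measurePreserving_update_infinitePi ν i
  have hm : Measurable fun z : ((ι → E) × (ι → F)) × (E × F) =>
      f (Function.update z.1.1 i z.2.1, Function.update z.1.2 i z.2.2) := by
    refine hf.comp (Measurable.prodMk ?_ ?_)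
    · exact hX.measurable.comp (measurable_fst.fst.prodMk measurable_snd.fst)
    · exact hY.measurable.comp (measurable_fst.snd.prodMk measurable_snd.snd)
  rw [← (hX.prod hY).lintegral_comp hf]
  have h1 : ∀ x y, Measurable fun q : E × F =>
      f (Function.update x i q.1, Function.update y i q.2) := fun x y =>
    hm.comp (measurable_prodMk_left (x := (x, y)))
  have h2 : Measurable fun p : (ι → E) × (ι → F) =>
      ∫⁻ q, f (Function.update p.1 i q.1, Function.update p.2 i q.2) ∂(μ.prod ν) :=
    hm.lintegral_prod_right'
  have h3 : Measurable fun z : ((ι → E) × E) × ((ι → F) × F) =>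
      f (Prod.map (fun p : (ι → E) × E => Function.update p.1 i p.2)
        (fun p : (ι → F) × F => Function.update p.1 i p.2) z) :=
    hf.comp (hX.prod hY).measurable
  rw [lintegral_prod _ h3.aemeasurable,
    lintegral_prod _ h3.lintegral_prod_right'.aemeasurable,
    lintegral_prod _ h2.aemeasurable]
  refine lintegral_congr fun x => ?_
  simp only [Prod.map]
  have h4 : ∀ a, Measurable fun z : (ι → F) × F =>
      f (Function.update x i a, Function.update z.1 i z.2) := fun a =>
    h3.comp (measurable_prodMk_left (x := (x, a)))
  calc ∫⁻ a, ∫⁻ z : (ι → F) × F, f (Function.update x i a, Function.update z.1 i z.2)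
          ∂((Measure.infinitePi fun _ => ν).prod ν) ∂μ
      = ∫⁻ a, ∫⁻ y, ∫⁻ b, f (Function.update x i a, Function.update y i b) ∂ν
          ∂(Measure.infinitePi fun _ => ν) ∂μ :=
        lintegral_congr fun a => lintegral_prod _ (h4 a).aemeasurable
    _ = ∫⁻ y, ∫⁻ a, ∫⁻ b, f (Function.update x i a, Function.update y i b) ∂ν ∂μ
          ∂(Measure.infinitePi fun _ => ν) := by
        refine lintegral_lintegral_swap (Measurable.aemeasurable ?_)
        refine Measurable.lintegral_prod_right' (f := fun w : (E × (ι → F)) × F =>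
          f (Function.update x i w.1.1, Function.update w.1.2 i w.2)) ?_
        exact hm.comp (((measurable_const (a := x)).prodMk measurable_fst.snd).prodMk
          (measurable_fst.fst.prodMk measurable_snd))
    _ = _ := lintegral_congr fun y => (lintegral_prod _ (h1 x y).aemeasurable).symm

/-- A family built coordinate by coordinate from two independent i.i.d. families: if the `i`-th
output has law `ν` given all inputs other than the `i`-th ones, and does not influence outputs of
lower or equal rank, then the outputs are i.i.d. -/
theorem map_infinitePi_prod_of_rank [DecidableEq ι] (μ : Measure E) (μ' : Measure F)
    (ν : Measure H)
    [IsProbabilityMeasure μ] [IsProbabilityMeasure μ'] [IsProbabilityMeasure ν] (r : ι → ℕ)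
    {Z : (ι → E) × (ι → F) → ι → H} (hZ : Measurable Z)
    (h1 : ∀ x y i, (μ.prod μ').map
      (fun q => Z (Function.update x i q.1, Function.update y i q.2) i) = ν)
    (h2 : ∀ x y i j a b, j ≠ i → r j ≤ r i →
      Z (Function.update x i a, Function.update y i b) j = Z (x, y) j) :
    MeasurePreserving Z
      ((Measure.infinitePi fun _ => μ).prod (Measure.infinitePi fun _ => μ'))
      (Measure.infinitePi fun _ => ν) := by
  refine ⟨hZ, Measure.eq_infinitePi _ fun s t ht => ?_⟩
  have hmeas : ∀ s : Finset ι, MeasurableSet (Z ⁻¹' (Set.pi s t)) := fun s =>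
    hZ (.pi s.countable_toSet fun _ _ => ht _)
  rw [Measure.map_apply hZ (.pi s.countable_toSet fun _ _ => ht _)]
  induction hn : s.card generalizing s with
  | zero =>
    rw [Finset.card_eq_zero] at hn
    subst hn
    simp
  | succ n ih =>
    -- Peel off an index `i` of maximal rank. By `h2`, resampling its inputs changes none of the
    -- other outputs indexed by `s`, so after resampling the factor `ν (t i)` given by `h1` splits
    -- off.
    have hne : s.Nonempty := Finset.card_pos.mp (by omega)
    obtain ⟨i, hi, hmax⟩ := s.exists_max_image r hne
    have ih' := ih (s.erase i) (by rw [Finset.card_erase_of_mem hi]; omega)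
    rw [← lintegral_indicator_one (hmeas s),
      lintegral_update_update μ μ' i (measurable_one.indicator (hmeas s))]
    have key : ∀ p : (ι → E) × (ι → F), ∫⁻ q : E × F, (Z ⁻¹' (Set.pi s t)).indicator 1
        (Function.update p.1 i q.1, Function.update p.2 i q.2) ∂(μ.prod μ') =
        (Z ⁻¹' (Set.pi (s.erase i) t)).indicator 1 p * ν (t i) := by
      rintro ⟨x, y⟩
      have hmq : Measurable fun q : E × F =>
          Z (Function.update x i q.1, Function.update y i q.2) i := by
        refine (measurable_pi_apply i).comp (hZ.comp (Measurable.prodMk ?_ ?_))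
        · exact (measurePreserving_update_infinitePi μ i).measurable.comp
            (measurable_const.prodMk measurable_fst)
        · exact (measurePreserving_update_infinitePi μ' i).measurable.comp
            (measurable_const.prodMk measurable_snd)
      have hmem : ∀ q : E × F, (Z ⁻¹' (Set.pi s t)).indicator (1 : (ι → E) × (ι → F) → ℝ≥0∞)
          (Function.update x i q.1, Function.update y i q.2) =
          (Z ⁻¹' (Set.pi (s.erase i) t)).indicator 1 (x, y) *
          ((fun q : E × F => Z (Function.update x i q.1, Function.update y i q.2) i) ⁻¹' t i).indicator
            1 q := by
        intro q
        have : (Function.update x i q.1, Function.update y i q.2) ∈ Z ⁻¹' (Set.pi s t) ↔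
            (x, y) ∈ Z ⁻¹' (Set.pi (s.erase i) t) ∧
            Z (Function.update x i q.1, Function.update y i q.2) i ∈ t i := by
          simp only [Set.mem_preimage, Set.mem_pi, Finset.mem_coe, Finset.mem_erase]
          constructor
          · intro h
            refine ⟨fun j hj => ?_, h i hi⟩
            have := h j hj.2
            rwa [h2 x y i j _ _ hj.1 (hmax j hj.2)] at this
          · rintro ⟨h, h'⟩ j hj
            by_cases hji : j = i
            · subst hji; exact h'
            · rw [h2 x y i j _ _ hji (hmax j hj)]; exact h j ⟨hji, hj⟩
        simp only [Set.indicator, this, Set.mem_preimage (s := t i), Pi.one_apply]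
        split_ifs <;> simp_all
      rw [lintegral_congr hmem, lintegral_const_mul _ (measurable_one.indicator (hmq (ht i))),
        lintegral_indicator_one (hmq (ht i)), ← h1 x y i, Measure.map_apply hmq (ht i)]
    rw [lintegral_congr key, lintegral_mul_const _ (measurable_one.indicator (hmeas _)),
      lintegral_indicator_one (hmeas _), ih', Finset.prod_erase_mul _ _ hi]

/-- Independent coordinatewise recombination of two i.i.d. families. -/
theorem measurePreserving_infinitePi_prod_coord (μ : Measure E) (μ' : Measure F)
    (ν : Measure H)
    [IsProbabilityMeasure μ] [IsProbabilityMeasure μ'] [IsProbabilityMeasure ν]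
    {U : ι → E × F → H} (hU : ∀ i, MeasurePreserving (U i) (μ.prod μ') ν) :
    MeasurePreserving (fun p : (ι → E) × (ι → F) => fun i => U i (p.1 i, p.2 i))
      ((Measure.infinitePi fun _ => μ).prod (Measure.infinitePi fun _ => μ'))
      (Measure.infinitePi fun _ => ν) := by
  classical
  refine map_infinitePi_prod_of_rank μ μ' ν (fun _ => 0) ?_ ?_ ?_
  · refine measurable_pi_lambda _ fun i => (hU i).measurable.comp ?_
    exact ((measurable_pi_apply i).comp measurable_fst).prodMk
      ((measurable_pi_apply i).comp measurable_snd)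
  · intro x y i
    simpa using (hU i).map_eq
  · intro x y i j a b hij _
    simp [Function.update_of_ne hij]

theorem measurePreserving_infinitePi_reindex (μ : Measure E) [IsProbabilityMeasure μ]
    {σ : κ → ι} (hσ : Function.Injective σ) :
    MeasurePreserving (fun (x : ι → E) k => x (σ k)) (Measure.infinitePi fun _ => μ)
      (Measure.infinitePi fun _ => μ) :=
  ⟨by fun_prop, Measure.map_infinitePi_infinitePi_of_inj hσ⟩

theorem measurePreserving_infinitePi_sumElim (μ : Measure E) [IsProbabilityMeasure μ] :
    MeasurePreserving (fun p : (ι → E) × (κ → E) => (Sum.elim p.1 p.2 : ι ⊕ κ → E))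
      ((Measure.infinitePi fun _ => μ).prod (Measure.infinitePi fun _ => μ))
      (Measure.infinitePi fun _ => μ) := by
  have hm : Measurable (fun p : (ι → E) × (κ → E) => (Sum.elim p.1 p.2 : ι ⊕ κ → E)) := by
    refine measurable_pi_lambda _ ?_
    rintro (i | k)
    · exact (measurable_pi_apply i).comp measurable_fst
    · exact (measurable_pi_apply k).comp measurable_snd
  refine ⟨hm, Measure.eq_infinitePi _ fun s t ht => ?_⟩
  rw [Measure.map_apply hm (.pi s.countable_toSet fun _ _ => ht _)]
  have : (fun p : (ι → E) × (κ → E) => (Sum.elim p.1 p.2 : ι ⊕ κ → E)) ⁻¹' (Set.pi s t) =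
      (Set.pi (s.toLeft : Finset ι) fun i => t (.inl i)) ×ˢ
        (Set.pi (s.toRight : Finset κ) fun i => t (.inr i)) := by
    ext ⟨x, y⟩
    simp [Set.mem_pi]
  rw [this, Measure.prod_prod, Measure.infinitePi_pi _ (fun j _ => ht _),
    Measure.infinitePi_pi _ (fun j _ => ht _)]
  rw [← Finset.toLeft_disjSum_toRight (u := s), Finset.prod_disjSum]
  simp

/-- Picking distinct coordinates from two independent i.i.d. families with the same law. -/
theorem measurePreserving_infinitePi_prod_reindex {ι' : Type*} (μ : Measure E)
    [IsProbabilityMeasure μ] {σ : ι' → ι ⊕ κ} (hσ : Function.Injective σ) :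
    MeasurePreserving (fun (p : (ι → E) × (κ → E)) k => (Sum.elim p.1 p.2 : ι ⊕ κ → E) (σ k))
      ((Measure.infinitePi fun _ => μ).prod (Measure.infinitePi fun _ => μ))
      (Measure.infinitePi fun _ => μ) :=
  (measurePreserving_infinitePi_reindex μ hσ).comp (measurePreserving_infinitePi_sumElim μ)

end ProductMeasure

/-! ### Exponential times and coin tosses -/

instance : IsProbabilityMeasure (expMeasure 1) := isProbabilityMeasure_expMeasure one_pos

instance : IsProbabilityMeasure coinTosses := by unfold coinTosses; infer_instance

theorem lintegral_expMeasure_one {f : ℝ → ℝ≥0∞} (hf : Measurable f) :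
    ∫⁻ x, f x ∂(expMeasure 1) = ∫⁻ x in Set.Ioi 0, ENNReal.ofReal (Real.exp (-x)) * f x := by
  have hm : Measurable (gammaPDF 1 1) := (measurable_exponentialPDFReal 1).ennreal_ofReal
  rw [expMeasure, gammaMeasure, lintegral_withDensity_eq_lintegral_mul _ hm hf,
    ← lintegral_indicator measurableSet_Ioi]
  have h0 : ∀ᵐ x : ℝ, x ≠ 0 := by simp [ae_iff]
  refine lintegral_congr_ae ?_
  filter_upwards [h0] with x hx
  have h : gammaPDF 1 1 x = if 0 ≤ x then ENNReal.ofReal (Real.exp (-x)) else 0 := by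
    have := exponentialPDF_eq 1 x
    simp only [exponentialPDF] at this
    simp only [gammaPDF]
    change ENNReal.ofReal (exponentialPDFReal 1 x) = _
    rw [this]
    split_ifs <;> simp
  simp only [Pi.mul_apply, h, Set.indicator, Set.mem_Ioi]
  rcases lt_or_gt_of_ne hx with h' | h'
  · simp [h'.not_ge, h'.not_gt]
  · simp [h'.le, h']

theorem expMeasure_one_Ioi {r : ℝ} (hr : 0 ≤ r) :
    expMeasure 1 (Set.Ioi r) = ENNReal.ofReal (Real.exp (-r)) := by
  have h := cdf_expMeasure_eq one_pos r
  rw [cdf_eq_real, if_pos hr, one_mul] at h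
  rw [← Set.compl_Iic, prob_compl_eq_one_sub measurableSet_Iic, ← ofReal_measureReal, h,
    ← ENNReal.ofReal_one, ← ENNReal.ofReal_sub]
  · congr 1; ring
  · simpa using hr

theorem expMeasure_one_Iic {r : ℝ} (hr : r ≤ 0) : expMeasure 1 (Set.Iic r) = 0 := by
  have h := cdf_expMeasure_eq one_pos r
  rw [cdf_eq_real] at h
  rw [← ofReal_measureReal, h]
  split_ifs with h0
  · have : r = 0 := le_antisymm hr h0
    simp [this]
  · simp

/-- The lack of memory of the exponential distribution. -/
theorem measurePreserving_exp_resample (r : ℝ) :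
    MeasurePreserving (fun q : ℝ × ℝ => if q.1 ≤ r then q.1 else max r 0 + q.2)
      ((expMeasure 1).prod (expMeasure 1)) (expMeasure 1) := by
  have hm : Measurable (fun q : ℝ × ℝ => if q.1 ≤ r then q.1 else max r 0 + q.2) :=
    Measurable.ite (measurableSet_le measurable_fst measurable_const) measurable_fst
      (measurable_const.add measurable_snd)
  refine ⟨hm, Measure.ext_of_lintegral _ fun f hf => ?_⟩
  rw [lintegral_map hf hm, lintegral_prod _ (by exact (hf.comp hm).aemeasurable)]
  have h1 : ∀ x : ℝ, ∫⁻ y, f (if x ≤ r then x else max r 0 + y) ∂(expMeasure 1) =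
      (Set.Iic r).indicator f x +
        (Set.Ioi r).indicator (fun _ => ∫⁻ y, f (max r 0 + y) ∂(expMeasure 1)) x := by
    intro x
    by_cases hx : x ≤ r
    · simp [hx]
    · simp [hx, lt_of_not_ge hx]
  rw [lintegral_congr h1, lintegral_add_left (hf.indicator measurableSet_Iic),
    lintegral_indicator measurableSet_Ioi, lintegral_const, Measure.restrict_apply_univ]
  -- For `r ≤ 0` (a vertex not yet born at the cutting time) the first sample exceeds `r` almost
  -- surely and `max r 0 = 0`, so the output is just the second sample.
  rcases le_or_gt r 0 with hr | hr
  · have h2 : expMeasure 1 (Set.Ioi r) = 1 := by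
      rw [← Set.compl_Iic, prob_compl_eq_one_sub measurableSet_Iic, expMeasure_one_Iic hr]; simp
    rw [lintegral_indicator measurableSet_Iic, setLIntegral_measure_zero _ _ (expMeasure_one_Iic hr),
      h2, max_eq_right hr]
    simp
  · rw [expMeasure_one_Ioi hr.le, max_eq_left hr.le,
      lintegral_expMeasure_one (hf.indicator measurableSet_Iic), lintegral_expMeasure_one hf,
      lintegral_expMeasure_one (f := fun y => f (r + y)) (by fun_prop)]
    -- Translation by `r`: the product of `exp (-x)` and `exp (-r)` is the density at `r + x`.
    have h3 : (∫⁻ x in Set.Ioi 0, ENNReal.ofReal (Real.exp (-x)) * f (r + x)) *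
        ENNReal.ofReal (Real.exp (-r)) =
        ∫⁻ x in Set.Ioi r, ENNReal.ofReal (Real.exp (-x)) * f x := by
      rw [← lintegral_mul_const _ (by fun_prop), ← lintegral_indicator measurableSet_Ioi,
        ← lintegral_indicator measurableSet_Ioi, ← lintegral_add_left_eq_self
          ((Set.Ioi r).indicator fun x => ENNReal.ofReal (Real.exp (-x)) * f x) r]
      refine lintegral_congr fun x => ?_
      simp only [Set.indicator, Set.mem_Ioi, lt_add_iff_pos_right]
      split_ifs
      · rw [mul_right_comm, ← ENNReal.ofReal_mul (Real.exp_nonneg _), ← Real.exp_add]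
        congr 3; ring
      · rfl
    rw [h3, ← lintegral_indicator measurableSet_Ioi, ← lintegral_indicator measurableSet_Ioi,
      ← lintegral_indicator measurableSet_Ioi, ← lintegral_add_left]
    · refine lintegral_congr fun x => ?_
      simp only [Set.indicator, Set.mem_Ioi, Set.mem_Iic]
      split_ifs <;> first | (exfalso; linarith) | simp
    · exact ((Measurable.mul (by fun_prop) (hf.indicator measurableSet_Iic))).indicator
        measurableSet_Ioi

/-! ### Splicing coin sequences -/

/-- Follow `ξ` until its initial segment satisfies `D`, and a fresh sequence `ξ'` from then on. -/
def splice (D : List Bool → Prop) (ξ ξ' : ℕ → Bool) (k : ℕ) : Bool :=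
  open Classical in
  if h : ∃ n, n ≤ k ∧ D ((List.range n).map ξ) then ξ' (k - Nat.find h) else ξ k

theorem splice_of_lt {D : List Bool → Prop} {ξ ξ' : ℕ → Bool} {k : ℕ}
    (h : ∀ n ≤ k, ¬ D ((List.range n).map ξ)) : splice D ξ ξ' k = ξ k := by
  rw [splice, dif_neg]
  rintro ⟨n, hn, hD⟩
  exact h n hn hD

theorem splice_add {D : List Bool → Prop} {ξ ξ' : ℕ → Bool} {n : ℕ}
    (hn : D ((List.range n).map ξ)) (h : ∀ m < n, ¬ D ((List.range m).map ξ)) (k : ℕ) :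
    splice D ξ ξ' (n + k) = ξ' k := by
  classical
  have hex : ∃ m, m ≤ n + k ∧ D ((List.range m).map ξ) := ⟨n, by omega, hn⟩
  rw [splice, dif_pos hex]
  have : Nat.find hex = n := by
    refine le_antisymm (Nat.find_min' hex ⟨by omega, hn⟩) ?_
    by_contra hlt
    exact h _ (not_le.mp hlt) (Nat.find_spec hex).2
  rw [this, Nat.add_sub_cancel_left]

theorem coinTosses_cylinder (N : ℕ) (a : ℕ → Bool) :
    coinTosses {ξ | ∀ k < N, ξ k = a k} = (1 / 2) ^ N := by
  have : {ξ : ℕ → Bool | ∀ k < N, ξ k = a k} =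
      Set.pi (Finset.range N : Finset ℕ) (fun k => {a k}) := by
    ext ξ; simp
  rw [this, coinTosses, Measure.infinitePi_pi _ (fun _ _ => measurableSet_singleton _)]
  simp

/-- Probability measures on coin sequences are determined by initial segments. -/
theorem eq_coinTosses {μ : Measure (ℕ → Bool)}
    (h : ∀ (N : ℕ) (a : ℕ → Bool), μ {ξ | ∀ k < N, ξ k = a k} = (1 / 2) ^ N) : μ = coinTosses := by
  classical
  refine Measure.eq_infinitePi _ fun s t _ => ?_
  rw [← Measure.infinitePi_pi _ (fun i _ => MeasurableSet.of_discrete)]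
  change μ _ = coinTosses _
  obtain ⟨N, hN⟩ : ∃ N, ∀ i ∈ s, i < N := ⟨s.sup id + 1, fun i hi =>
    Nat.lt_succ_of_le (Finset.le_sup (f := id) hi)⟩
  -- The box only constrains coordinates below `N`, so it is a finite disjoint union of cylinders on
  -- the first `N` coins. The padding by `false` is immaterial.
  let ext : (Fin N → Bool) → ℕ → Bool := fun a k => if hk : k < N then a ⟨k, hk⟩ else false
  let A : Finset (Fin N → Bool) := {a | ext a ∈ Set.pi s t}
  have hset : Set.pi (s : Set ℕ) t = ⋃ a ∈ A, {ξ : ℕ → Bool | ∀ k < N, ξ k = ext a k} := by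
    ext ξ
    simp only [Set.mem_iUnion, Set.mem_ofPred_eq, exists_prop, A, Finset.mem_filter,
      Finset.mem_univ, true_and]
    constructor
    · intro hξ
      have : ∀ k < N, ξ k = ext (fun i => ξ i) k := fun k hk => by simp [ext, hk]
      refine ⟨fun i => ξ i, fun i hi => ?_, this⟩
      rw [← this i (hN i hi)]; exact hξ i hi
    · rintro ⟨a, ha, hξ⟩ i hi
      rw [hξ i (hN i hi)]; exact ha i hi
  have hd : Set.PairwiseDisjoint (A : Set (Fin N → Bool))
      (fun a => {ξ : ℕ → Bool | ∀ k < N, ξ k = ext a k}) := by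
    intro a _ b _ hab
    refine Set.disjoint_left.mpr fun ξ ha hb => hab (funext fun i => ?_)
    have := (ha i i.2).symm.trans (hb i i.2)
    simpa [ext] using this
  have hms : ∀ a : ℕ → Bool, MeasurableSet {ξ : ℕ → Bool | ∀ k < N, ξ k = a k} := fun a => by
    measurability
  rw [hset, measure_biUnion_finset hd fun a _ => hms _,
    measure_biUnion_finset hd fun a _ => hms _]
  refine Finset.sum_congr rfl fun a _ => ?_
  rw [h, coinTosses_cylinder]

theorem measurable_map_range_eq {Ω : Type*} [MeasurableSpace Ω] {ξ : Ω → ℕ → Bool}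
    (hξ : Measurable ξ) (n : ℕ) (w : List Bool) :
    Measurable fun ω => (List.range n).map (ξ ω) = w := by
  have : (fun ω => (List.range n).map (ξ ω) = w) =
      fun ω => w.length = n ∧ ∀ (k : ℕ) (hk : k < w.length), ξ ω k = w[k] := by
    ext ω
    constructor
    · rintro rfl
      simp
    · rintro ⟨rfl, h⟩
      exact List.ext_getElem (by simp) fun k hk hk' => by simp [h k hk']
  rw [this]
  refine measurable_const.and (Measurable.forall fun k => Measurable.forall fun hk => ?_)
  exact measurableSet_setOfPred.mp (((measurable_pi_apply k).comp hξ)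
    (measurableSet_singleton w[k]))

/-- The stopping rule may itself be random. Each output coin is decided by a countable case
distinction on the first stopping index. -/
theorem measurable_splice_uncurry {Ω : Type*} [MeasurableSpace Ω] {D : Ω → List Bool → Prop}
    (hD : ∀ w, MeasurableSet {ω | D ω w}) {ξ ξ' : Ω → ℕ → Bool} (hξ : Measurable ξ)
    (hξ' : Measurable ξ') : Measurable fun ω => splice (D ω) (ξ ω) (ξ' ω) := by
  classical
  have h1 : ∀ n, Measurable fun ω => D ω ((List.range n).map (ξ ω)) := by
    intro n
    have : (fun ω => D ω ((List.range n).map (ξ ω))) =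
        fun ω => ∃ w, (List.range n).map (ξ ω) = w ∧ D ω w := by
      ext ω
      simp
    rw [this]
    exact Measurable.exists fun w => (measurable_map_range_eq hξ n w).and
      (measurableSet_setOfPred.mp (hD w))
  refine measurable_pi_lambda _ fun k => measurable_to_bool ?_
  have : (fun ω => splice (D ω) (ξ ω) (ξ' ω) k) ⁻¹' {true} =
      {ω | (∃ n, n ≤ k ∧ D ω ((List.range n).map (ξ ω)) ∧
        (∀ m < n, ¬ D ω ((List.range m).map (ξ ω))) ∧ ξ' ω (k - n) = true) ∨
        ((∀ n ≤ k, ¬ D ω ((List.range n).map (ξ ω))) ∧ ξ ω k = true)} := by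
    ext ω
    simp only [Set.mem_preimage, Set.mem_singleton_iff, Set.mem_ofPred_eq]
    by_cases h : ∃ n, n ≤ k ∧ D ω ((List.range n).map (ξ ω))
    · have hs := Nat.find_spec h
      have hmin : ∀ m < Nat.find h, ¬ D ω ((List.range m).map (ξ ω)) := fun m hm hD =>
        Nat.find_min h hm ⟨by omega, hD⟩
      have heq : splice (D ω) (ξ ω) (ξ' ω) k = ξ' ω (k - Nat.find h) := by
        rw [splice, dif_pos h]
      rw [heq]
      constructor
      · intro h'
        exact Or.inl ⟨_, hs.1, hs.2, hmin, h'⟩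
      · rintro (⟨n, hn, hD, hn', h'⟩ | ⟨h', -⟩)
        · have : Nat.find h = n := by
            refine le_antisymm (Nat.find_min' h ⟨hn, hD⟩) ?_
            by_contra hlt
            exact hn' _ (not_le.mp hlt) hs.2
          rw [this]; exact h'
        · exact absurd hs.2 (h' _ hs.1)
    · have h' : ∀ n ≤ k, ¬ D ω ((List.range n).map (ξ ω)) := fun n hn hD => h ⟨n, hn, hD⟩
      rw [splice_of_lt h']
      constructor
      · exact fun h'' => Or.inr ⟨h', h''⟩
      · rintro (⟨n, hn, hD, -⟩ | ⟨-, h''⟩)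
        · exact absurd hD (h' n hn)
        · exact h''
  rw [this]
  refine measurableSet_setOfPred.mpr (Measurable.or (Measurable.exists fun n => ?_) ?_)
  · refine measurable_const.and ((h1 n).and (Measurable.and ?_ ?_))
    · exact Measurable.forall fun m => Measurable.forall fun _ => (h1 m).not
    · exact measurableSet_setOfPred.mp (((measurable_pi_apply (k - n)).comp hξ')
        (measurableSet_singleton true))
  · refine Measurable.and ?_ ?_
    · exact Measurable.forall fun m => Measurable.forall fun _ => (h1 m).not
    · exact measurableSet_setOfPred.mp (((measurable_pi_apply k).comp hξ)
        (measurableSet_singleton true))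

/-- The strong Markov property of coin tossing. Whether `D` has occurred by step `n` depends on the
first `n` coins only, so on a cylinder with pattern `a` the stopping index is a function of `a`, and
the cylinder pulls back to a product of two cylinders of total length `N`. -/
theorem measurePreserving_splice (D : List Bool → Prop) :
    MeasurePreserving (fun q : (ℕ → Bool) × (ℕ → Bool) => splice D q.1 q.2)
      (coinTosses.prod coinTosses) coinTosses := by
  classical
  have hm : Measurable (fun q : (ℕ → Bool) × (ℕ → Bool) => splice D q.1 q.2) :=
    measurable_splice_uncurry (D := fun _ => D) (fun w => MeasurableSet.const _) measurable_fst
      measurable_snd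
  refine ⟨hm, eq_coinTosses fun N a => ?_⟩
  rw [Measure.map_apply hm (by measurability)]
  have hpre : ∀ {ξ : ℕ → Bool} {n : ℕ}, (∀ k < n, ξ k = a k) →
      (List.range n).map ξ = (List.range n).map a := fun h =>
    List.map_congr_left fun k hk => h k (List.mem_range.mp hk)
  by_cases hex : ∃ n, n ≤ N ∧ D ((List.range n).map a)
  · set n := Nat.find hex with hn
    have hnN : n ≤ N := (Nat.find_spec hex).1
    have hnD : D ((List.range n).map a) := (Nat.find_spec hex).2
    have hmin : ∀ m < n, ¬ D ((List.range m).map a) := fun m hm hD =>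
      Nat.find_min hex hm ⟨by omega, hD⟩
    have : (fun q : (ℕ → Bool) × (ℕ → Bool) => splice D q.1 q.2) ⁻¹' {ξ | ∀ k < N, ξ k = a k} =
        {ξ | ∀ k < n, ξ k = a k} ×ˢ {ξ | ∀ k < N - n, ξ k = a (n + k)} := by
      ext ⟨ξ, ξ'⟩
      simp only [Set.mem_preimage, Set.mem_ofPred_eq, Set.mem_prod]
      constructor
      · intro h
        -- The prefix is identified one coin at a time: knowing that the first `j` coins are those
        -- of `a` shows that no stop has occurred, hence that the spliced coin `j` is `ξ j`.
        have h1 : ∀ k ≤ n, ∀ j < k, ξ j = a j := by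
          intro k
          induction k with
          | zero => intro _ j hj; omega
          | succ k ih =>
            intro hk j hj
            have ihk := ih (by omega)
            rcases Nat.lt_succ_iff_lt_or_eq.mp hj with hj | rfl
            · exact ihk j hj
            · rw [← h j (by omega), splice_of_lt]
              intro m hm
              rw [hpre fun i hi => ihk i (by omega)]
              exact hmin m (by omega)
        have h2 := h1 n le_rfl
        refine ⟨h2, fun k hk => ?_⟩
        rw [← h (n + k) (by omega), splice_add]
        · rw [hpre h2]; exact hnD
        · intro m hm
          rw [hpre fun i hi => h2 i (by omega)]
          exact hmin m hm
      · rintro ⟨h1, h2⟩ k hk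
        rcases lt_or_ge k n with hkn | hkn
        · rw [splice_of_lt, h1 k hkn]
          intro m hm
          rw [hpre fun i hi => h1 i (by omega)]
          exact hmin m (by omega)
        · obtain ⟨j, rfl⟩ := Nat.exists_eq_add_of_le hkn
          rw [splice_add, h2 j (by omega)]
          · rw [hpre h1]; exact hnD
          · intro m hm
            rw [hpre fun i hi => h1 i (by omega)]
            exact hmin m hm
    rw [this, Measure.prod_prod, coinTosses_cylinder,
      coinTosses_cylinder (N - n) fun k => a (n + k), ← pow_add, Nat.add_sub_cancel' hnN]
  · have hno : ∀ m ≤ N, ¬ D ((List.range m).map a) := fun m hm hD => hex ⟨m, hm, hD⟩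
    have : (fun q : (ℕ → Bool) × (ℕ → Bool) => splice D q.1 q.2) ⁻¹' {ξ | ∀ k < N, ξ k = a k} =
        {ξ | ∀ k < N, ξ k = a k} ×ˢ Set.univ := by
      ext ⟨ξ, ξ'⟩
      simp only [Set.mem_preimage, Set.mem_ofPred_eq, Set.mem_prod, Set.mem_univ, and_true]
      constructor
      · intro h
        have h1 : ∀ k ≤ N, ∀ j < k, ξ j = a j := by
          intro k
          induction k with
          | zero => intro _ j hj; omega
          | succ k ih =>
            intro hk j hj
            have ihk := ih (by omega)
            rcases Nat.lt_succ_iff_lt_or_eq.mp hj with hj | rfl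
            · exact ihk j hj
            · rw [← h j (by omega), splice_of_lt]
              intro m hm
              rw [hpre fun i hi => ihk i (by omega)]
              exact hno m (by omega)
        exact h1 N le_rfl
      · intro h1 k hk
        rw [splice_of_lt, h1 k hk]
        intro m hm
        rw [hpre fun i hi => h1 i (by omega)]
        exact hno m (by omega)
    rw [this, Measure.prod_prod, coinTosses_cylinder, measure_univ, mul_one]

theorem measurePreserving_coin_cons :
    MeasurePreserving (fun q : Bool × (ℕ → Bool) => (fun k => Nat.casesOn k q.1 q.2 : ℕ → Bool))
      ((PMF.uniformOfFintype Bool).toMeasure.prod coinTosses) coinTosses := by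
  have hm : Measurable (fun q : Bool × (ℕ → Bool) =>
      (fun k => Nat.casesOn k q.1 q.2 : ℕ → Bool)) := by
    refine measurable_pi_lambda _ fun k => ?_
    cases k with
    | zero => exact measurable_fst
    | succ k => exact (measurable_pi_apply k).comp measurable_snd
  refine ⟨hm, eq_coinTosses fun N a => ?_⟩
  rw [Measure.map_apply hm (by measurability)]
  cases N with
  | zero => simp
  | succ N =>
    have : (fun q : Bool × (ℕ → Bool) => (fun k => Nat.casesOn k q.1 q.2 : ℕ → Bool)) ⁻¹'
        {ξ | ∀ k < N + 1, ξ k = a k} = {a 0} ×ˢ {ξ | ∀ k < N, ξ k = a (k + 1)} := by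
      ext ⟨b, ξ⟩
      simp only [Set.mem_preimage, Set.mem_ofPred_eq, Set.mem_prod, Set.mem_singleton_iff]
      constructor
      · intro h
        exact ⟨h 0 (by omega), fun k hk => h (k + 1) (by omega)⟩
      · rintro ⟨h0, h1⟩ k hk
        cases k with
        | zero => exact h0
        | succ k => exact h1 k (by omega)
    rw [this, Measure.prod_prod, coinTosses_cylinder N fun k => a (k + 1)]
    simp [pow_succ, mul_comm]

/-! ### The process started from a single vertex, as a random environment on the binary tree -/

/-- What happens at a vertex: its lifetime, the number of edges created at its split, and the
coins followed by the ends of these edges. -/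
abbrev Node : Type := ℝ × ℕ × (ℕ × Bool → ℕ → Bool)

/-- Words are read from the first split downwards, so recursion on a word amounts to conditioning on
the first split. -/
abbrev Env : Type := List Bool → Node

open Classical in
/-- The indicator of a proposition. -/
def ind (P : Prop) : ℝ≥0∞ := if P then 1 else 0

theorem ind_of {P : Prop} (h : P) : ind P = 1 := if_pos h

theorem ind_not {P : Prop} (h : ¬ P) : ind P = 0 := if_neg h

theorem ind_le_one (P : Prop) : ind P ≤ 1 := by
  by_cases h : P
  · rw [ind_of h]
  · rw [ind_not h]; exact zero_le_one

theorem ind_le_of_imp {P : Prop} {a : ℝ≥0∞} (h : P → 1 ≤ a) : ind P ≤ a := by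
  by_cases hP : P
  · rw [ind_of hP]; exact h hP
  · rw [ind_not hP]; exact zero_le

theorem measurable_ind {Ω : Type*} [MeasurableSpace Ω] {P : Ω → Prop} (h : Measurable P) :
    Measurable fun a => ind (P a) :=
  Measurable.ite (measurableSet_setOfPred.mpr h) measurable_const measurable_const

theorem lintegral_ind {Ω : Type*} [MeasurableSpace Ω] (μ : Measure Ω) {P : Ω → Prop}
    (h : Measurable P) : ∫⁻ a, ind (P a) ∂μ = μ {a | P a} := by
  rw [← lintegral_indicator_one (measurableSet_setOfPred.mpr h)]
  refine lintegral_congr fun a => ?_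
  by_cases ha : P a
  · rw [ind_of ha, Set.indicator_of_mem (by exact ha)]; rfl
  · rw [ind_not ha, Set.indicator_of_notMem (by exact ha)]

namespace Env

/-- The environment seen from the offspring `b` of the root. -/
def sub (ω : Env) (b : Bool) : Env := fun w => ω (b :: w)

/-- The environment with root data `X`, with `ω₁` on the side `b` and `ω₂` on the other side. -/
def join (X : Node) (b : Bool) (ω₁ ω₂ : Env) : Env
  | [] => X
  | c :: w => if c = b then ω₁ w else ω₂ w

/-- The marker following the coins `ξ` is at the vertex `u` at time `τ`. -/
def AtLeaf : List Bool → ℝ → Env → (ℕ → Bool) → Prop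
  | [], τ, ω, _ => τ < (ω []).1
  | b :: u, τ, ω, ξ => (ω []).1 ≤ τ ∧ ξ 0 = b ∧
      AtLeaf u (τ - (ω []).1) (ω.sub b) (fun k => ξ (k + 1))

/-- The vertices `u` and `v` are present and adjacent at time `τ`. -/
def Adj : List Bool → List Bool → ℝ → Env → Prop
  | b :: u, c :: v, τ, ω => (ω []).1 ≤ τ ∧
      ((b = c ∧ Adj u v (τ - (ω []).1) (ω.sub b)) ∨
        (b ≠ c ∧ ∃ i < (ω []).2.1, AtLeaf u (τ - (ω []).1) (ω.sub b) ((ω []).2.2 (i, b)) ∧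
          AtLeaf v (τ - (ω []).1) (ω.sub c) ((ω []).2.2 (i, c))))
  | _, _, _, _ => False

/-- The `i`-th edge created at the split of `w` is incident with `u` at time `τ`. -/
def Inc : List Bool → ℕ → List Bool → ℝ → Env → Prop
  | [], i, b :: u, τ, ω => (ω []).1 ≤ τ ∧ i < (ω []).2.1 ∧
      AtLeaf u (τ - (ω []).1) (ω.sub b) ((ω []).2.2 (i, b))
  | c :: w, i, b :: u, τ, ω => (ω []).1 ≤ τ ∧ c = b ∧ Inc w i u (τ - (ω []).1) (ω.sub c)
  | _, _, [], _, _ => False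

def Conn (u v : List Bool) (τ : ℝ) (ω : Env) : Prop :=
  Relation.ReflTransGen (fun x y => Adj x y τ ω) u v

/-- Two markers are in the same component at time `τ`. -/
def MConn (τ : ℝ) (ω : Env) (x y : ℕ → Bool) : Prop :=
  ∃ u v, AtLeaf u τ ω x ∧ Conn u v τ ω ∧ AtLeaf v τ ω y

/-- The vertex `v` is in the component of the marker `x` at time `τ`. -/
def Reach (τ : ℝ) (ω : Env) (x : ℕ → Bool) (v : List Bool) : Prop :=
  ∃ u, AtLeaf u τ ω x ∧ Conn u v τ ω

/-- The number of vertices of depth at most `n` in the component of the marker `x`. -/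
def clusterCount (n : ℕ) (τ : ℝ) (ω : Env) (x : ℕ → Bool) : ℝ≥0∞ :=
  ∑' v : List Bool, ind (v.length ≤ n ∧ Reach τ ω x v)

/-- The number of edges created at depth less than `n` that meet the vertex of the marker `x`. -/
def degreeCount (n : ℕ) (τ : ℝ) (ω : Env) (x : ℕ → Bool) : ℝ≥0∞ :=
  ∑' w : List Bool, ∑' i : ℕ,
    ind (w.length < n ∧ ∃ u, AtLeaf u τ ω x ∧ Inc w i u τ ω)

/-- The probability that an independent marker is in the component of the marker `x`. -/
def weight (τ : ℝ) (ω : Env) (x : ℕ → Bool) : ℝ≥0∞ := coinTosses {y | MConn τ ω x y}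

/-! #### Measurability -/

theorem measurable_sub (b : Bool) : Measurable fun ω : Env => ω.sub b :=
  measurable_pi_lambda _ fun w => measurable_pi_apply (b :: w)

/-- Reachability is a countable union over finite chains, each of which is a finite intersection of
relation events. -/
theorem measurable_reflTransGen {Ω α : Type*} [MeasurableSpace Ω] [Countable α]
    {r : Ω → α → α → Prop} (hr : ∀ x y, Measurable fun ω => r ω x y) (x y : α) :
    Measurable fun ω => Relation.ReflTransGen (r ω) x y := by
  have h1 : ∀ (n : ℕ) (z : α), Measurable fun ω => ∃ l : List α, l.length = n ∧
      List.IsChain (r ω) (x :: l) ∧ (x :: l).getLast (List.cons_ne_nil _ _) = z := by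
    intro n z
    refine Measurable.exists fun l => measurable_const.and (Measurable.and ?_ measurable_const)
    generalize x = x'
    induction l generalizing x' with
    | nil => simp
    | cons a l ih => simpa [List.isChain_cons_cons] using (hr x' a).and (ih a)
  have h2 : (fun ω => Relation.ReflTransGen (r ω) x y) = fun ω => ∃ n, ∃ l : List α, l.length = n ∧
      List.IsChain (r ω) (x :: l) ∧ (x :: l).getLast (List.cons_ne_nil _ _) = y := by
    ext ω
    constructor
    · intro h
      obtain ⟨l, hl, hl'⟩ := List.exists_isChain_cons_of_relationReflTransGen h
      exact ⟨_, l, rfl, hl, hl'⟩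
    · rintro ⟨n, l, -, hl, hl'⟩
      exact hl' ▸ List.relationReflTransGen_of_exists_isChain_cons l hl rfl
  rw [h2]
  exact Measurable.exists fun n => h1 n y

section Measurability

variable {Ω : Type*} [MeasurableSpace Ω] {τ : Ω → ℝ} {ω : Ω → Env} {x y : Ω → ℕ → Bool}

theorem measurable_lifetime (hω : Measurable ω) (w : List Bool) :
    Measurable fun a => (ω a w).1 := ((measurable_pi_apply w).comp hω).fst

theorem measurable_ends (hω : Measurable ω) (w : List Bool) (p : ℕ × Bool) :
    Measurable fun a => (ω a w).2.2 p :=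
  (measurable_pi_apply p).comp ((measurable_pi_apply w).comp hω).snd.snd

theorem measurable_lt_newEdges (hω : Measurable ω) (w : List Bool) (i : ℕ) :
    Measurable fun a => i < (ω a w).2.1 :=
  measurableSet_setOfPred.mp
    (measurableSet_lt measurable_const ((measurable_pi_apply w).comp hω).snd.fst)

theorem measurable_atLeaf (hτ : Measurable τ) (hω : Measurable ω) (hx : Measurable x)
    (u : List Bool) : Measurable fun a => AtLeaf u (τ a) (ω a) (x a) := by
  induction u generalizing τ ω x with
  | nil => exact measurableSet_setOfPred.mp (measurableSet_lt hτ (measurable_lifetime hω []))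
  | cons b u ih =>
    refine Measurable.and ?_ (Measurable.and ?_ ?_)
    · exact measurableSet_setOfPred.mp (measurableSet_le (measurable_lifetime hω []) hτ)
    · exact measurableSet_setOfPred.mp
        (((measurable_pi_apply 0).comp hx) (measurableSet_singleton b))
    · exact ih (hτ.sub (measurable_lifetime hω [])) ((measurable_sub b).comp hω)
        (measurable_pi_lambda _ fun k => (measurable_pi_apply (k + 1)).comp hx)

theorem measurable_adj (hτ : Measurable τ) (hω : Measurable ω) (u v : List Bool) :
    Measurable fun a => Adj u v (τ a) (ω a) := by
  induction u generalizing τ ω v with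
  | nil => simp only [Adj]; exact measurable_const
  | cons b u ih =>
    cases v with
    | nil => simp only [Adj]; exact measurable_const
    | cons c v =>
      have hτ' := hτ.sub (measurable_lifetime hω [])
      refine Measurable.and ?_ (Measurable.or ?_ ?_)
      · exact measurableSet_setOfPred.mp (measurableSet_le (measurable_lifetime hω []) hτ)
      · exact measurable_const.and (ih hτ' ((measurable_sub b).comp hω) v)
      · refine measurable_const.and (Measurable.exists fun i => ?_)
        exact (measurable_lt_newEdges hω [] i).and
          ((measurable_atLeaf hτ' ((measurable_sub b).comp hω) (measurable_ends hω [] _) u).and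
            (measurable_atLeaf hτ' ((measurable_sub c).comp hω) (measurable_ends hω [] _) v))

theorem measurable_inc (hτ : Measurable τ) (hω : Measurable ω) (w : List Bool) (i : ℕ)
    (u : List Bool) : Measurable fun a => Inc w i u (τ a) (ω a) := by
  induction w generalizing τ ω u with
  | nil =>
    cases u with
    | nil => simp only [Inc]; exact measurable_const
    | cons b u =>
      refine Measurable.and ?_ ((measurable_lt_newEdges hω [] i).and ?_)
      · exact measurableSet_setOfPred.mp (measurableSet_le (measurable_lifetime hω []) hτ)
      · exact measurable_atLeaf (hτ.sub (measurable_lifetime hω [])) ((measurable_sub b).comp hω)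
          (measurable_ends hω [] _) u
  | cons c w ih =>
    cases u with
    | nil => simp only [Inc]; exact measurable_const
    | cons b u =>
      refine Measurable.and ?_ (measurable_const.and ?_)
      · exact measurableSet_setOfPred.mp (measurableSet_le (measurable_lifetime hω []) hτ)
      · exact ih (hτ.sub (measurable_lifetime hω [])) ((measurable_sub c).comp hω) u

theorem measurable_conn (hτ : Measurable τ) (hω : Measurable ω) (u v : List Bool) :
    Measurable fun a => Conn u v (τ a) (ω a) :=
  measurable_reflTransGen (fun x y => measurable_adj hτ hω x y) u v

theorem measurable_mconn (hτ : Measurable τ) (hω : Measurable ω) (hx : Measurable x)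
    (hy : Measurable y) : Measurable fun a => MConn (τ a) (ω a) (x a) (y a) :=
  Measurable.exists fun u => Measurable.exists fun v => (measurable_atLeaf hτ hω hx u).and
    ((measurable_conn hτ hω u v).and (measurable_atLeaf hτ hω hy v))

theorem measurable_clusterCount (hτ : Measurable τ) (hω : Measurable ω) (hx : Measurable x)
    (n : ℕ) : Measurable fun a => clusterCount n (τ a) (ω a) (x a) := by
  refine Measurable.tsum fun v => measurable_ind ?_
  exact (measurable_const.and (Measurable.exists fun u =>
    (measurable_atLeaf hτ hω hx u).and (measurable_conn hτ hω u v)))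

theorem measurable_degreeCount (hτ : Measurable τ) (hω : Measurable ω) (hx : Measurable x)
    (n : ℕ) : Measurable fun a => degreeCount n (τ a) (ω a) (x a) := by
  refine Measurable.tsum fun w => Measurable.tsum fun i => measurable_ind ?_
  exact (measurable_const.and (Measurable.exists fun u =>
    (measurable_atLeaf hτ hω hx u).and (measurable_inc hτ hω w i u)))

theorem measurable_weight (hτ : Measurable τ) (hω : Measurable ω) (hx : Measurable x) :
    Measurable fun a => weight (τ a) (ω a) (x a) := by
  have h : MeasurableSet {q : Ω × (ℕ → Bool) | MConn (τ q.1) (ω q.1) (x q.1) q.2} :=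
    measurableSet_setOfPred.mpr (measurable_mconn (hτ.comp measurable_fst)
      (hω.comp measurable_fst) (hx.comp measurable_fst) measurable_snd)
  exact measurable_measure_prodMk_left h

end Measurability

/-! #### Decomposition at the first split -/

theorem AtLeaf.unique {u v : List Bool} {τ : ℝ} {ω : Env} {ξ : ℕ → Bool} (hu : AtLeaf u τ ω ξ)
    (hv : AtLeaf v τ ω ξ) : u = v := by
  induction u generalizing v τ ω ξ with
  | nil =>
    cases v with
    | nil => rfl
    | cons c v => exact absurd hu (not_lt.mpr hv.1)
  | cons b u ih =>
    cases v with
    | nil => exact absurd hv (not_lt.mpr hu.1)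
    | cons c v =>
      obtain ⟨-, hb, hu⟩ := hu
      obtain ⟨-, hc, hv⟩ := hv
      obtain rfl : b = c := hb.symm.trans hc
      rw [ih hu hv]

theorem Adj.symm {u v : List Bool} {τ : ℝ} {ω : Env} (h : Adj u v τ ω) : Adj v u τ ω := by
  induction u generalizing v τ ω with
  | nil => simp [Adj] at h
  | cons b u ih =>
    cases v with
    | nil => simp [Adj] at h
    | cons c v =>
      obtain ⟨hl, (⟨rfl, h⟩ | ⟨hne, i, hi, h1, h2⟩)⟩ := h
      · exact ⟨hl, Or.inl ⟨rfl, ih h⟩⟩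
      · exact ⟨hl, Or.inr ⟨hne.symm, i, hi, h2, h1⟩⟩

theorem Conn.symm {u v : List Bool} {τ : ℝ} {ω : Env} (h : Conn u v τ ω) : Conn v u τ ω := by
  induction h with
  | refl => exact Relation.ReflTransGen.refl
  | tail _ hadj ih => exact ih.head hadj.symm

/-- The component of a vertex, decomposed at the split of the root: a vertex on the other side is
reached through new edges, and a vertex on the same side is reached directly or with two new edges
that meet a common component on the other side. -/
theorem conn_cons {b : Bool} {u z : List Bool} {τ : ℝ} {ω : Env}
    (h : Conn (b :: u) z τ ω) :
    (∃ v, z = b :: v ∧ (Conn u v (τ - (ω []).1) (ω.sub b) ∨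
      ((∃ i < (ω []).2.1, Reach (τ - (ω []).1) (ω.sub b) ((ω []).2.2 (i, b)) u) ∧
        (∃ i < (ω []).2.1, ∃ k < (ω []).2.1, i ≠ k ∧ MConn (τ - (ω []).1) (ω.sub (!b))
          ((ω []).2.2 (i, !b)) ((ω []).2.2 (k, !b))) ∧
        ∃ j < (ω []).2.1, Reach (τ - (ω []).1) (ω.sub b) ((ω []).2.2 (j, b)) v))) ∨
    (∃ v, z = (!b) :: v ∧
      (∃ i < (ω []).2.1, Reach (τ - (ω []).1) (ω.sub b) ((ω []).2.2 (i, b)) u) ∧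
      ∃ j < (ω []).2.1, Reach (τ - (ω []).1) (ω.sub (!b)) ((ω []).2.2 (j, !b)) v) := by
  set r := τ - (ω []).1 with hr
  set e := (ω []).2.2 with he
  set K := (ω []).2.1 with hK
  -- The induction along a path needs a finer invariant on the other side: whether the current
  -- vertex is still attached to the very edge by which the path first crossed. Without this,
  -- recrossing that edge could not be recognised as a return to the original component.
  suffices H : (∃ v, z = b :: v ∧ (Conn u v r (ω.sub b) ∨
      ((∃ i < K, Reach r (ω.sub b) (e (i, b)) u) ∧
        (∃ i < K, ∃ k < K, i ≠ k ∧ MConn r (ω.sub (!b)) (e (i, !b)) (e (k, !b))) ∧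
        ∃ j < K, Reach r (ω.sub b) (e (j, b)) v))) ∨
    (∃ v, z = (!b) :: v ∧
      ((∃ i < K, Reach r (ω.sub b) (e (i, b)) u ∧ Reach r (ω.sub (!b)) (e (i, !b)) v) ∨
      ((∃ i < K, Reach r (ω.sub b) (e (i, b)) u) ∧
        (∃ i < K, ∃ k < K, i ≠ k ∧ MConn r (ω.sub (!b)) (e (i, !b)) (e (k, !b))) ∧
        ∃ j < K, Reach r (ω.sub (!b)) (e (j, !b)) v))) by
    rcases H with H | ⟨v, hv, (⟨i, hi, h1, h2⟩ | ⟨h1, -, h2⟩)⟩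
    · exact Or.inl H
    · exact Or.inr ⟨v, hv, ⟨i, hi, h1⟩, i, hi, h2⟩
    · exact Or.inr ⟨v, hv, h1, h2⟩
  have step : ∀ {c : Bool} {x : ℕ → Bool} {v v' : List Bool}, Reach r (ω.sub c) x v →
      Adj v v' r (ω.sub c) → Reach r (ω.sub c) x v' := by
    rintro c x v v' ⟨u', hu', h'⟩ hadj
    exact ⟨u', hu', h'.tail hadj⟩
  induction h with
  | refl => exact Or.inl ⟨u, rfl, Or.inl Relation.ReflTransGen.refl⟩
  | @tail z z' _ hadj ih =>
    rcases ih with ⟨v, rfl, ih⟩ | ⟨v, rfl, ih⟩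
    · cases z' with
      | nil => simp [Adj] at hadj
      | cons c v' =>
        obtain ⟨-, (⟨rfl, hadj⟩ | ⟨hne, i, hi, h1, h2⟩)⟩ := hadj
        · refine Or.inl ⟨v', rfl, ?_⟩
          rcases ih with ih | ⟨ih1, ih2, j, hj, ih3⟩
          · exact Or.inl (ih.tail hadj)
          · exact Or.inr ⟨ih1, ih2, j, hj, step ih3 hadj⟩
        · obtain rfl : c = !b := by cases b <;> cases c <;> simp_all
          refine Or.inr ⟨v', rfl, ?_⟩
          have h2' : Reach r (ω.sub (!b)) (e (i, !b)) v' := ⟨v', h2, Relation.ReflTransGen.refl⟩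
          rcases ih with ih | ⟨ih1, ih2, -⟩
          · exact Or.inl ⟨i, hi, ⟨v, h1, ih.symm⟩, h2'⟩
          · exact Or.inr ⟨ih1, ih2, i, hi, h2'⟩
    · cases z' with
      | nil => simp [Adj] at hadj
      | cons c v' =>
        obtain ⟨-, (⟨rfl, hadj⟩ | ⟨hne, i, hi, h1, h2⟩)⟩ := hadj
        · refine Or.inr ⟨v', rfl, ?_⟩
          rcases ih with ⟨i, hi, ih1, ih2⟩ | ⟨ih1, ih2, j, hj, ih3⟩
          · exact Or.inl ⟨i, hi, ih1, step ih2 hadj⟩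
          · exact Or.inr ⟨ih1, ih2, j, hj, step ih3 hadj⟩
        · obtain rfl : b = c := by cases b <;> cases c <;> simp_all
          refine Or.inl ⟨v', rfl, ?_⟩
          have h2' : Reach r (ω.sub b) (e (i, b)) v' := ⟨v', h2, Relation.ReflTransGen.refl⟩
          rcases ih with ⟨i', hi', ih1, ih2⟩ | ⟨ih1, ih2, -⟩
          -- Recrossing the same edge lands at the unique vertex carrying its end, hence in the
          -- component of `u`. A different edge supplies two distinct new edges whose far ends share
          -- a component.
          · by_cases hii : i' = i
            · subst hii
              obtain ⟨u', hu', hc⟩ := ih1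
              obtain rfl := hu'.unique h2
              exact Or.inl hc.symm
            · obtain ⟨u', hu', hc⟩ := ih2
              exact Or.inr ⟨⟨i', hi', ih1⟩, ⟨i', hi', i, hi, hii, u', v, hu', hc, h1⟩, i, hi, h2'⟩
          · exact Or.inr ⟨ih1, ih2, i, hi, h2'⟩

theorem conn_nil {z : List Bool} {τ : ℝ} {ω : Env} (h : Conn [] z τ ω) : z = [] := by
  induction h with
  | refl => rfl
  | tail _ hadj ih => subst ih; simp [Adj] at hadj

def cons (b : Bool) (ξ : ℕ → Bool) : ℕ → Bool := fun k => Nat.casesOn k b ξ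

/-- `conn_cons` with the starting vertex named by a marker. Meeting its component becomes a relation
between two coin sequences, which can then be averaged over independent coins. -/
theorem reach_cons {b : Bool} {x : ℕ → Bool} {z : List Bool} {τ : ℝ} {ω : Env}
    (hl : (ω []).1 ≤ τ) (h : Reach τ ω (cons b x) z) :
    (∃ v, z = b :: v ∧ (Reach (τ - (ω []).1) (ω.sub b) x v ∨
      ((∃ i < (ω []).2.1, MConn (τ - (ω []).1) (ω.sub b) x ((ω []).2.2 (i, b))) ∧
        (∃ i < (ω []).2.1, ∃ k < (ω []).2.1, i ≠ k ∧ MConn (τ - (ω []).1) (ω.sub (!b))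
          ((ω []).2.2 (i, !b)) ((ω []).2.2 (k, !b))) ∧
        ∃ j < (ω []).2.1, Reach (τ - (ω []).1) (ω.sub b) ((ω []).2.2 (j, b)) v))) ∨
    (∃ v, z = (!b) :: v ∧
      (∃ i < (ω []).2.1, MConn (τ - (ω []).1) (ω.sub b) x ((ω []).2.2 (i, b))) ∧
      ∃ j < (ω []).2.1, Reach (τ - (ω []).1) (ω.sub (!b)) ((ω []).2.2 (j, !b)) v) := by
  obtain ⟨u, hu, h⟩ := h
  cases u with
  | nil => exact absurd hu (not_lt.mpr hl)
  | cons c u =>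
    obtain ⟨-, hc, hu⟩ := hu
    obtain rfl : b = c := hc
    have hm : ∀ {i}, Reach (τ - (ω []).1) (ω.sub b) ((ω []).2.2 (i, b)) u →
        MConn (τ - (ω []).1) (ω.sub b) x ((ω []).2.2 (i, b)) := by
      rintro i ⟨u', hu', hc⟩
      exact ⟨u, u', hu, hc.symm, hu'⟩
    rcases conn_cons h with ⟨v, rfl, (h | ⟨⟨i, hi, h1⟩, h2, h3⟩)⟩ | ⟨v, rfl, ⟨i, hi, h1⟩, h2⟩
    · exact Or.inl ⟨v, rfl, Or.inl ⟨u, hu, h⟩⟩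
    · exact Or.inl ⟨v, rfl, Or.inr ⟨⟨i, hi, hm h1⟩, h2, h3⟩⟩
    · exact Or.inr ⟨v, rfl, ⟨i, hi, hm h1⟩, h2⟩

end Env

namespace Env

/-! #### The law of the environment -/

abbrev SplitData : Type := ℕ × (ℕ × Bool → ℕ → Bool)

def splitLaw (lam : ℝ≥0) : Measure SplitData :=
  (poissonMeasure (lam / 2)).prod (Measure.infinitePi fun _ => coinTosses)

def nodeLaw (lam : ℝ≥0) : Measure Node := (expMeasure 1).prod (splitLaw lam)

instance (lam : ℝ≥0) : IsProbabilityMeasure (splitLaw lam) := by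
  unfold splitLaw; infer_instance

instance (lam : ℝ≥0) : IsProbabilityMeasure (nodeLaw lam) := by
  unfold nodeLaw; infer_instance

def law (lam : ℝ≥0) : Measure Env := Measure.infinitePi fun _ => nodeLaw lam

instance (lam : ℝ≥0) : IsProbabilityMeasure (law lam) := by unfold law; infer_instance

theorem measurable_join (b : Bool) :
    Measurable fun q : Node × (Env × Env) => join q.1 b q.2.1 q.2.2 := by
  refine measurable_pi_lambda _ fun w => ?_
  cases w with
  | nil => exact measurable_fst
  | cons c w =>
    by_cases h : c = b
    · simp only [join, h, if_true]
      exact (measurable_pi_apply w).comp measurable_snd.fst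
    · simp only [join, h, if_false]
      exact (measurable_pi_apply w).comp measurable_snd.snd

/-- Different words read different coordinates of the three independent inputs, so the nodes of the
joined tree are again i.i.d. -/
theorem measurePreserving_join (lam : ℝ≥0) (b : Bool) :
    MeasurePreserving (fun q : Node × (Env × Env) => join q.1 b q.2.1 q.2.2)
      ((nodeLaw lam).prod ((law lam).prod (law lam))) (law lam) := by
  have h0 : MeasurePreserving (fun (X : Node) (_ : Unit) => X) (nodeLaw lam)
      (Measure.infinitePi fun _ => nodeLaw lam) := by
    have hm : Measurable (fun (X : Node) (_ : Unit) => X) :=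
      measurable_pi_lambda _ fun _ => measurable_id
    refine ⟨hm, Measure.eq_infinitePi _ fun s t ht => ?_⟩
    rw [Measure.map_apply hm (.pi s.countable_toSet fun _ _ => ht _)]
    rcases s.eq_empty_or_nonempty with rfl | hs
    · simp
    · obtain rfl : s = {()} := by
        obtain ⟨⟨⟩, hy⟩ := hs
        exact Finset.eq_singleton_iff_unique_mem.mpr ⟨hy, fun _ _ => rfl⟩
      simp [Set.preimage]
  let σ : List Bool → Unit ⊕ (List Bool ⊕ List Bool) := fun w => match w with
    | [] => .inl ()
    | c :: w => .inr (if c = b then .inl w else .inr w)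
  have hσ : Function.Injective σ := by
    intro w w' h
    cases w <;> cases w' <;> simp only [σ] at h
    · rfl
    · cases h
    · cases h
    · rename_i c w c' w'
      split_ifs at h with h1 h2 h2
      · simp_all
      · simp at h
      · simp at h
      · have : c = c' := by cases b <;> cases c <;> cases c' <;> simp_all
        simp_all
  have h := (measurePreserving_infinitePi_reindex (nodeLaw lam) hσ).comp
    ((measurePreserving_infinitePi_sumElim (ι := Unit) (κ := List Bool ⊕ List Bool)
      (nodeLaw lam)).comp (h0.prod (measurePreserving_infinitePi_sumElim (nodeLaw lam))))
  unfold law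
  convert h using 1
  funext ⟨X, ω₁, ω₂⟩ w
  cases w with
  | nil => rfl
  | cons c w =>
    by_cases hc : c = b <;> simp [join, hc, σ]

theorem join_nil (X : Node) (b : Bool) (ω₁ ω₂ : Env) : join X b ω₁ ω₂ [] = X := rfl

theorem join_sub (X : Node) (b : Bool) (ω₁ ω₂ : Env) : (join X b ω₁ ω₂).sub b = ω₁ := by
  funext w; simp [sub, join]

theorem join_sub_not (X : Node) (b : Bool) (ω₁ ω₂ : Env) : (join X b ω₁ ω₂).sub (!b) = ω₂ := by
  funext w; simp [sub, join]

theorem measurable_cons (b : Bool) : Measurable (cons b) := by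
  refine measurable_pi_lambda _ fun k => ?_
  cases k with
  | zero => exact measurable_const
  | succ k => exact measurable_pi_apply k

theorem lintegral_coinTosses {f : (ℕ → Bool) → ℝ≥0∞} (hf : Measurable f) :
    ∫⁻ x, f x ∂coinTosses =
      ∫⁻ b, ∫⁻ x, f (cons b x) ∂coinTosses ∂(PMF.uniformOfFintype Bool).toMeasure := by
  rw [← measurePreserving_coin_cons.lintegral_comp hf,
    lintegral_prod _ (by exact (hf.comp measurePreserving_coin_cons.measurable).aemeasurable)]
  rfl

theorem measurable_join_cons (b : Bool) :
    Measurable fun q : ℝ × ((Env × Env) × (ℕ → Bool)) × SplitData =>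
      (join (q.1, q.2.2) b q.2.1.1.1 q.2.1.1.2, cons b q.2.1.2) := by
  refine Measurable.prodMk ?_ ((measurable_cons b).comp measurable_snd.fst.snd)
  exact (measurable_join b).comp ((measurable_fst.prodMk measurable_snd.snd).prodMk
    (measurable_snd.fst.fst.fst.prodMk measurable_snd.fst.fst.snd))

/-- Expectations over an environment and an independent marker, decomposed at the root. -/
theorem lintegral_root (lam : ℝ≥0) {F : Env × (ℕ → Bool) → ℝ≥0∞} (hF : Measurable F) :
    ∫⁻ z, F z ∂((law lam).prod coinTosses) =
      ∫⁻ b, ∫⁻ l, ∫⁻ q, ∫⁻ κ, F (join (l, κ) b q.1.1 q.1.2, cons b q.2) ∂(splitLaw lam)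
        ∂(((law lam).prod (law lam)).prod coinTosses) ∂(expMeasure 1)
        ∂(PMF.uniformOfFintype Bool).toMeasure := by
  rw [lintegral_prod_symm _ hF.aemeasurable, lintegral_coinTosses hF.lintegral_prod_left']
  refine lintegral_congr fun b => ?_
  have hG : Measurable fun q : ℝ × ((Env × Env) × (ℕ → Bool)) × SplitData =>
      F (join (q.1, q.2.2) b q.2.1.1.1 q.2.1.1.2, cons b q.2.1.2) :=
    hF.comp (measurable_join_cons b)
  have h1 : ∀ x, ∫⁻ ω, F (ω, cons b x) ∂(law lam) = ∫⁻ l, ∫⁻ κ, ∫⁻ p : Env × Env,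
      F (join (l, κ) b p.1 p.2, cons b x) ∂((law lam).prod (law lam)) ∂(splitLaw lam)
        ∂(expMeasure 1) := by
    intro x
    have hx : Measurable fun ω => F (ω, cons b x) := hF.comp measurable_prodMk_right
    rw [← (measurePreserving_join lam b).lintegral_comp hx,
      lintegral_prod _ (by exact (hx.comp (measurable_join b)).aemeasurable), nodeLaw,
      lintegral_prod _ (by exact (hx.comp (measurable_join b)).lintegral_prod_right'.aemeasurable)]
  simp_rw [h1]
  have hA : Measurable fun z : (ℕ → Bool) × ℝ => ∫⁻ κ, ∫⁻ p : Env × Env,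
      F (join (z.2, κ) b p.1 p.2, cons b z.1) ∂((law lam).prod (law lam)) ∂(splitLaw lam) := by
    refine Measurable.lintegral_prod_right' (f := fun w : ((ℕ → Bool) × ℝ) × SplitData =>
      ∫⁻ p : Env × Env, F (join (w.1.2, w.2) b p.1 p.2, cons b w.1.1)
        ∂((law lam).prod (law lam))) ?_
    refine Measurable.lintegral_prod_right'
      (f := fun v : (((ℕ → Bool) × ℝ) × SplitData) × (Env × Env) =>
      F (join (v.1.1.2, v.1.2) b v.2.1 v.2.2, cons b v.1.1.1)) ?_
    exact hG.comp (measurable_fst.fst.snd.prodMk ((measurable_snd.prodMk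
      measurable_fst.fst.fst).prodMk measurable_fst.snd))
  -- The lifetime moves outside and the split data inside: the recursions fix the lifetime and
  -- average over the new edges with the marker and both side environments frozen.
  rw [lintegral_lintegral_swap (f := fun x l => ∫⁻ κ, ∫⁻ p : Env × Env,
      F (join (l, κ) b p.1 p.2, cons b x) ∂((law lam).prod (law lam)) ∂(splitLaw lam))
      hA.aemeasurable]
  refine lintegral_congr fun l => ?_
  have hB : Measurable fun q : ((Env × Env) × (ℕ → Bool)) × SplitData =>
      F (join (l, q.2) b q.1.1.1 q.1.1.2, cons b q.1.2) :=
    hG.comp (measurable_prodMk_left (x := l))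
  rw [lintegral_prod_symm _ hB.lintegral_prod_right'.aemeasurable]
  refine lintegral_congr fun x => ?_
  rw [lintegral_lintegral_swap]
  exact (hB.comp ((measurable_snd.prodMk measurable_const).prodMk measurable_fst)).aemeasurable

end Env

/-! ### Pathwise recursions for sizes, degrees and weights at the first split -/

theorem tsum_list_bool_le (b : Bool) (f : List Bool → ℝ≥0∞) :
    ∑' v, f v ≤ f [] + (∑' v, f (b :: v) + ∑' v, f ((!b) :: v)) := by
  let g : Unit ⊕ (List Bool ⊕ List Bool) → List Bool := fun s => match s with
    | .inl _ => []
    | .inr (.inl v) => b :: v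
    | .inr (.inr v) => (!b) :: v
  have hg : Function.Surjective g := by
    intro v
    cases v with
    | nil => exact ⟨.inl (), rfl⟩
    | cons c v =>
      by_cases h : c = b
      · exact ⟨.inr (.inl v), by simp [g, h]⟩
      · exact ⟨.inr (.inr v), by cases b <;> cases c <;> simp_all [g]⟩
  refine (ENNReal.tsum_le_tsum_comp_of_surjective hg f).trans (le_of_eq ?_)
  rw [Summable.tsum_sum ENNReal.summable ENNReal.summable,
    Summable.tsum_sum ENNReal.summable ENNReal.summable]
  simp [g]

namespace Env

theorem clusterCount_of_lt (n : ℕ) {τ : ℝ} {ω : Env} (x : ℕ → Bool) (h : τ < (ω []).1) :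
    clusterCount n τ ω x ≤ 1 := by
  rw [clusterCount, tsum_eq_single []]
  · exact ind_le_one _
  · rintro v hv
    refine ind_not ?_
    rintro ⟨-, u, hu, hc⟩
    cases u with
    | nil => exact hv (conn_nil hc)
    | cons c u => exact absurd h (not_lt.mpr hu.1)

theorem clusterCount_zero {τ : ℝ} {ω : Env} (b : Bool) (x : ℕ → Bool) (h : (ω []).1 ≤ τ) :
    clusterCount 0 τ ω (cons b x) = 0 := by
  rw [clusterCount, ENNReal.tsum_eq_zero]
  rintro v
  refine ind_not ?_
  rintro ⟨hv, hr⟩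
  obtain rfl : v = [] := by simpa using hv
  rcases reach_cons h hr with ⟨v, hv, -⟩ | ⟨v, hv, -⟩ <;> simp at hv

/-- A union bound over the cases of `reach_cons`. In the case of a return, the requirement that the
marker's own component meets a new edge is dropped: the two remaining factors then concern different
sides, so they are independent. -/
theorem clusterCount_succ_le (n : ℕ) {τ : ℝ} {ω : Env} (b : Bool) (x : ℕ → Bool)
    (h : (ω []).1 ≤ τ) :
    clusterCount (n + 1) τ ω (cons b x) ≤
      clusterCount n (τ - (ω []).1) (ω.sub b) x +
      (∑ i ∈ Finset.range (ω []).2.1, ∑ k ∈ Finset.range (ω []).2.1,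
        ∑ j ∈ Finset.range (ω []).2.1, if i = k then 0 else
          ind (MConn (τ - (ω []).1) (ω.sub (!b)) ((ω []).2.2 (i, !b)) ((ω []).2.2 (k, !b))) *
            clusterCount n (τ - (ω []).1) (ω.sub b) ((ω []).2.2 (j, b))) +
      ∑ i ∈ Finset.range (ω []).2.1, ∑ j ∈ Finset.range (ω []).2.1,
          ind (MConn (τ - (ω []).1) (ω.sub b) x ((ω []).2.2 (i, b))) *
            clusterCount n (τ - (ω []).1) (ω.sub (!b)) ((ω []).2.2 (j, !b)) := by
  set r := τ - (ω []).1 with hr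
  set e := (ω []).2.2 with he
  set K := (ω []).2.1 with hK
  rw [clusterCount]
  refine (tsum_list_bool_le b _).trans ?_
  have h0 : ind (([] : List Bool).length ≤ n + 1 ∧ Reach τ ω (cons b x) []) = 0 := by
    refine ind_not ?_
    rintro ⟨-, hr⟩
    rcases reach_cons h hr with ⟨v, hv, -⟩ | ⟨v, hv, -⟩ <;> simp at hv
  rw [h0, zero_add]
  refine add_le_add ?_ ?_
  · have h1 : ∀ v : List Bool, ind ((b :: v).length ≤ n + 1 ∧ Reach τ ω (cons b x) (b :: v)) ≤
        ind (v.length ≤ n ∧ Reach r (ω.sub b) x v) +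
        ∑ i ∈ Finset.range K, ∑ k ∈ Finset.range K, ∑ j ∈ Finset.range K, if i = k then 0 else
          ind (MConn r (ω.sub (!b)) (e (i, !b)) (e (k, !b))) *
            ind (v.length ≤ n ∧ Reach r (ω.sub b) (e (j, b)) v) := by
      intro v
      refine ind_le_of_imp ?_
      rintro ⟨hv, hreach⟩
      have hv' : v.length ≤ n := by simpa using hv
      rcases reach_cons h hreach with ⟨v', hv, (hr' | ⟨-, ⟨i, hi, k, hk, hik, hc⟩, j, hj, hR⟩)⟩ |
        ⟨v', hv, -⟩
      · simp only [List.cons.injEq, true_and] at hv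
        subst hv
        rw [ind_of ⟨hv', hr'⟩]
        exact le_self_add
      · simp only [List.cons.injEq, true_and] at hv
        subst hv
        refine le_trans ?_ le_add_self
        refine le_trans ?_ (Finset.single_le_sum (fun _ _ => zero_le) (Finset.mem_range.mpr hi))
        refine le_trans ?_ (Finset.single_le_sum (fun _ _ => zero_le) (Finset.mem_range.mpr hk))
        refine le_trans ?_ (Finset.single_le_sum (fun _ _ => zero_le) (Finset.mem_range.mpr hj))
        rw [if_neg hik, ind_of hc, ind_of ⟨hv', hR⟩, one_mul]
      · simp at hv
    refine (ENNReal.tsum_le_tsum h1).trans (le_of_eq ?_)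
    rw [ENNReal.tsum_add]
    refine congrArg₂ _ rfl ?_
    rw [Summable.tsum_finsetSum fun _ _ => ENNReal.summable]
    refine Finset.sum_congr rfl fun i _ => ?_
    rw [Summable.tsum_finsetSum fun _ _ => ENNReal.summable]
    refine Finset.sum_congr rfl fun k _ => ?_
    rw [Summable.tsum_finsetSum fun _ _ => ENNReal.summable]
    refine Finset.sum_congr rfl fun j _ => ?_
    split_ifs
    · simp
    · rw [ENNReal.tsum_mul_left]; rfl
  · have h1 : ∀ v : List Bool,
        ind (((!b) :: v).length ≤ n + 1 ∧ Reach τ ω (cons b x) ((!b) :: v)) ≤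
        ∑ i ∈ Finset.range K, ∑ j ∈ Finset.range K,
          ind (MConn r (ω.sub b) x (e (i, b))) *
            ind (v.length ≤ n ∧ Reach r (ω.sub (!b)) (e (j, !b)) v) := by
      intro v
      refine ind_le_of_imp ?_
      rintro ⟨hv, hreach⟩
      have hv' : v.length ≤ n := by simpa using hv
      rcases reach_cons h hreach with ⟨v', hv, -⟩ | ⟨v', hv, ⟨i, hi, hc⟩, j, hj, hR⟩
      · simp at hv
      · simp only [List.cons.injEq, true_and] at hv
        subst hv
        refine le_trans ?_ (Finset.single_le_sum (fun _ _ => zero_le) (Finset.mem_range.mpr hi))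
        refine le_trans ?_ (Finset.single_le_sum (fun _ _ => zero_le) (Finset.mem_range.mpr hj))
        rw [ind_of hc, ind_of ⟨hv', hR⟩, one_mul]
    refine (ENNReal.tsum_le_tsum h1).trans (le_of_eq ?_)
    rw [Summable.tsum_finsetSum fun _ _ => ENNReal.summable]
    refine Finset.sum_congr rfl fun i _ => ?_
    rw [Summable.tsum_finsetSum fun _ _ => ENNReal.summable]
    refine Finset.sum_congr rfl fun j _ => ?_
    rw [ENNReal.tsum_mul_left]; rfl

theorem degreeCount_zero (τ : ℝ) (ω : Env) (x : ℕ → Bool) : degreeCount 0 τ ω x = 0 := by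
  rw [degreeCount]
  simp [ind]

theorem degreeCount_of_lt (n : ℕ) {τ : ℝ} {ω : Env} (x : ℕ → Bool) (h : τ < (ω []).1) :
    degreeCount n τ ω x = 0 := by
  rw [degreeCount]
  refine ENNReal.tsum_eq_zero.mpr fun w => ENNReal.tsum_eq_zero.mpr fun i => ind_not ?_
  rintro ⟨-, u, hu, hi⟩
  cases u with
  | nil => cases w <;> simp [Inc] at hi
  | cons c u => exact absurd h (not_lt.mpr hu.1)

/-- Edges created deeper on the other side never reach the marker's vertex. An edge of the first
split counts only if its end is at that vertex, which is relaxed to lying in the same component. -/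
theorem degreeCount_succ_le (n : ℕ) {τ : ℝ} {ω : Env} (b : Bool) (x : ℕ → Bool) :
    degreeCount (n + 1) τ ω (cons b x) ≤
      degreeCount n (τ - (ω []).1) (ω.sub b) x +
      ∑ i ∈ Finset.range (ω []).2.1,
          ind (MConn (τ - (ω []).1) (ω.sub b) x ((ω []).2.2 (i, b))) := by
  rw [degreeCount, degreeCount]
  refine (tsum_list_bool_le b _).trans ?_
  rw [add_comm]
  refine add_le_add ?_ ?_
  · have h1 : ∑' v : List Bool, ∑' i, ind (((!b) :: v).length < n + 1 ∧
        ∃ u, AtLeaf u τ ω (cons b x) ∧ Inc ((!b) :: v) i u τ ω) = 0 := by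
      refine ENNReal.tsum_eq_zero.mpr fun w => ENNReal.tsum_eq_zero.mpr fun i => ind_not ?_
      rintro ⟨-, u, hu, hi⟩
      cases u with
      | nil => simp [Inc] at hi
      | cons c u =>
        obtain rfl : b = c := hu.2.1
        exact absurd hi.2.1 (by simp)
    rw [h1, add_zero]
    refine ENNReal.tsum_le_tsum fun w => ENNReal.tsum_le_tsum fun i => ind_le_of_imp ?_
    rintro ⟨hw, u, hu, hi⟩
    cases u with
    | nil => simp [Inc] at hi
    | cons c u =>
      obtain rfl : b = c := hu.2.1
      rw [ind_of ⟨by simpa using hw, u, hu.2.2, hi.2.2⟩]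
  · rw [tsum_eq_sum (s := Finset.range (ω []).2.1)]
    · refine Finset.sum_le_sum fun i hi => ind_le_of_imp ?_
      rintro ⟨-, u, hu, hi⟩
      cases u with
      | nil => simp [Inc] at hi
      | cons c u =>
        obtain rfl : b = c := hu.2.1
        rw [ind_of ⟨u, u, hu.2.2, Relation.ReflTransGen.refl, hi.2.2⟩]
    · intro i hi
      refine ind_not ?_
      rintro ⟨-, u, hu, hinc⟩
      cases u with
      | nil => simp [Inc] at hinc
      | cons c u => exact hi (Finset.mem_range.mpr hinc.2.1)

theorem weight_le_one (τ : ℝ) (ω : Env) (x : ℕ → Bool) : weight τ ω x ≤ 1 := prob_le_one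

theorem measurable_mconn_right (τ : ℝ) (ω : Env) (x : ℕ → Bool) :
    Measurable fun y => MConn τ ω x y :=
  measurable_mconn measurable_const measurable_const measurable_const measurable_id

theorem weight_eq_lintegral (τ : ℝ) (ω : Env) (x : ℕ → Bool) :
    weight τ ω x = ∫⁻ y, ind (MConn τ ω x y) ∂coinTosses :=
  (lintegral_ind _ (measurable_mconn_right τ ω x)).symm

/-- If no new edge meets the component of the marker, the weight of its component halves. -/
theorem weight_cons_le {τ : ℝ} {ω : Env} (b : Bool) (x : ℕ → Bool) (h : (ω []).1 ≤ τ)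
    (hno : ∀ i < (ω []).2.1, ¬ MConn (τ - (ω []).1) (ω.sub b) x ((ω []).2.2 (i, b))) :
    weight τ ω (cons b x) ≤ 2⁻¹ * weight (τ - (ω []).1) (ω.sub b) x := by
  rw [weight_eq_lintegral, lintegral_coinTosses
    (measurable_ind (measurable_mconn_right τ ω (cons b x)))]
  -- Without a new edge leaving the component, the first coin of the independent marker has to be
  -- `b`; this is the source of the factor one half.
  have h1 : ∀ c, ∫⁻ y, ind (MConn τ ω (cons b x) (cons c y)) ∂coinTosses ≤
      ({b} : Set Bool).indicator (fun _ => weight (τ - (ω []).1) (ω.sub b) x) c := by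
    intro c
    have key : ∀ y, MConn τ ω (cons b x) (cons c y) →
        c = b ∧ MConn (τ - (ω []).1) (ω.sub b) x y := by
      rintro y ⟨u, v, hu, hc, hv⟩
      have hr : Reach τ ω (cons b x) v := ⟨u, hu, hc⟩
      rcases reach_cons h hr with ⟨v', rfl, (⟨u', hu', hc'⟩ | ⟨⟨i, hi, hc⟩, -⟩)⟩ |
        ⟨v', -, ⟨i, hi, hc⟩, -⟩
      · obtain ⟨-, hcb, hv⟩ := hv
        obtain rfl : c = b := hcb
        exact ⟨rfl, u', v', hu', hc', hv⟩
      · exact absurd hc (hno i hi)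
      · exact absurd hc (hno i hi)
    by_cases hcb : c = b
    · rw [Set.indicator_of_mem (by exact hcb), weight_eq_lintegral]
      refine lintegral_mono fun y => ind_le_of_imp fun hy => ?_
      rw [ind_of (key y hy).2]
    · rw [Set.indicator_of_notMem (by exact hcb)]
      refine le_of_eq ?_
      rw [lintegral_eq_zero_iff (measurable_ind (measurable_mconn measurable_const measurable_const
        measurable_const (measurable_cons c)))]
      exact Filter.Eventually.of_forall fun y => ind_not fun hy => hcb (key y hy).1
  refine (lintegral_mono h1).trans (le_of_eq ?_)
  rw [lintegral_indicator_const (measurableSet_singleton b), mul_comm]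
  congr 1
  simp

end Env

namespace Env

/-! #### Expectations, and their recursions at the first split -/

/-- The probability that two independent markers are in the same component at time `t`. -/
def connProb (lam : ℝ≥0) (t : ℝ) : ℝ≥0∞ :=
  ∫⁻ z, weight t z.1 z.2 ∂((law lam).prod coinTosses)

def expCluster (lam : ℝ≥0) (n : ℕ) (t : ℝ) : ℝ≥0∞ :=
  ∫⁻ z, clusterCount n t z.1 z.2 ∂((law lam).prod coinTosses)

def expDegree (lam : ℝ≥0) (n : ℕ) (t : ℝ) : ℝ≥0∞ :=
  ∫⁻ z, degreeCount n t z.1 z.2 ∂((law lam).prod coinTosses)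

/-- The potential of a marker whose component has weight `w`. -/
def potential (lam : ℝ≥0) (w : ℝ≥0∞) : ℝ≥0∞ := ENNReal.ofReal (1 - Real.exp (-(lam * w.toReal)))

def expPotential (lam : ℝ≥0) (t : ℝ) : ℝ≥0∞ :=
  ∫⁻ z, potential lam (weight t z.1 z.2) ∂((law lam).prod coinTosses)

theorem measurable_potential (lam : ℝ≥0) : Measurable (potential lam) := by
  unfold potential; fun_prop

theorem potential_mono (lam : ℝ≥0) {v w : ℝ≥0∞} (h : v ≤ w) (hw : w ≠ ∞) :
    potential lam v ≤ potential lam w := by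
  refine ENNReal.ofReal_le_ofReal (sub_le_sub_left (Real.exp_le_exp.mpr (neg_le_neg ?_)) 1)
  exact mul_le_mul_of_nonneg_left (ENNReal.toReal_mono hw h) lam.2

theorem potential_le_one (lam : ℝ≥0) (w : ℝ≥0∞) : potential lam w ≤ 1 := by
  unfold potential
  rw [← ENNReal.ofReal_one]
  refine ENNReal.ofReal_le_ofReal ?_
  have := Real.exp_pos (-(lam * w.toReal))
  linarith

section Measurability

variable {Ω : Type*} [MeasurableSpace Ω] {τ : Ω → ℝ}

theorem measurable_weight_uncurry (hτ : Measurable τ) :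
    Measurable fun z : Ω × (Env × (ℕ → Bool)) => weight (τ z.1) z.2.1 z.2.2 :=
  measurable_weight (hτ.comp measurable_fst) measurable_snd.fst measurable_snd.snd

theorem measurable_connProb (lam : ℝ≥0) : Measurable (connProb lam) :=
  (measurable_weight_uncurry measurable_id).lintegral_prod_right'

theorem measurable_expPotential (lam : ℝ≥0) : Measurable (expPotential lam) :=
  ((measurable_potential lam).comp (measurable_weight_uncurry measurable_id)).lintegral_prod_right'

end Measurability

theorem lintegral_const_prob {Ω : Type*} [MeasurableSpace Ω] (μ : Measure Ω)
    [IsProbabilityMeasure μ] (c : ℝ≥0∞) : ∫⁻ _, c ∂μ = c := by simp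

theorem lintegral_le_of_le_const {Ω : Type*} [MeasurableSpace Ω] {μ : Measure Ω}
    [IsProbabilityMeasure μ] {f : Ω → ℝ≥0∞} {c : ℝ≥0∞} (h : ∀ a, f a ≤ c) : ∫⁻ a, f a ∂μ ≤ c :=
  (lintegral_mono h).trans (lintegral_const_prob μ c).le

theorem connProb_le_one (lam : ℝ≥0) (t : ℝ) : connProb lam t ≤ 1 :=
  lintegral_le_of_le_const fun z => weight_le_one t z.1 z.2

theorem expPotential_le_one (lam : ℝ≥0) (t : ℝ) : expPotential lam t ≤ 1 :=
  lintegral_le_of_le_const fun _ => potential_le_one lam _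

/-- A bound on an expectation from bounds given the first split. -/
theorem lintegral_root_le (lam : ℝ≥0) {F : Env × (ℕ → Bool) → ℝ≥0∞} (hF : Measurable F)
    {B : ℝ → ℝ≥0∞}
    (hB : ∀ b l, ∫⁻ q, ∫⁻ κ, F (join (l, κ) b q.1.1 q.1.2, cons b q.2) ∂(splitLaw lam)
        ∂(((law lam).prod (law lam)).prod coinTosses) ≤ B l) :
    ∫⁻ z, F z ∂((law lam).prod coinTosses) ≤ ∫⁻ l, B l ∂(expMeasure 1) := by
  rw [lintegral_root lam hF]
  exact lintegral_le_of_le_const fun b => lintegral_mono fun l => hB b l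

/-! ### Averages over the coins of the ends of new edges -/

section EndCoins

theorem lintegral_coin_eval {f : (ℕ → Bool) → ℝ≥0∞} (hf : Measurable f) (p : ℕ × Bool) :
    ∫⁻ e : ℕ × Bool → ℕ → Bool, f (e p) ∂(Measure.infinitePi fun _ => coinTosses) =
      ∫⁻ x, f x ∂coinTosses :=
  (measurePreserving_eval_infinitePi (fun _ : ℕ × Bool => coinTosses) p).lintegral_comp hf

theorem lintegral_coin_eval_mul {f g : (ℕ → Bool) → ℝ≥0∞} (hf : Measurable f)
    (hg : Measurable g) {p q : ℕ × Bool} (hpq : p ≠ q) :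
    ∫⁻ e : ℕ × Bool → ℕ → Bool, f (e p) * g (e q) ∂(Measure.infinitePi fun _ => coinTosses) =
      (∫⁻ x, f x ∂coinTosses) * ∫⁻ x, g x ∂coinTosses := by
  have hind : iIndepFun (fun (i : ℕ × Bool) (e : ℕ × Bool → ℕ → Bool) => e i)
      (Measure.infinitePi fun _ => coinTosses) :=
    iIndepFun_infinitePi (X := fun _ x => x) fun _ => measurable_id
  rw [← lintegral_coin_eval hf p, ← lintegral_coin_eval hg q]
  exact lintegral_mul_eq_lintegral_mul_lintegral_of_indepFun (hf.comp (measurable_pi_apply p))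
    (hg.comp (measurable_pi_apply q)) ((hind.indepFun hpq).comp hf hg)

theorem lintegral_coin_eval_pair_mul {f : (ℕ → Bool) × (ℕ → Bool) → ℝ≥0∞}
    {g : (ℕ → Bool) → ℝ≥0∞} (hf : Measurable f) (hg : Measurable g) {p q s : ℕ × Bool}
    (hpq : p ≠ q) (hps : p ≠ s) (hqs : q ≠ s) :
    ∫⁻ e : ℕ × Bool → ℕ → Bool, f (e p, e q) * g (e s) ∂(Measure.infinitePi fun _ => coinTosses) =
      (∫⁻ x, ∫⁻ y, f (x, y) ∂coinTosses ∂coinTosses) * ∫⁻ x, g x ∂coinTosses := by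
  have hind : iIndepFun (fun (i : ℕ × Bool) (e : ℕ × Bool → ℕ → Bool) => e i)
      (Measure.infinitePi fun _ => coinTosses) :=
    iIndepFun_infinitePi (X := fun _ x => x) fun _ => measurable_id
  have hpair : Measurable fun e : ℕ × Bool → ℕ → Bool => (e p, e q) :=
    (measurable_pi_apply p).prodMk (measurable_pi_apply q)
  rw [← lintegral_coin_eval hg s, ← lintegral_prod _ hf.aemeasurable,
    ← Measure.infinitePi_map_eval_prod (P := fun _ : ℕ × Bool => coinTosses) hpq,
    lintegral_map hf hpair]
  exact lintegral_mul_eq_lintegral_mul_lintegral_of_indepFun (hf.comp hpair)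
    (hg.comp (measurable_pi_apply s))
    ((hind.indepFun_prodMk (fun i => measurable_pi_apply i) p q s hps hqs).comp hf hg)

end EndCoins

theorem measurable_fix_clusterCount (n : ℕ) (r : ℝ) (ω : Env) :
    Measurable fun x => clusterCount n r ω x :=
  measurable_clusterCount measurable_const measurable_const measurable_id n

theorem measurable_fix_weight (r : ℝ) (ω : Env) : Measurable fun x => weight r ω x :=
  measurable_weight measurable_const measurable_const measurable_id

theorem measurable_env_clusterCount (n : ℕ) (r : ℝ) :
    Measurable fun z : Env × (ℕ → Bool) => clusterCount n r z.1 z.2 :=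
  measurable_clusterCount measurable_const measurable_fst measurable_snd n

theorem measurable_env_degreeCount (n : ℕ) (r : ℝ) :
    Measurable fun z : Env × (ℕ → Bool) => degreeCount n r z.1 z.2 :=
  measurable_degreeCount measurable_const measurable_fst measurable_snd n

theorem measurable_env_weight (r : ℝ) :
    Measurable fun z : Env × (ℕ → Bool) => weight r z.1 z.2 :=
  measurable_weight measurable_const measurable_fst measurable_snd

/-- The cube accounts for the triple of new edges in the returning term; the terms with one or two
edges are bounded by the same moment. -/
def newEdgeMoment (lam : ℝ≥0) : ℝ≥0∞ := ∫⁻ k : ℕ, (k : ℝ≥0∞) ^ 3 ∂(poissonMeasure (lam / 2))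

theorem lintegral_splitLaw (lam : ℝ≥0) {f : SplitData → ℝ≥0∞} (hf : Measurable f) :
    ∫⁻ κ, f κ ∂(splitLaw lam) = ∫⁻ k, ∫⁻ e, f (k, e)
      ∂(Measure.infinitePi fun _ => coinTosses) ∂(poissonMeasure (lam / 2)) :=
  lintegral_prod _ hf.aemeasurable

theorem lintegral_fst_coin (lam : ℝ≥0) {f : Env × (ℕ → Bool) → ℝ≥0∞} (hf : Measurable f) :
    ∫⁻ q : (Env × Env) × (ℕ → Bool), f (q.1.1, q.2)
      ∂(((law lam).prod (law lam)).prod coinTosses) = ∫⁻ z, f z ∂((law lam).prod coinTosses) := by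
  have h := ((measurePreserving_fst (μ := law lam) (ν := law lam)).prod
    (MeasurePreserving.id coinTosses)).lintegral_comp hf
  simpa [Prod.map] using h

theorem measurable_root_comp {F : Env × (ℕ → Bool) → ℝ≥0∞} (hF : Measurable F) (b : Bool) (l : ℝ)
    (q : (Env × Env) × (ℕ → Bool)) :
    Measurable fun κ : SplitData => F (join (l, κ) b q.1.1 q.1.2, cons b q.2) :=
  hF.comp ((measurable_join_cons b).comp
    (measurable_const.prodMk (measurable_const.prodMk measurable_id)))

/-- With the side environments frozen, the ends of the new edges are independent markers. Each
summand of `clusterCount_succ_le` therefore factors into a connection probability and a mean cluster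
count, and only the number of summands remains to be averaged. -/
theorem lintegral_cluster_split_le (lam : ℝ≥0) (n : ℕ) {l t : ℝ} (h : l ≤ t) (b : Bool)
    (q : (Env × Env) × (ℕ → Bool)) :
    ∫⁻ κ, clusterCount (n + 1) t (join (l, κ) b q.1.1 q.1.2) (cons b q.2) ∂(splitLaw lam) ≤
      clusterCount n (t - l) q.1.1 q.2 + newEdgeMoment lam *
        (((∫⁻ x, weight (t - l) q.1.2 x ∂coinTosses) *
          ∫⁻ x, clusterCount n (t - l) q.1.1 x ∂coinTosses) +
        weight (t - l) q.1.1 q.2 * ∫⁻ x, clusterCount n (t - l) q.1.2 x ∂coinTosses) := by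
  obtain ⟨⟨ω₁, ω₂⟩, x⟩ := q
  rw [lintegral_splitLaw lam (measurable_root_comp (measurable_env_clusterCount (n + 1) t) b l _)]
  simp only
  set r := t - l
  set P := ∫⁻ x, weight r ω₂ x ∂coinTosses with hP
  set N₁ := ∫⁻ x, clusterCount n r ω₁ x ∂coinTosses with hN₁
  set N₂ := ∫⁻ x, clusterCount n r ω₂ x ∂coinTosses with hN₂
  have h1 : ∀ k : ℕ, ∫⁻ e, clusterCount (n + 1) t (join (l, k, e) b ω₁ ω₂) (cons b x)
      ∂(Measure.infinitePi fun _ => coinTosses) ≤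
      clusterCount n r ω₁ x + (k : ℝ≥0∞) ^ 3 * (P * N₁ + weight r ω₁ x * N₂) := by
    intro k
    have hm1 : ∀ i j, Measurable fun e : ℕ × Bool → ℕ → Bool =>
        ind (MConn r ω₁ x (e (i, b))) * clusterCount n r ω₂ (e (j, !b)) := fun i j =>
      (measurable_ind (measurable_mconn measurable_const measurable_const measurable_const
        (measurable_pi_apply _))).mul
      (measurable_clusterCount measurable_const measurable_const (measurable_pi_apply _) n)
    have hm2 : ∀ i k' j, Measurable fun e : ℕ × Bool → ℕ → Bool =>
        if i = k' then 0 else ind (MConn r ω₂ (e (i, !b)) (e (k', !b))) *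
          clusterCount n r ω₁ (e (j, b)) := fun i k' j => by
      split_ifs
      · exact measurable_const
      · exact (measurable_ind (measurable_mconn measurable_const measurable_const
          (measurable_pi_apply _) (measurable_pi_apply _))).mul
          (measurable_clusterCount measurable_const measurable_const (measurable_pi_apply _) n)
    have hle : ∀ e, clusterCount (n + 1) t (join (l, k, e) b ω₁ ω₂) (cons b x) ≤
        clusterCount n r ω₁ x +
        (∑ i ∈ Finset.range k, ∑ k' ∈ Finset.range k, ∑ j ∈ Finset.range k, if i = k' then 0 else
          ind (MConn r ω₂ (e (i, !b)) (e (k', !b))) * clusterCount n r ω₁ (e (j, b))) +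
        ∑ i ∈ Finset.range k, ∑ j ∈ Finset.range k,
          ind (MConn r ω₁ x (e (i, b))) * clusterCount n r ω₂ (e (j, !b)) := by
      intro e
      have := clusterCount_succ_le n (ω := join (l, k, e) b ω₁ ω₂) b x (τ := t) h
      simpa only [join_nil, join_sub, join_sub_not] using this
    refine (lintegral_mono hle).trans ?_
    rw [lintegral_add_right _ (Finset.measurable_sum _ fun i _ =>
        Finset.measurable_sum _ fun j _ => hm1 i j),
      lintegral_add_left measurable_const, lintegral_const_prob, add_assoc]
    gcongr
    rw [mul_add]
    refine add_le_add ?_ ?_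
    · have hterm : ∀ i k' j, ∫⁻ e : ℕ × Bool → ℕ → Bool, (if i = k' then 0 else
          ind (MConn r ω₂ (e (i, !b)) (e (k', !b))) * clusterCount n r ω₁ (e (j, b)))
          ∂(Measure.infinitePi fun _ => coinTosses) ≤ P * N₁ := by
        intro i k' j
        by_cases hik : i = k'
        · simp [hik]
        · simp only [if_neg hik]
          have hbb : ∀ m m' : ℕ, (m, !b) ≠ (m', b) := fun m m' => by simp
          rw [lintegral_coin_eval_pair_mul (f := fun z => ind (MConn r ω₂ z.1 z.2))
            (measurable_ind (measurable_mconn measurable_const measurable_const measurable_fst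
              measurable_snd)) (measurable_fix_clusterCount n r ω₁)
            (p := (i, !b)) (q := (k', !b)) (s := (j, b)) (by simpa using hik) (hbb _ _) (hbb _ _)]
          simp only [← weight_eq_lintegral]
          rfl
      rw [lintegral_finsetSum _ fun i _ => Finset.measurable_sum _ fun k' _ =>
        Finset.measurable_sum _ fun j _ => hm2 i k' j]
      calc _ ≤ ∑ i ∈ Finset.range k, ∑ k' ∈ Finset.range k, ∑ j ∈ Finset.range k, P * N₁ := by
            refine Finset.sum_le_sum fun i _ => ?_
            rw [lintegral_finsetSum _ fun k' _ => Finset.measurable_sum _ fun j _ => hm2 i k' j]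
            refine Finset.sum_le_sum fun k' _ => ?_
            rw [lintegral_finsetSum _ fun j _ => hm2 i k' j]
            exact Finset.sum_le_sum fun j _ => hterm i k' j
        _ = (k : ℝ≥0∞) ^ 3 * (P * N₁) := by simp; ring
    · have hterm : ∀ i j, ∫⁻ e : ℕ × Bool → ℕ → Bool,
          ind (MConn r ω₁ x (e (i, b))) * clusterCount n r ω₂ (e (j, !b))
          ∂(Measure.infinitePi fun _ => coinTosses) = weight r ω₁ x * N₂ := by
        intro i j
        rw [lintegral_coin_eval_mul (measurable_ind (measurable_mconn_right r ω₁ x))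
          (measurable_fix_clusterCount n r ω₂) (p := (i, b)) (q := (j, !b)) (by simp),
          ← weight_eq_lintegral]
      rw [lintegral_finsetSum _ fun i _ => Finset.measurable_sum _ fun j _ => hm1 i j]
      calc _ = ∑ i ∈ Finset.range k, ∑ j ∈ Finset.range k, weight r ω₁ x * N₂ := by
            refine Finset.sum_congr rfl fun i _ => ?_
            rw [lintegral_finsetSum _ fun j _ => hm1 i j]
            exact Finset.sum_congr rfl fun j _ => hterm i j
        _ = (k : ℝ≥0∞) ^ 2 * (weight r ω₁ x * N₂) := by simp; ring
        -- Squares are at most cubes for natural numbers, so one moment serves both terms.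
        _ ≤ (k : ℝ≥0∞) ^ 3 * (weight r ω₁ x * N₂) := by
            gcongr ?_ * _
            rcases Nat.eq_zero_or_pos k with rfl | hk
            · simp
            · exact pow_le_pow_right₀ (by exact_mod_cast hk) (by norm_num)
  refine (lintegral_mono h1).trans (le_of_eq ?_)
  rw [lintegral_add_left measurable_const, lintegral_const_prob,
    lintegral_mul_const _ (measurable_of_countable _)]
  rfl

/-- Both sides are independent copies of the environment, so the crossing and the returning term
have the same mean, whence the factor 2. If the starting vertex has not split, it is the whole
component, which gives the value 1. -/
theorem expCluster_succ_le (lam : ℝ≥0) (n : ℕ) (t : ℝ) :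
    expCluster lam (n + 1) t ≤ ∫⁻ l, (if l ≤ t then
      expCluster lam n (t - l) +
        2 * newEdgeMoment lam * (connProb lam (t - l) * expCluster lam n (t - l)) else 1)
      ∂(expMeasure 1) := by
  refine lintegral_root_le lam (measurable_env_clusterCount (n + 1) t) fun b l => ?_
  split_ifs with h
  · refine (lintegral_mono fun q => lintegral_cluster_split_le lam n h b q).trans ?_
    set r := t - l
    have hmW : Measurable fun ω : Env => ∫⁻ x, weight r ω x ∂coinTosses :=
      (measurable_env_weight r).lintegral_prod_right'
    have hmN : Measurable fun ω : Env => ∫⁻ x, clusterCount n r ω x ∂coinTosses :=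
      (measurable_env_clusterCount n r).lintegral_prod_right'
    have hW : ∫⁻ ω, ∫⁻ x, weight r ω x ∂coinTosses ∂(law lam) = connProb lam r :=
      (lintegral_prod _ (measurable_env_weight r).aemeasurable).symm
    have hN : ∫⁻ ω, ∫⁻ x, clusterCount n r ω x ∂coinTosses ∂(law lam) = expCluster lam n r :=
      (lintegral_prod _ (measurable_env_clusterCount n r).aemeasurable).symm
    have hm1 : Measurable fun q : (Env × Env) × (ℕ → Bool) => clusterCount n r q.1.1 q.2 :=
      (measurable_env_clusterCount n r).comp (measurable_fst.fst.prodMk measurable_snd)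
    have hm2 : Measurable fun q : (Env × Env) × (ℕ → Bool) =>
        (∫⁻ x, weight r q.1.2 x ∂coinTosses) * ∫⁻ x, clusterCount n r q.1.1 x ∂coinTosses :=
      (hmW.comp measurable_fst.snd).mul (hmN.comp measurable_fst.fst)
    have hm3 : Measurable fun q : (Env × Env) × (ℕ → Bool) =>
        weight r q.1.1 q.2 * ∫⁻ x, clusterCount n r q.1.2 x ∂coinTosses :=
      ((measurable_env_weight r).comp (measurable_fst.fst.prodMk measurable_snd)).mul
        (hmN.comp measurable_fst.snd)
    rw [lintegral_add_left hm1, lintegral_const_mul _ (by exact hm2.add hm3), lintegral_add_left hm2,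
      lintegral_fst_coin lam (measurable_env_clusterCount n r)]
    have e2 : ∫⁻ q : (Env × Env) × (ℕ → Bool), (∫⁻ x, weight r q.1.2 x ∂coinTosses) *
        ∫⁻ x, clusterCount n r q.1.1 x ∂coinTosses
        ∂(((law lam).prod (law lam)).prod coinTosses) = connProb lam r * expCluster lam n r := by
      rw [lintegral_prod _ hm2.aemeasurable]
      simp only [lintegral_const_prob]
      rw [← hW, ← hN, mul_comm, ← lintegral_prod_mul hmN.aemeasurable hmW.aemeasurable]
      exact lintegral_congr fun z => mul_comm _ _
    have e3 : ∫⁻ q : (Env × Env) × (ℕ → Bool), weight r q.1.1 q.2 *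
        ∫⁻ x, clusterCount n r q.1.2 x ∂coinTosses
        ∂(((law lam).prod (law lam)).prod coinTosses) = connProb lam r * expCluster lam n r := by
      rw [lintegral_prod _ hm3.aemeasurable]
      simp_rw [lintegral_mul_const _ (measurable_fix_weight r _)]
      rw [← hW, ← hN, ← lintegral_prod_mul hmW.aemeasurable hmN.aemeasurable]
    rw [e2, e3]
    refine le_of_eq ?_
    change expCluster lam n r + _ = _
    ring
  · exact lintegral_le_of_le_const fun q => lintegral_le_of_le_const fun κ =>
      clusterCount_of_lt (n + 1) (ω := join (l, κ) b q.1.1 q.1.2) (cons b q.2) (not_le.mp h)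

theorem expCluster_zero_le (lam : ℝ≥0) (t : ℝ) :
    expCluster lam 0 t ≤ ∫⁻ l, (if l ≤ t then 0 else 1) ∂(expMeasure 1) := by
  refine lintegral_root_le lam (measurable_env_clusterCount 0 t) fun b l => ?_
  split_ifs with h
  · exact lintegral_le_of_le_const fun q => lintegral_le_of_le_const fun κ =>
      (clusterCount_zero b q.2 (ω := join (l, κ) b q.1.1 q.1.2) h).le
  · exact lintegral_le_of_le_const fun q => lintegral_le_of_le_const fun κ =>
      clusterCount_of_lt 0 (ω := join (l, κ) b q.1.1 q.1.2) (cons b q.2) (not_le.mp h)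

/-- Degrees only gain edges of the first split, and there are no edges before it; hence an additive
source term and the boundary value 0. -/
theorem expDegree_succ_le (lam : ℝ≥0) (n : ℕ) (t : ℝ) :
    expDegree lam (n + 1) t ≤ ∫⁻ l, (if l ≤ t then
      expDegree lam n (t - l) + newEdgeMoment lam * connProb lam (t - l) else 0)
      ∂(expMeasure 1) := by
  refine lintegral_root_le lam (measurable_env_degreeCount (n + 1) t) fun b l => ?_
  split_ifs with h
  · set r := t - l
    have h1 : ∀ q : (Env × Env) × (ℕ → Bool),
        ∫⁻ κ, degreeCount (n + 1) t (join (l, κ) b q.1.1 q.1.2) (cons b q.2) ∂(splitLaw lam) ≤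
        degreeCount n r q.1.1 q.2 + newEdgeMoment lam * weight r q.1.1 q.2 := by
      rintro ⟨⟨ω₁, ω₂⟩, x⟩
      rw [lintegral_splitLaw lam
        (measurable_root_comp (measurable_env_degreeCount (n + 1) t) b l _)]
      have h2 : ∀ k : ℕ, ∫⁻ e, degreeCount (n + 1) t (join (l, k, e) b ω₁ ω₂) (cons b x)
          ∂(Measure.infinitePi fun _ => coinTosses) ≤
          degreeCount n r ω₁ x + (k : ℝ≥0∞) ^ 3 * weight r ω₁ x := by
        intro k
        have hle : ∀ e, degreeCount (n + 1) t (join (l, k, e) b ω₁ ω₂) (cons b x) ≤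
            degreeCount n r ω₁ x + ∑ i ∈ Finset.range k, ind (MConn r ω₁ x (e (i, b))) := by
          intro e
          have := degreeCount_succ_le n (ω := join (l, k, e) b ω₁ ω₂) (τ := t) b x
          simpa only [join_nil, join_sub, join_sub_not] using this
        have hm : ∀ i, Measurable fun e : ℕ × Bool → ℕ → Bool =>
            ind (MConn r ω₁ x (e (i, b))) := fun i =>
          measurable_ind (measurable_mconn measurable_const measurable_const measurable_const
            (measurable_pi_apply _))
        refine (lintegral_mono hle).trans ?_
        rw [lintegral_add_left measurable_const, lintegral_const_prob,
          lintegral_finsetSum _ fun i _ => hm i]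
        gcongr
        calc _ = ∑ i ∈ Finset.range k, weight r ω₁ x := by
              refine Finset.sum_congr rfl fun i _ => ?_
              rw [lintegral_coin_eval (measurable_ind (measurable_mconn_right r ω₁ x)) (i, b),
                weight_eq_lintegral]
          _ = (k : ℝ≥0∞) ^ 1 * weight r ω₁ x := by simp
          _ ≤ (k : ℝ≥0∞) ^ 3 * weight r ω₁ x := by
              gcongr ?_ * _
              rcases Nat.eq_zero_or_pos k with rfl | hk
              · simp
              · exact pow_le_pow_right₀ (by exact_mod_cast hk) (by norm_num)
      refine (lintegral_mono h2).trans (le_of_eq ?_)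
      rw [lintegral_add_left measurable_const, lintegral_const_prob,
        lintegral_mul_const _ (measurable_of_countable _)]
      rfl
    refine (lintegral_mono h1).trans (le_of_eq ?_)
    have hm1 : Measurable fun q : (Env × Env) × (ℕ → Bool) => degreeCount n r q.1.1 q.2 :=
      (measurable_env_degreeCount n r).comp (measurable_fst.fst.prodMk measurable_snd)
    have hm2 : Measurable fun q : (Env × Env) × (ℕ → Bool) => weight r q.1.1 q.2 :=
      (measurable_env_weight r).comp (measurable_fst.fst.prodMk measurable_snd)
    rw [lintegral_add_left hm1, lintegral_const_mul _ hm2,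
      lintegral_fst_coin lam (measurable_env_degreeCount n r),
      lintegral_fst_coin lam (measurable_env_weight r)]
    rfl
  · exact lintegral_le_of_le_const fun q => lintegral_le_of_le_const fun κ =>
      (degreeCount_of_lt (n + 1) (ω := join (l, κ) b q.1.1 q.1.2) (cons b q.2)
        (not_le.mp h)).le

end Env

namespace Env

/-! ### Poisson averages and the decay of the potential -/

theorem lintegral_poissonMeasure (θ : ℝ≥0) (f : ℕ → ℝ≥0∞) :
    ∫⁻ k, f k ∂(poissonMeasure θ) =
      ∑' k : ℕ, ENNReal.ofReal (Real.exp (-θ) * θ ^ k / k.factorial) * f k := by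
  rw [poissonMeasure, lintegral_sum_measure]
  refine tsum_congr fun k => ?_
  rw [lintegral_smul_measure, lintegral_dirac, smul_eq_mul]

/-- The generating function is used at 8 to dominate third moments, at 1 for normalisation, and at
the probability that one new edge avoids a component. -/
theorem hasSum_poisson_pow (θ : ℝ≥0) (s : ℝ) :
    HasSum (fun k : ℕ => Real.exp (-θ) * θ ^ k / k.factorial * s ^ k)
      (Real.exp (-(θ * (1 - s)))) := by
  have h := (NormedSpace.expSeries_div_hasSum_exp (θ * s : ℝ)).mul_left (Real.exp (-θ))
  rw [← Real.exp_eq_exp_ℝ, ← Real.exp_add] at h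
  have e : -(θ : ℝ) + θ * s = -(θ * (1 - s)) := by ring
  rw [e] at h
  have e' : (fun k : ℕ => Real.exp (-θ) * θ ^ k / k.factorial * s ^ k) =
      fun k : ℕ => Real.exp (-θ) * ((θ * s) ^ k / k.factorial) := by
    funext k
    rw [mul_pow]; ring
  rw [e']
  exact h

theorem newEdgeMoment_lt_top (lam : ℝ≥0) : newEdgeMoment lam < ∞ := by
  set θ := lam / 2
  have h1 : ∀ k : ℕ, (k : ℝ≥0∞) ^ 3 ≤ ENNReal.ofReal (8 ^ k) := by
    intro k
    have : (k : ℝ≥0∞) ^ 3 = ENNReal.ofReal ((k : ℝ) ^ 3) := by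
      rw [ENNReal.ofReal_pow (by positivity), ENNReal.ofReal_natCast]
    rw [this]
    refine ENNReal.ofReal_le_ofReal ?_
    have h2 : (k : ℝ) ≤ 2 ^ k := by exact_mod_cast (Nat.lt_two_pow_self (n := k)).le
    calc (k : ℝ) ^ 3 ≤ (2 ^ k) ^ 3 := by gcongr
      _ = 8 ^ k := by rw [← pow_mul, mul_comm, pow_mul]; norm_num
  refine lt_of_le_of_lt (lintegral_mono h1) ?_
  rw [lintegral_poissonMeasure]
  have h2 : ∀ k : ℕ, ENNReal.ofReal (Real.exp (-θ) * θ ^ k / k.factorial) * ENNReal.ofReal (8 ^ k) =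
      ENNReal.ofReal (Real.exp (-θ) * θ ^ k / k.factorial * 8 ^ k) := fun k =>
    (ENNReal.ofReal_mul (by positivity)).symm
  rw [tsum_congr h2]
  exact (hasSum_poisson_pow θ 8).summable.tsum_ofReal_lt_top

/-- The mean of `A + (1 - s) ^ K * D` for a Poisson variable `K`. -/
theorem lintegral_poisson_mix (θ : ℝ≥0) {s : ℝ≥0∞} (hs : s ≤ 1) {A D : ℝ≥0∞} (hD : D ≤ A)
    (hA : A ≠ ∞) :
    ∫⁻ k : ℕ, ((1 - s) ^ k * D + (1 - (1 - s) ^ k) * A) ∂(poissonMeasure θ) =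
      ENNReal.ofReal (A.toReal - (A.toReal - D.toReal) * Real.exp (-(θ * s.toReal))) := by
  have hs' : s ≠ ∞ := (hs.trans_lt ENNReal.one_lt_top).ne
  have hs1 : s.toReal ≤ 1 := by simpa using ENNReal.toReal_mono ENNReal.one_ne_top hs
  have hs0 : 0 ≤ s.toReal := ENNReal.toReal_nonneg
  have hDA : D.toReal ≤ A.toReal := ENNReal.toReal_mono hA hD
  have hD0 : 0 ≤ D.toReal := ENNReal.toReal_nonneg
  have hD' : D ≠ ∞ := (hD.trans_lt hA.lt_top).ne
  have hval : ∀ k : ℕ, (1 - s) ^ k * D + (1 - (1 - s) ^ k) * A =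
      ENNReal.ofReal (A.toReal - (A.toReal - D.toReal) * (1 - s.toReal) ^ k) := by
    intro k
    have hp0 : 0 ≤ (1 - s.toReal) ^ k := pow_nonneg (by linarith) k
    have hp1 : (1 - s.toReal) ^ k ≤ 1 := pow_le_one₀ (by linarith) (by linarith)
    have e1 : (1 - s) = ENNReal.ofReal (1 - s.toReal) := by
      rw [ENNReal.ofReal_sub _ hs0, ENNReal.ofReal_one, ENNReal.ofReal_toReal hs']
    rw [e1, ← ENNReal.ofReal_pow (by linarith), ← ENNReal.ofReal_one, ← ENNReal.ofReal_sub _ hp0,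
      ← ENNReal.ofReal_toReal hA, ← ENNReal.ofReal_toReal hD', ← ENNReal.ofReal_mul hp0,
      ← ENNReal.ofReal_mul (by linarith), ← ENNReal.ofReal_add (by positivity)
      (mul_nonneg (by linarith) (by linarith))]
    simp only [ENNReal.toReal_ofReal ENNReal.toReal_nonneg]
    congr 1; ring
  rw [lintegral_congr hval, lintegral_poissonMeasure]
  have h2 : ∀ k : ℕ, ENNReal.ofReal (Real.exp (-θ) * θ ^ k / k.factorial) *
      ENNReal.ofReal (A.toReal - (A.toReal - D.toReal) * (1 - s.toReal) ^ k) =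
      ENNReal.ofReal (Real.exp (-θ) * θ ^ k / k.factorial * 1 ^ k * A.toReal -
        (A.toReal - D.toReal) * (Real.exp (-θ) * θ ^ k / k.factorial * (1 - s.toReal) ^ k)) := by
    intro k
    rw [← ENNReal.ofReal_mul (by positivity)]
    congr 1; ring
  have hsum := ((hasSum_poisson_pow θ 1).mul_right A.toReal).sub
    ((hasSum_poisson_pow θ (1 - s.toReal)).mul_left (A.toReal - D.toReal))
  rw [tsum_congr h2, ← ENNReal.ofReal_tsum_of_nonneg _ hsum.summable, hsum.tsum_eq]
  · simp
  · intro k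
    have hp1 : (1 - s.toReal) ^ k ≤ 1 := pow_le_one₀ (by linarith) (by linarith)
    have hp0 : 0 ≤ (1 - s.toReal) ^ k := pow_nonneg (by linarith) k
    have : Real.exp (-θ) * θ ^ k / k.factorial * 1 ^ k * A.toReal -
        (A.toReal - D.toReal) * (Real.exp (-θ) * θ ^ k / k.factorial * (1 - s.toReal) ^ k) =
        Real.exp (-θ) * θ ^ k / k.factorial *
          (A.toReal - (A.toReal - D.toReal) * (1 - s.toReal) ^ k) := by ring
    rw [this]
    refine mul_nonneg (by positivity) ?_
    nlinarith [mul_le_mul_of_nonneg_left hp1 (sub_nonneg.mpr hDA)]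

/-- The probability that the first `k` coin sequences on the side `b` all avoid a set. -/
theorem measure_forall_coins_notMem (k : ℕ) (b : Bool) {S : Set (ℕ → Bool)} (hS : MeasurableSet S) :
    (Measure.infinitePi fun _ : ℕ × Bool => coinTosses) {e | ∀ i < k, e (i, b) ∉ S} =
      (1 - coinTosses S) ^ k := by
  have : {e : ℕ × Bool → ℕ → Bool | ∀ i < k, e (i, b) ∉ S} =
      Set.pi ((Finset.range k).map ⟨fun i => (i, b), fun i j h => by simpa using h⟩ :
        Finset (ℕ × Bool)) (fun _ => Sᶜ) := by
    ext e
    simp only [Set.mem_pi, Finset.coe_map, Set.mem_image, Finset.coe_range, Set.mem_Iio,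
      Set.mem_compl_iff, forall_exists_index, and_imp, forall_apply_eq_imp_iff₂]
    exact Iff.rfl
  rw [this, Measure.infinitePi_pi _ fun _ _ => hS.compl]
  simp [prob_compl_eq_one_sub hS]

/-- The potential decreases in mean at a split, by at least a multiple of the weight. -/
theorem lintegral_potential_split_le (lam : ℝ≥0) {l t : ℝ} (h : l ≤ t) (b : Bool)
    (q : (Env × Env) × (ℕ → Bool)) :
    ∫⁻ κ, potential lam (weight t (join (l, κ) b q.1.1 q.1.2) (cons b q.2)) ∂(splitLaw lam) +
      ENNReal.ofReal (Real.exp (-lam) * (1 - Real.exp (-(lam / 2)))) * weight (t - l) q.1.1 q.2 ≤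
      potential lam (weight (t - l) q.1.1 q.2) := by
  obtain ⟨⟨ω₁, ω₂⟩, x⟩ := q
  rw [lintegral_splitLaw lam (measurable_root_comp
    (F := fun z => potential lam (weight t z.1 z.2))
    ((measurable_potential lam).comp (measurable_env_weight t)) b l ((ω₁, ω₂), x))]
  set r := t - l
  set W := weight r ω₁ x with hW
  set S := {y | MConn r ω₁ x y} with hS
  have hmS : MeasurableSet S := measurableSet_setOfPred.mpr (measurable_mconn_right r ω₁ x)
  have hW1 : W ≤ 1 := weight_le_one _ _ _
  have hWt : W ≠ ∞ := (hW1.trans_lt ENNReal.one_lt_top).ne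
  set D := potential lam (2⁻¹ * W) with hD
  set A := potential lam 1 with hA
  have hDA : D ≤ A := by
    refine potential_mono lam ?_ ENNReal.one_ne_top
    calc 2⁻¹ * W ≤ 1 * 1 := by gcongr; simp
      _ = 1 := one_mul 1
  have hAt : A ≠ ∞ := ENNReal.ofReal_ne_top
  -- Given `k` new edges, all of them avoid the component with probability `(1 - W) ^ k`, and then
  -- `weight_cons_le` bounds the potential by `D`; in the other case only the trivial bound `A` is
  -- used.
  have h1 : ∀ k : ℕ, ∫⁻ e, potential lam (weight t (join (l, k, e) b ω₁ ω₂) (cons b x))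
      ∂(Measure.infinitePi fun _ => coinTosses) ≤ (1 - W) ^ k * D + (1 - (1 - W) ^ k) * A := by
    intro k
    set T := {e : ℕ × Bool → ℕ → Bool | ∀ i < k, e (i, b) ∉ S} with hT
    have hmT : MeasurableSet T := by
      refine measurableSet_setOfPred.mpr (Measurable.forall fun i => Measurable.forall fun _ => ?_)
      exact (measurableSet_setOfPred.mp (measurable_pi_apply (i, b) hmS)).not
    have hle : ∀ e, potential lam (weight t (join (l, k, e) b ω₁ ω₂) (cons b x)) ≤
        T.indicator (fun _ => D) e + Tᶜ.indicator (fun _ => A) e := by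
      intro e
      by_cases he : e ∈ T
      · rw [Set.indicator_of_mem he, Set.indicator_of_notMem (by simpa using he), add_zero]
        refine potential_mono lam ?_ (ENNReal.mul_ne_top (by simp) hWt)
        have := weight_cons_le (ω := join (l, k, e) b ω₁ ω₂) (τ := t) b x h
          (by rw [join_nil, join_sub]; exact he)
        simpa only [join_nil, join_sub] using this
      · rw [Set.indicator_of_notMem he, Set.indicator_of_mem (by simpa using he), zero_add]
        exact potential_mono lam (weight_le_one _ _ _) ENNReal.one_ne_top
    refine (lintegral_mono hle).trans (le_of_eq ?_)
    rw [lintegral_add_left (measurable_const.indicator hmT), lintegral_indicator_const hmT,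
      lintegral_indicator_const hmT.compl, prob_compl_eq_one_sub hmT,
      measure_forall_coins_notMem k b hmS, mul_comm D, mul_comm A]
    rfl
  refine (add_le_add_left (lintegral_mono h1) _).trans ?_
  rw [lintegral_poisson_mix _ hW1 hDA hAt]
  set w := W.toReal with hw
  have hw0 : 0 ≤ w := ENNReal.toReal_nonneg
  have hw1 : w ≤ 1 := by simpa using ENNReal.toReal_mono ENNReal.one_ne_top hW1
  have hpot : ∀ v : ℝ≥0∞, (potential lam v).toReal = 1 - Real.exp (-(lam * v.toReal)) := fun v => by
    rw [potential, ENNReal.toReal_ofReal]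
    have : Real.exp (-(lam * v.toReal)) ≤ 1 := Real.exp_le_one_iff.mpr (by
      have := mul_nonneg lam.2 (ENNReal.toReal_nonneg (a := v)); simpa using this)
    linarith
  have hAr : A.toReal = 1 - Real.exp (-lam) := by rw [hA, hpot]; simp
  have hDr : D.toReal = 1 - Real.exp (-(lam / 2 * w)) := by
    rw [hD, hpot, ENNReal.toReal_mul, ENNReal.toReal_inv, ENNReal.toReal_ofNat]
    congr 3; ring
  have hWr : W = ENNReal.ofReal w := (ENNReal.ofReal_toReal hWt).symm
  -- Convexity of the exponential between `0` and `-λ/2`, at the intermediate point with parameter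
  -- `w ∈ [0, 1]`.
  have hconv : (1 - Real.exp (-((lam : ℝ) / 2))) * w ≤ 1 - Real.exp (-(lam / 2 * w)) := by
    have := convexOn_exp.2 (Set.mem_univ 0) (Set.mem_univ (-((lam : ℝ) / 2)))
      (sub_nonneg.mpr hw1) hw0 (by ring)
    simp only [smul_eq_mul, mul_zero, zero_add, Real.exp_zero, mul_one] at this
    have e : w * -((lam : ℝ) / 2) = -(lam / 2 * w) := by ring
    rw [e] at this
    linarith
  have hc0 : 0 ≤ Real.exp (-(lam : ℝ)) * (1 - Real.exp (-((lam : ℝ) / 2))) := by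
    have : Real.exp (-((lam : ℝ) / 2)) ≤ 1 := Real.exp_le_one_iff.mpr (by
      have := lam.2; linarith)
    have := Real.exp_pos (-(lam : ℝ))
    nlinarith
  have hDA' : D.toReal ≤ A.toReal := ENNReal.toReal_mono hAt hDA
  have hcoe : ((lam / 2 : ℝ≥0) : ℝ) = lam / 2 := by simp
  rw [hWr, ← ENNReal.ofReal_mul hc0, ← ENNReal.ofReal_add _ (mul_nonneg hc0 hw0), potential,
    ENNReal.toReal_ofReal hw0, hcoe]
  · refine ENNReal.ofReal_le_ofReal ?_
    rw [hAr, hDr]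
    -- The potential of `w` is `1 - a²`, while the Poisson mean is `1 - a² - exp(-λ)(1 - a)`. The
    -- gap is thus exactly `exp(-λ)(1 - a)`, and `hconv` bounds it below.
    set a := Real.exp (-(lam / 2 * w)) with ha
    have e : Real.exp (-(lam * w)) = a * a := by rw [ha, ← Real.exp_add]; congr 1; ring
    rw [e]
    have := mul_le_mul_of_nonneg_left hconv (Real.exp_pos (-(lam : ℝ))).le
    nlinarith
  · have hE : Real.exp (-(((lam / 2 : ℝ≥0) : ℝ) * w)) ≤ 1 := Real.exp_le_one_iff.mpr (by
      have := mul_nonneg (lam / 2).2 hw0; simpa using this)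
    have hD0 : 0 ≤ D.toReal := ENNReal.toReal_nonneg
    have := Real.exp_pos (-(((lam / 2 : ℝ≥0) : ℝ) * w))
    nlinarith

def decayRate (lam : ℝ≥0) : ℝ≥0∞ :=
  ENNReal.ofReal (Real.exp (-lam) * (1 - Real.exp (-(lam / 2))))

theorem decayRate_pos {lam : ℝ≥0} (h : 0 < lam) : 0 < decayRate lam := by
  refine ENNReal.ofReal_pos.mpr (mul_pos (Real.exp_pos _) ?_)
  have : Real.exp (-((lam : ℝ) / 2)) < 1 := Real.exp_lt_one_iff.mpr (by
    have : (0 : ℝ) < lam := h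
    linarith)
  linarith

/-- The renewal form of the decay of the potential. If no split occurs by time `t`, nothing is
gained and the potential is bounded by 1. -/
theorem expPotential_add_le (lam : ℝ≥0) (t : ℝ) :
    expPotential lam t + decayRate lam * ∫⁻ l, (if l ≤ t then connProb lam (t - l) else 0)
      ∂(expMeasure 1) ≤
      ∫⁻ l, (if l ≤ t then expPotential lam (t - l) else 1) ∂(expMeasure 1) := by
  have hF : Measurable fun z : Env × (ℕ → Bool) => potential lam (weight t z.1 z.2) :=
    (measurable_potential lam).comp (measurable_env_weight t)
  have hmp : Measurable fun l => if l ≤ t then connProb lam (t - l) else 0 :=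
    Measurable.ite measurableSet_Iic ((measurable_connProb lam).comp (measurable_const.sub
      measurable_id)) measurable_const
  rw [← lintegral_const_mul _ hmp, expPotential, lintegral_root lam hF,
    ← lintegral_const_prob (PMF.uniformOfFintype Bool).toMeasure (∫⁻ l, _ ∂(expMeasure 1)),
    ← lintegral_add_right _ measurable_const]
  refine lintegral_le_of_le_const fun b => ?_
  rw [← lintegral_add_right _ (hmp.const_mul _)]
  refine lintegral_mono fun l => ?_
  simp only
  split_ifs with h
  · have hmW : Measurable fun q : (Env × Env) × (ℕ → Bool) => weight (t - l) q.1.1 q.2 :=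
      (measurable_env_weight (t - l)).comp (measurable_fst.fst.prodMk measurable_snd)
    rw [connProb, ← lintegral_fst_coin lam (measurable_env_weight (t - l)),
      ← lintegral_const_mul _ hmW, ← lintegral_add_right _ (hmW.const_mul _), expPotential,
      ← lintegral_fst_coin lam (f := fun z => potential lam (weight (t - l) z.1 z.2))
        ((measurable_potential lam).comp (measurable_env_weight (t - l)))]
    exact lintegral_mono fun q => lintegral_potential_split_le lam h b q
  · rw [mul_zero, add_zero]
    exact lintegral_le_of_le_const fun q => lintegral_le_of_le_const fun κ => potential_le_one _ _

end Env

/-! ### Integral equations driven by exponential lifetimes -/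

/-- The fundamental theorem of calculus for the exponential of a primitive. -/
theorem one_add_lintegral_exp_primitive {q : ℝ → ℝ} (hq : Measurable q) {K : ℝ}
    (h0 : ∀ r, 0 ≤ q r) (hK : ∀ r, q r ≤ K) {t : ℝ} (ht : 0 ≤ t) :
    1 + ∫⁻ r in Set.Icc 0 t, ENNReal.ofReal (q r * Real.exp (∫ s in (0)..r, q s)) =
      ENNReal.ofReal (Real.exp (∫ s in (0)..t, q s)) := by
  have hK0 : 0 ≤ K := (h0 0).trans (hK 0)
  have hint : ∀ a b, IntervalIntegrable q volume a b := fun a b => by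
    refine (intervalIntegrable_const (c := K)).mono_fun hq.aestronglyMeasurable ?_
    filter_upwards with r
    rw [Real.norm_of_nonneg (h0 r), Real.norm_of_nonneg hK0]
    exact hK r
  have hcont : Continuous fun r => ∫ s in (0)..r, q s :=
    intervalIntegral.continuous_primitive hint 0
  have hbound : ∀ a b, ‖∫ s in a..b, q s‖ ≤ K * |b - a| := fun a b =>
    intervalIntegral.norm_integral_le_of_norm_le_const fun s _ => by
      rw [Real.norm_of_nonneg (h0 s)]; exact hK s
  have hmaps : Set.MapsTo (fun r => ∫ s in (0)..r, q s) (Set.uIcc 0 t)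
      (Set.Icc (-(K * t)) (K * t)) := by
    intro r hr
    rw [Set.uIcc_of_le ht] at hr
    have h := hbound 0 r
    rw [sub_zero, abs_of_nonneg hr.1, Real.norm_eq_abs, abs_le] at h
    have := mul_le_mul_of_nonneg_left hr.2 hK0
    exact ⟨by linarith, by linarith⟩
  -- The integrand `q` is only measurable, so the exponential of its primitive need not be
  -- differentiable everywhere. It is Lipschitz on the bounded interval, hence absolutely
  -- continuous, and equals the integral of its almost everywhere derivative.
  have hlip : LipschitzWith K.toNNReal fun r => ∫ s in (0)..r, q s :=
    LipschitzWith.of_dist_le_mul fun x y => by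
      rw [Real.dist_eq, intervalIntegral.integral_interval_sub_left (hint _ _) (hint _ _),
        Real.coe_toNNReal _ hK0, Real.dist_eq, ← Real.norm_eq_abs]
      exact hbound y x
  obtain ⟨L, hL⟩ := (Real.contDiff_exp (n := 1)).contDiffOn.exists_lipschitzOnWith
    (by decide) (convex_Icc (-(K * t)) (K * t)) isCompact_Icc
  have hAC := (hL.comp hlip.lipschitzOnWith hmaps).absolutelyContinuousOnInterval
  have hFTC := hAC.integral_deriv_eq_sub
  have hderiv : ∫ r in (0)..t, q r * Real.exp (∫ s in (0)..r, q s) =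
      ∫ r in (0)..t, deriv (Real.exp ∘ fun r => ∫ s in (0)..r, q s) r := by
    refine intervalIntegral.integral_congr_ae ?_
    filter_upwards [(hint 0 t).ae_hasDerivAt_integral] with r hr hr'
    have h := (hr (Set.uIoc_subset_uIcc hr') 0 Set.left_mem_uIcc).exp
    rw [mul_comm]
    exact h.deriv.symm
  have hnn : ∀ r, 0 ≤ q r * Real.exp (∫ s in (0)..r, q s) := fun r =>
    mul_nonneg (h0 r) (Real.exp_pos _).le
  have hI : Integrable (fun r => q r * Real.exp (∫ s in (0)..r, q s))
      (volume.restrict (Set.Icc 0 t)) := by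
    refine ((hint 0 t).mul_continuousOn hcont.rexp.continuousOn).1.congr_set_ae ?_
    exact Ioc_ae_eq_Icc.symm
  rw [← ofReal_integral_eq_lintegral_ofReal hI (Filter.Eventually.of_forall hnn),
    integral_Icc_eq_integral_Ioc, ← intervalIntegral.integral_of_le ht, hderiv, hFTC,
    ← ENNReal.ofReal_one, ← ENNReal.ofReal_add zero_le_one]
  · simp
  · rw [← hFTC, ← hderiv]
    exact intervalIntegral.integral_nonneg ht fun r _ => hnn r

/-- The substitution `r = t - l` turns the exponential density `exp (-l)` into `exp (-t) * exp r`,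
so a renewal equation becomes an ordinary integral equation; the event of no split contributes `exp
(-t) * a`. -/
theorem lintegral_exp_convolution {f : ℝ → ℝ≥0∞} (hf : Measurable f) (a : ℝ≥0∞) {t : ℝ}
    (ht : 0 ≤ t) :
    ∫⁻ l, (if l ≤ t then f (t - l) else a) ∂(expMeasure 1) =
      ENNReal.ofReal (Real.exp (-t)) *
        (a + ∫⁻ r in Set.Icc 0 t, ENNReal.ofReal (Real.exp r) * f r) := by
  have hm : Measurable fun l => if l ≤ t then f (t - l) else a :=
    Measurable.ite measurableSet_Iic (hf.comp (measurable_const.sub measurable_id))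
      measurable_const
  rw [← lintegral_add_compl _ (measurableSet_Iic (a := t)), Set.compl_Iic]
  have h1 : ∫⁻ l in Set.Ioi t, (if l ≤ t then f (t - l) else a) ∂(expMeasure 1) =
      ENNReal.ofReal (Real.exp (-t)) * a := by
    rw [setLIntegral_congr_fun measurableSet_Ioi (g := fun _ => a)
      (fun l hl => if_neg (not_le.mpr hl)), setLIntegral_const, expMeasure_one_Ioi ht, mul_comm]
  have h2 : ∫⁻ l in Set.Iic t, (if l ≤ t then f (t - l) else a) ∂(expMeasure 1) =
      ENNReal.ofReal (Real.exp (-t)) *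
        ∫⁻ r in Set.Icc 0 t, ENNReal.ofReal (Real.exp r) * f r := by
    have hf' : Measurable fun l => f (t - l) := hf.comp (measurable_const.sub measurable_id)
    rw [setLIntegral_congr_fun measurableSet_Iic (g := fun l => f (t - l))
      (fun l (hl : l ≤ t) => if_pos hl), ← lintegral_indicator measurableSet_Iic, lintegral_expMeasure_one
      (hf'.indicator measurableSet_Iic), ← lintegral_const_mul _ (by fun_prop)]
    have hmp : MeasurePreserving (fun r : ℝ => t - r) volume volume :=
      Measure.measurePreserving_sub_left volume t
    have he : MeasurableEmbedding (fun r : ℝ => t - r) :=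
      (MeasurableEquiv.subLeft t).measurableEmbedding
    rw [restrict_Ico_eq_restrict_Icc.symm, ← lintegral_indicator measurableSet_Ico,
      ← lintegral_indicator measurableSet_Ioi, ← hmp.lintegral_comp_emb he]
    refine lintegral_congr fun r => ?_
    by_cases hr : 0 ≤ r ∧ r < t
    · rw [Set.indicator_of_mem (show t - r ∈ Set.Ioi 0 by simp [hr.2]),
        Set.indicator_of_mem (show t - r ∈ Set.Iic t by simp [hr.1]),
        Set.indicator_of_mem (show r ∈ Set.Ico 0 t from hr), sub_sub_cancel, ← mul_assoc,
        ← ENNReal.ofReal_mul (Real.exp_pos _).le, ← Real.exp_add]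
      congr 3; ring
    · rw [Set.indicator_of_notMem (show r ∉ Set.Ico 0 t from hr)]
      by_cases h3 : r < t
      · have h4 : ¬ 0 ≤ r := fun h => hr ⟨h, h3⟩
        rw [Set.indicator_of_mem (show t - r ∈ Set.Ioi 0 by simp [h3]),
          Set.indicator_of_notMem (show t - r ∉ Set.Iic t by simpa using h4), mul_zero]
      · rw [Set.indicator_of_notMem (show t - r ∉ Set.Ioi 0 by simpa using h3)]
  rw [h1, h2, mul_add, add_comm]

namespace Env

/-! ### Integrability of the connection probability and uniform moment bounds -/

/-- The connection probability is integrable over the times. -/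
theorem exists_lintegral_connProb_le {lam : ℝ≥0} (hlam : 0 < lam) :
    ∃ I : ℝ≥0, ∀ T : ℝ, ∫⁻ u in Set.Icc 0 T, connProb lam u ≤ I := by
  have hc := decayRate_pos hlam
  have hct : decayRate lam ≠ ∞ := ENNReal.ofReal_ne_top
  -- Only lifetimes in `(0, 1]` are kept in the lower bound: they have positive mass and shift the
  -- time window by at most one, which explains `T - 1` below.
  set ρ : ℝ≥0∞ := expMeasure 1 (Set.Ioc 0 1) with hρ
  have hpos : ∀ᵐ l ∂(expMeasure 1), 0 < l := by
    rw [ae_iff]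
    simpa [Set.Iic_def] using expMeasure_one_Iic le_rfl
  have hρ0 : ρ ≠ 0 := by
    intro h0
    have h1 : (expMeasure 1) Set.univ ≤ 0 + (0 + ENNReal.ofReal (Real.exp (-1))) := by
      rw [← expMeasure_one_Iic le_rfl, ← expMeasure_one_Ioi zero_le_one]
      nth_rewrite 2 [expMeasure_one_Iic le_rfl]
      rw [← h0]
      refine (measure_mono fun x _ => ?_).trans ((measure_union_le (Set.Iic 0)
        (Set.Ioc 0 1 ∪ Set.Ioi 1)).trans (add_le_add_right (measure_union_le _ _) _))
      rcases le_or_gt x 0 with h | h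
      · exact Or.inl h
      · rcases le_or_gt x 1 with h' | h'
        · exact Or.inr (Or.inl ⟨h, h'⟩)
        · exact Or.inr (Or.inr h')
    rw [measure_univ, zero_add, zero_add, ← ENNReal.ofReal_one,
      ENNReal.ofReal_le_ofReal_iff (Real.exp_pos _).le, Real.one_le_exp_iff] at h1
    linarith
  have key : ∀ T : ℝ, 1 ≤ T →
      decayRate lam * (ρ * ∫⁻ u in Set.Icc 0 (T - 1), connProb lam u) ≤ 1 := by
    intro T hT
    have hmp := measurable_connProb lam
    have hmg := measurable_expPotential lam
    have hm1 : Measurable fun z : ℝ × ℝ => if z.2 ≤ z.1 then connProb lam (z.1 - z.2) else 0 :=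
      Measurable.ite (measurableSet_le measurable_snd measurable_fst)
        (hmp.comp (measurable_fst.sub measurable_snd)) measurable_const
    have hm2 : Measurable fun z : ℝ × ℝ => if z.2 ≤ z.1 then expPotential lam (z.1 - z.2) else 0 :=
      Measurable.ite (measurableSet_le measurable_snd measurable_fst)
        (hmg.comp (measurable_fst.sub measurable_snd)) measurable_const
    have htrans : ∀ (f : ℝ → ℝ≥0∞) (l : ℝ), Measurable f → ∀ U : ℝ,
        ∫⁻ t in Set.Icc l U, f (t - l) = ∫⁻ u in Set.Icc 0 (U - l), f u := by
      intro f l hf U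
      have hmp' : MeasurePreserving (fun t : ℝ => t - l) volume volume :=
        measurePreserving_sub_right volume l
      have h := hmp'.setLIntegral_comp_preimage (s := Set.Icc 0 (U - l)) measurableSet_Icc hf
      rw [← h]
      congr 2
      ext t; simp
    have hG : ∫⁻ t in Set.Icc 0 T, expPotential lam t ≠ ∞ := by
      refine ((setLIntegral_mono (g := fun _ => 1) measurable_const fun t _ =>
        expPotential_le_one lam t).trans_lt ?_).ne
      simp
    -- Convolution with the lifetime law does not increase the integral over `[0, T]`. Lifetimes
    -- exceeding `t` add the integral of `exp (-t)`, which is at most 1 whatever `T` is.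
    have hupper : ∫⁻ t in Set.Icc 0 T, ∫⁻ l, (if l ≤ t then expPotential lam (t - l) else 1)
        ∂(expMeasure 1) ≤ (∫⁻ t in Set.Icc 0 T, expPotential lam t) + 1 := by
      have h1 : ∀ t ∈ Set.Icc 0 T, ∫⁻ l, (if l ≤ t then expPotential lam (t - l) else 1)
          ∂(expMeasure 1) ≤ (∫⁻ l, (if l ≤ t then expPotential lam (t - l) else 0)
          ∂(expMeasure 1)) + ENNReal.ofReal (Real.exp (-t)) := by
        intro t ht
        have e : ENNReal.ofReal (Real.exp (-t)) =
            ∫⁻ l, (Set.Ioi t).indicator (fun _ => 1) l ∂(expMeasure 1) := by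
          rw [lintegral_indicator measurableSet_Ioi, setLIntegral_one, expMeasure_one_Ioi ht.1]
        rw [e, ← lintegral_add_right _ (measurable_const.indicator measurableSet_Ioi)]
        refine lintegral_mono fun l => ?_
        by_cases hl : l ≤ t
        · simp [hl]
        · simp [hl, Set.indicator_of_mem (show l ∈ Set.Ioi t from not_le.mp hl)]
      refine (setLIntegral_mono' measurableSet_Icc h1).trans ?_
      rw [lintegral_add_right _ (by fun_prop)]
      refine add_le_add ?_ ?_
      · rw [lintegral_lintegral_swap hm2.aemeasurable]
        refine (lintegral_mono_ae (g := fun _ => ∫⁻ t in Set.Icc 0 T, expPotential lam t)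
          ?_).trans (by simp)
        filter_upwards [hpos] with l hl
        rw [← lintegral_indicator measurableSet_Icc]
        have h2 : ∀ t, (Set.Icc 0 T).indicator
            (fun t => if l ≤ t then expPotential lam (t - l) else 0) t ≤
            (Set.Icc l T).indicator (fun t => expPotential lam (t - l)) t := by
          intro t
          by_cases h3 : t ∈ Set.Icc 0 T ∧ l ≤ t
          · rw [Set.indicator_of_mem h3.1, if_pos h3.2,
              Set.indicator_of_mem (show t ∈ Set.Icc l T from ⟨h3.2, h3.1.2⟩)]
          · refine le_trans (le_of_eq ?_) zero_le
            by_cases h4 : t ∈ Set.Icc 0 T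
            · rw [Set.indicator_of_mem h4, if_neg fun h5 => h3 ⟨h4, h5⟩]
            · rw [Set.indicator_of_notMem h4]
        refine (lintegral_mono h2).trans ?_
        rw [lintegral_indicator measurableSet_Icc, htrans _ _ hmg]
        exact lintegral_mono_set (Set.Icc_subset_Icc_right (by linarith))
      · have h := lintegral_expMeasure_one (f := fun _ => 1) measurable_const
        simp only [mul_one, lintegral_one, measure_univ] at h
        rw [h]
        rw [restrict_Ioc_eq_restrict_Icc.symm]
        exact lintegral_mono_set Set.Ioc_subset_Ioi_self
    have hlower : ρ * ∫⁻ u in Set.Icc 0 (T - 1), connProb lam u ≤ ∫⁻ t in Set.Icc 0 T,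
        ∫⁻ l, (if l ≤ t then connProb lam (t - l) else 0) ∂(expMeasure 1) := by
      rw [lintegral_lintegral_swap hm1.aemeasurable, mul_comm, ← setLIntegral_const]
      refine (setLIntegral_mono' measurableSet_Ioc fun l hl => ?_).trans
        (setLIntegral_le_lintegral _ _)
      have : ∫⁻ u in Set.Icc 0 (T - 1), connProb lam u ≤ ∫⁻ t in Set.Icc l T,
          connProb lam (t - l) := by
        rw [htrans _ _ hmp]
        exact lintegral_mono_set (Set.Icc_subset_Icc_right (by linarith [hl.2]))
      refine this.trans ?_
      have h2 : Set.Icc l T ⊆ Set.Icc 0 T := Set.Icc_subset_Icc_left hl.1.le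
      refine le_trans (le_of_eq ?_) (lintegral_mono_set h2)
      exact setLIntegral_congr_fun measurableSet_Icc fun t ht => (if_pos ht.1).symm
    have hsum : (∫⁻ t in Set.Icc 0 T, expPotential lam t) +
        decayRate lam * (ρ * ∫⁻ u in Set.Icc 0 (T - 1), connProb lam u) ≤
        (∫⁻ t in Set.Icc 0 T, expPotential lam t) + 1 := by
      refine le_trans ?_ hupper
      refine (add_le_add_right (mul_le_mul_right hlower _) _).trans ?_
      have hmc : Measurable fun t => ∫⁻ l, (if l ≤ t then connProb lam (t - l) else 0)
          ∂(expMeasure 1) := hm1.lintegral_prod_right'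
      rw [← lintegral_const_mul _ hmc, ← lintegral_add_left hmg]
      exact lintegral_mono fun t => expPotential_add_le lam t
    -- The integrated potential appears on both sides and is finite because the potential is
    -- bounded; cancelling it leaves a bound independent of `T`.
    exact (ENNReal.add_le_add_iff_left hG).mp hsum
  have hne : decayRate lam * ρ ≠ 0 := mul_ne_zero hc.ne' hρ0
  refine ⟨((decayRate lam * ρ)⁻¹).toNNReal, fun T => ?_⟩
  rw [ENNReal.coe_toNNReal (ENNReal.inv_ne_top.mpr hne)]
  have h := key (max T 0 + 1) (by linarith [le_max_right T 0])
  rw [add_sub_cancel_right, ← mul_assoc, mul_comm] at h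
  refine (lintegral_mono_set (Set.Icc_subset_Icc_right (le_max_left T 0))).trans ?_
  rw [← one_div, ENNReal.le_div_iff_mul_le (Or.inl hne) (Or.inl (ENNReal.mul_ne_top hct
    (measure_ne_top _ _)))]
  exact h

/-- A function with bounded integrals over all `[0, T]` cannot stay above a positive level.
Smallness at a single time is all that the limiting arguments need, so neither monotonicity nor
convergence of `connProb` is established. -/
theorem exists_connProb_le {lam : ℝ≥0} (hlam : 0 < lam) {ε : ℝ≥0∞} (hε : ε ≠ 0) :
    ∃ t : ℝ, 0 ≤ t ∧ connProb lam t ≤ ε := by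
  by_contra! hcon
  obtain ⟨I, hI⟩ := exists_lintegral_connProb_le hlam
  have h : ∀ n : ℕ, min ε 1 * n ≤ I := fun n => by
    refine le_trans ?_ (hI n)
    have h1 : ∫⁻ _ in Set.Icc 0 (n : ℝ), min ε 1 ≤ ∫⁻ u in Set.Icc 0 (n : ℝ), connProb lam u :=
      setLIntegral_mono' measurableSet_Icc fun u hu => (min_le_left _ _).trans (hcon u hu.1).le
    simpa using h1
  have hm : min ε 1 ≠ 0 := by simp [hε]
  obtain ⟨n, hn⟩ := ENNReal.exists_nat_mul_gt hm (b := (I : ℝ≥0∞)) ENNReal.coe_ne_top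
  exact (hn.trans_le (by rw [mul_comm]; exact h n)).false

/-- The expected size and the expected root degree of the component of the root are bounded,
uniformly in time. -/
theorem exists_expCluster_le {lam : ℝ≥0} (hlam : 0 < lam) :
    ∃ B : ℝ≥0, ∀ (n : ℕ) (t : ℝ), 0 ≤ t → expCluster lam n t ≤ B ∧ expDegree lam n t ≤ B := by
  obtain ⟨I, hI⟩ := exists_lintegral_connProb_le hlam
  set m : ℝ := (newEdgeMoment lam).toReal with hm
  have hm0 : 0 ≤ m := ENNReal.toReal_nonneg
  have hmE : newEdgeMoment lam = ENNReal.ofReal m :=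
    (ENNReal.ofReal_toReal (newEdgeMoment_lt_top lam).ne).symm
  set p : ℝ → ℝ := fun r => (connProb lam r).toReal with hp
  have hp0 : ∀ r, 0 ≤ p r := fun r => ENNReal.toReal_nonneg
  have hp1 : ∀ r, p r ≤ 1 := fun r => by
    simpa using ENNReal.toReal_mono ENNReal.one_ne_top (connProb_le_one lam r)
  have hpE : ∀ r, connProb lam r = ENNReal.ofReal (p r) := fun r =>
    (ENNReal.ofReal_toReal ((connProb_le_one lam r).trans_lt ENNReal.one_lt_top).ne).symm
  have hpm : Measurable p := (measurable_connProb lam).ennreal_toReal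
  have hpint : ∀ a b, IntervalIntegrable p volume a b := fun a b => by
    refine (intervalIntegrable_const (c := (1 : ℝ))).mono_fun hpm.aestronglyMeasurable ?_
    filter_upwards with r
    rw [Real.norm_of_nonneg (hp0 r), Real.norm_of_nonneg zero_le_one]
    exact hp1 r
  -- Since `exp t * Y t` is the exponential of the primitive of `1 + 2 * m * p`, this `Y` solves the
  -- renewal equation with boundary value 1 exactly; integrability of `p` makes it bounded.
  set Y : ℝ → ℝ := fun t => Real.exp (2 * m * ∫ s in (0)..t, p s) with hY
  have hYm : Measurable Y := by
    have : Continuous fun t => ∫ s in (0)..t, p s := intervalIntegral.continuous_primitive hpint 0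
    exact (this.const_mul _).rexp.measurable
  have hY1 : ∀ t, 0 ≤ t → 1 ≤ Y t := fun t ht => Real.one_le_exp_iff.mpr
    (mul_nonneg (by positivity) (intervalIntegral.integral_nonneg ht fun r _ => hp0 r))
  have hQ : ∀ t, ∫ s in (0)..t, (1 + 2 * m * p s) = t + 2 * m * ∫ s in (0)..t, p s := by
    intro t
    rw [intervalIntegral.integral_add intervalIntegrable_const ((hpint 0 t).const_mul _),
      intervalIntegral.integral_const_mul, intervalIntegral.integral_const]
    simp
  have hsuper : ∀ t, 0 ≤ t → ∀ a ≤ 1, ∫⁻ l, (if l ≤ t then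
      ENNReal.ofReal ((1 + 2 * m * p (t - l)) * Y (t - l)) else a) ∂(expMeasure 1) ≤
      ENNReal.ofReal (Y t) := by
    intro t ht a ha
    rw [lintegral_exp_convolution (f := fun r => ENNReal.ofReal ((1 + 2 * m * p r) * Y r))
      (by fun_prop) a ht]
    have h := one_add_lintegral_exp_primitive (q := fun r => 1 + 2 * m * p r) (by fun_prop)
      (K := 1 + 2 * m) (fun r => by have := hp0 r; positivity)
      (fun r => by nlinarith [hp1 r]) ht
    have e : ∫⁻ r in Set.Icc 0 t, ENNReal.ofReal (Real.exp r) *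
        ENNReal.ofReal ((1 + 2 * m * p r) * Y r) =
        ∫⁻ r in Set.Icc 0 t, ENNReal.ofReal ((1 + 2 * m * p r) *
          Real.exp (∫ s in (0)..r, (1 + 2 * m * p s))) := by
      refine lintegral_congr fun r => ?_
      rw [← ENNReal.ofReal_mul (Real.exp_pos _).le, hQ, Real.exp_add]
      congr 1
      simp only [hY]; ring
    rw [e]
    refine (mul_le_mul_right (add_le_add_left ha _) _).trans ?_
    rw [h, ← ENNReal.ofReal_mul (Real.exp_pos _).le, hQ, ← Real.exp_add]
    refine ENNReal.ofReal_le_ofReal (le_of_eq ?_)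
    simp only [hY]; congr 1; ring
  -- The depth cut-off makes the comparison with the supersolution an induction, so finiteness of
  -- the untruncated expectation need not be known in advance.
  have hC : ∀ (n : ℕ) (t : ℝ), 0 ≤ t → expCluster lam n t ≤ ENNReal.ofReal (Y t) := by
    intro n
    induction n with
    | zero =>
      intro t ht
      refine (expCluster_zero_le lam t).trans (le_trans ?_ (hsuper t ht 1 le_rfl))
      refine lintegral_mono fun l => ?_
      split_ifs <;> simp
    | succ n ih =>
      intro t ht
      refine (expCluster_succ_le lam n t).trans (le_trans (lintegral_mono fun l => ?_)
        (hsuper t ht 1 le_rfl))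
      split_ifs with hl
      · have h0 : 0 ≤ t - l := by linarith
        rw [hmE, hpE]
        have h2 : (2 : ℝ≥0∞) = ENNReal.ofReal 2 := by simp
        calc _ ≤ ENNReal.ofReal (Y (t - l)) + 2 * ENNReal.ofReal m *
              (ENNReal.ofReal (p (t - l)) * ENNReal.ofReal (Y (t - l))) := by
              gcongr <;> exact ih _ h0
          _ = _ := by
              have := hp0 (t - l)
              have := hY1 _ h0
              rw [h2, ← ENNReal.ofReal_mul (by norm_num), ← ENNReal.ofReal_mul (by linarith),
                ← ENNReal.ofReal_mul (by positivity), ← ENNReal.ofReal_add (by positivity)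
                (by positivity)]
              congr 1; ring
      · exact le_rfl
  have hD : ∀ (n : ℕ) (t : ℝ), 0 ≤ t → expDegree lam n t ≤ ENNReal.ofReal (Y t) := by
    intro n
    induction n with
    | zero => intro t ht; simp [expDegree, degreeCount_zero]
    | succ n ih =>
      intro t ht
      refine (expDegree_succ_le lam n t).trans (le_trans (lintegral_mono fun l => ?_)
        (hsuper t ht 0 zero_le_one))
      split_ifs with hl
      · have h0 : 0 ≤ t - l := by linarith
        have := hp0 (t - l)
        have h1 := hY1 _ h0
        rw [hmE, hpE, ← ENNReal.ofReal_mul hm0]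
        refine (add_le_add_left (ih _ h0) _).trans ?_
        rw [← ENNReal.ofReal_add (by positivity) (by positivity)]
        refine ENNReal.ofReal_le_ofReal ?_
        -- As `Y ≥ 1`, the additive source `m * p` is absorbed into `2 * m * p * Y`.
        have := mul_le_mul_of_nonneg_left h1 (mul_nonneg hm0 this)
        nlinarith [mul_nonneg hm0 (hp0 (t - l))]
      · exact le_rfl
  have hYB : ∀ t, 0 ≤ t → ENNReal.ofReal (Y t) ≤ ((Real.exp (2 * m * I)).toNNReal : ℝ≥0∞) := by
    intro t ht
    refine ENNReal.ofReal_le_ofReal (Real.exp_le_exp.mpr (mul_le_mul_of_nonneg_left ?_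
      (by positivity)))
    rw [intervalIntegral.integral_of_le ht, ← integral_Icc_eq_integral_Ioc,
      integral_eq_lintegral_of_nonneg_ae (Filter.Eventually.of_forall hp0)
        hpm.aestronglyMeasurable]
    refine ENNReal.toReal_le_coe_of_le_coe ?_
    simpa only [← hpE] using hI t
  exact ⟨_, fun n t ht => ⟨(hC n t ht).trans (hYB t ht), (hD n t ht).trans (hYB t ht)⟩⟩

end Env

namespace Env

/-- The bounds do not depend on the depth cut-off, and any finite set of words has bounded depth;
they pass to the supremum of finite partial sums. -/
theorem exists_lintegral_total_le {lam : ℝ≥0} (hlam : 0 < lam) :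
    ∃ B : ℝ≥0, ∀ t : ℝ, 0 ≤ t →
      ∫⁻ z, ∑' v, ind (Reach t z.1 z.2 v) ∂((law lam).prod coinTosses) ≤ B ∧
      ∫⁻ z, ∑' (w : List Bool) (i : ℕ), ind (∃ u, AtLeaf u t z.1 z.2 ∧ Inc w i u t z.1)
        ∂((law lam).prod coinTosses) ≤ B := by
  obtain ⟨B, hB⟩ := exists_expCluster_le hlam
  have hfst : Measurable fun z : Env × (ℕ → Bool) => z.1 := measurable_fst
  have hsnd : Measurable fun z : Env × (ℕ → Bool) => z.2 := measurable_snd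
  have hlen : ∀ s : Finset (List Bool), ∃ n, ∀ v ∈ s, v.length < n := fun s =>
    ⟨s.sup List.length + 1, fun v hv => Nat.lt_succ_of_le (Finset.le_sup hv)⟩
  refine ⟨B, fun t ht => ⟨?_, ?_⟩⟩
  · have hm : ∀ v, Measurable fun z : Env × (ℕ → Bool) => ind (Reach t z.1 z.2 v) := fun v =>
      measurable_ind (Measurable.exists fun u =>
        (measurable_atLeaf measurable_const hfst hsnd u).and
          (measurable_conn measurable_const hfst u v))
    rw [lintegral_tsum fun v => (hm v).aemeasurable, ENNReal.tsum_eq_iSup_sum]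
    refine iSup_le fun s => ?_
    obtain ⟨n, hn⟩ := hlen s
    rw [← lintegral_finsetSum _ fun v _ => hm v]
    refine le_trans (lintegral_mono fun z => ?_) (hB n t ht).1
    refine le_trans (Finset.sum_le_sum fun v hv => ?_) (ENNReal.sum_le_tsum s)
    exact ind_le_of_imp fun h => (ind_of ⟨(hn v hv).le, h⟩).ge
  · have hm : ∀ w, Measurable fun z : Env × (ℕ → Bool) =>
        ∑' i : ℕ, ind (∃ u, AtLeaf u t z.1 z.2 ∧ Inc w i u t z.1) := fun w =>
      Measurable.tsum fun i => measurable_ind (Measurable.exists fun u =>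
        (measurable_atLeaf measurable_const hfst hsnd u).and
          (measurable_inc measurable_const hfst w i u))
    rw [lintegral_tsum fun v => (hm v).aemeasurable, ENNReal.tsum_eq_iSup_sum]
    refine iSup_le fun s => ?_
    obtain ⟨n, hn⟩ := hlen s
    rw [← lintegral_finsetSum _ fun v _ => hm v]
    refine le_trans (lintegral_mono fun z => ?_) (hB n t ht).2
    refine le_trans (Finset.sum_le_sum fun w hw => ENNReal.tsum_le_tsum fun i => ?_)
      (ENNReal.sum_le_tsum s)
    exact ind_le_of_imp fun h => (ind_of ⟨hn w hw, h⟩).ge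

end Env

/-! ### Isomorphisms of rooted multigraphs -/

namespace RootedMultigraph

variable {α β α' β' α'' β'' : Type}

theorem Isomorphic.refl (G : RootedMultigraph α β) : Isomorphic G G :=
  ⟨Equiv.refl _, Equiv.refl _, rfl, fun _ _ _ => Iff.rfl⟩

theorem Isomorphic.symm {G : RootedMultigraph α β} {H : RootedMultigraph α' β'}
    (h : Isomorphic G H) : Isomorphic H G := by
  obtain ⟨f, g, hr, hl⟩ := h
  refine ⟨f.symm, g.symm, ?_, fun e x y => ?_⟩
  · have : f ⟨G.root, G.root_mem⟩ = ⟨H.root, H.root_mem⟩ := Subtype.ext hr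
    rw [← this, Equiv.symm_apply_apply]
  · rw [hl]; simp

theorem Isomorphic.trans {G : RootedMultigraph α β} {H : RootedMultigraph α' β'}
    {K : RootedMultigraph α'' β''} (h : Isomorphic G H) (h' : Isomorphic H K) :
    Isomorphic G K := by
  obtain ⟨f, g, hr, hl⟩ := h
  obtain ⟨f', g', hr', hl'⟩ := h'
  refine ⟨f.trans f', g.trans g', ?_, fun e x y => ?_⟩
  · have : f ⟨G.root, G.root_mem⟩ = ⟨H.root, H.root_mem⟩ := Subtype.ext hr
    rw [Equiv.trans_apply, this, hr']
  · rw [hl, hl']; rfl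

/-- An embedding on the component of `o` that is onto on the links gives an isomorphism. -/
theorem component_isomorphic {Γ : Graph α β} {Γ' : Graph α' β'} (h : Γ.Loopless)
    (h' : Γ'.Loopless) {o : α} {o' : α'} (f : α → α') (g : β → β') (ho : f o = o')
    (hf : ∀ x y, Relation.ReflTransGen Γ.Adj o x → Relation.ReflTransGen Γ.Adj o y →
      f x = f y → x = y)
    (hg : ∀ e x y e' x' y', Relation.ReflTransGen Γ.Adj o x → Γ.IsLink e x y →
      Relation.ReflTransGen Γ.Adj o x' → Γ.IsLink e' x' y' → g e = g e' → e = e')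
    (hl : ∀ e x y, Relation.ReflTransGen Γ.Adj o x → Γ.IsLink e x y →
      Γ'.IsLink (g e) (f x) (f y))
    (hl' : ∀ e' x y', Relation.ReflTransGen Γ.Adj o x → Γ'.IsLink e' (f x) y' →
      ∃ e y, Γ.IsLink e x y ∧ g e = e' ∧ f y = y') :
    Isomorphic (component Γ h o) (component Γ' h' o') := by
  subst ho
  have hreach : ∀ x, Relation.ReflTransGen Γ.Adj o x →
      Relation.ReflTransGen Γ'.Adj (f o) (f x) := by
    intro x hx
    induction hx with
    | refl => exact .refl
    | tail hy hz ih =>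
      obtain ⟨e, he⟩ := hz
      exact ih.tail ⟨g e, hl _ _ _ hy he⟩
  have hreach' : ∀ x', Relation.ReflTransGen Γ'.Adj (f o) x' →
      ∃ x, Relation.ReflTransGen Γ.Adj o x ∧ f x = x' := by
    intro x' hx'
    induction hx' with
    | refl => exact ⟨o, .refl, rfl⟩
    | tail hy hz ih =>
      obtain ⟨x, hx, rfl⟩ := ih
      obtain ⟨e', he'⟩ := hz
      obtain ⟨e, y, he, -, hy⟩ := hl' _ _ _ hx he'
      exact ⟨y, hx.tail ⟨e, he⟩, hy⟩
  let F : (component Γ h o).graph.vertexSet ≃ (component Γ' h' (f o)).graph.vertexSet :=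
    Equiv.ofBijective (fun x => ⟨f x, hreach x x.2⟩) ⟨fun x y hxy =>
      Subtype.ext (hf x y x.2 y.2 (congrArg Subtype.val hxy)), fun x' => by
        obtain ⟨x, hx, hx'⟩ := hreach' x' x'.2
        exact ⟨⟨x, hx⟩, Subtype.ext hx'⟩⟩
  have hE : ∀ e : (component Γ h o).graph.edgeSet,
      g e ∈ (component Γ' h' (f o)).graph.edgeSet := by
    rintro ⟨e, he⟩
    obtain ⟨x, y, hxy⟩ := (Graph.edge_mem_iff_exists_isLink _ _).mp he
    exact (Graph.edge_mem_iff_exists_isLink _ _).mpr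
      ⟨f x, f y, hl _ _ _ hxy.2 hxy.1, hreach _ hxy.2⟩
  let E : (component Γ h o).graph.edgeSet ≃ (component Γ' h' (f o)).graph.edgeSet :=
    Equiv.ofBijective (fun e => ⟨g e, hE e⟩) (by
      constructor
      · rintro ⟨e, he⟩ ⟨e', he'⟩ hee
        obtain ⟨x, y, hxy⟩ := (Graph.edge_mem_iff_exists_isLink _ _).mp he
        obtain ⟨x', y', hxy'⟩ := (Graph.edge_mem_iff_exists_isLink _ _).mp he'
        exact Subtype.ext (hg e x y e' x' y' hxy.2 hxy.1 hxy'.2 hxy'.1 (congrArg Subtype.val hee))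
      · rintro ⟨e', he'⟩
        obtain ⟨x', y', hxy', hx'⟩ := (Graph.edge_mem_iff_exists_isLink _ _).mp he'
        obtain ⟨x, hx, rfl⟩ := hreach' x' hx'
        obtain ⟨e, y, he, hge, -⟩ := hl' _ _ _ hx hxy'
        exact ⟨⟨e, (Graph.edge_mem_iff_exists_isLink _ _).mpr ⟨x, y, he, hx⟩⟩, Subtype.ext hge⟩)
  refine ⟨F, E, rfl, fun e x y => ⟨fun hxy => ⟨hl _ _ _ hxy.2 hxy.1, hreach _ hxy.2⟩, ?_⟩⟩
  rintro ⟨hxy, -⟩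
  obtain ⟨e₁, y₁, he₁, hge, hy⟩ := hl' _ _ _ x.2 hxy
  obtain ⟨x₀, y₀, hxy₀⟩ := (Graph.edge_mem_iff_exists_isLink _ _).mp e.2
  have h1 := hg _ _ _ _ _ _ x.2 he₁ hxy₀.2 hxy₀.1 hge
  have h2 : y₁ = y := hf _ _ (Relation.ReflTransGen.tail x.2 ⟨e₁, he₁⟩) y.2 hy
  rw [← h1, ← h2]
  exact ⟨he₁, x.2⟩

theorem size_congr {G : RootedMultigraph α β} {H : RootedMultigraph α' β'}
    (h : Isomorphic G H) : G.size = H.size := by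
  obtain ⟨f, -⟩ := h
  exact Set.encard_congr f

theorem rootDegree_congr {G : RootedMultigraph α β} {H : RootedMultigraph α' β'}
    (h : Isomorphic G H) : G.rootDegree = H.rootDegree := by
  obtain ⟨f, g, hr, hl⟩ := h
  have hr' : f ⟨G.root, G.root_mem⟩ = ⟨H.root, H.root_mem⟩ := Subtype.ext hr
  have key : ∀ e : G.graph.edgeSet, G.graph.Inc e G.root ↔ H.graph.Inc (g e) H.root := by
    intro e
    constructor
    · rintro ⟨y, hy⟩
      have := (hl e ⟨_, G.root_mem⟩ ⟨y, hy.right_mem⟩).mp hy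
      rw [hr'] at this
      exact ⟨_, this⟩
    · rintro ⟨y, hy⟩
      refine ⟨f.symm ⟨y, hy.right_mem⟩, (hl e ⟨_, G.root_mem⟩ (f.symm ⟨y, hy.right_mem⟩)).mpr ?_⟩
      rw [hr']
      simpa using hy
  refine Set.encard_congr (Equiv.ofBijective (fun e => ⟨g ⟨e.1, e.2.edge_mem⟩,
    (key ⟨e.1, e.2.edge_mem⟩).mp e.2⟩) ⟨fun e e' hee => ?_, fun e' => ?_⟩)
  · have h1 := congrArg Subtype.val hee
    have h2 := g.injective (Subtype.ext h1)
    exact Subtype.ext (congrArg (fun z : G.graph.edgeSet => z.1) h2)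
  · have h1 : g (g.symm ⟨e'.1, e'.2.edge_mem⟩) = ⟨e'.1, e'.2.edge_mem⟩ := by simp
    refine ⟨⟨(g.symm ⟨e'.1, e'.2.edge_mem⟩ : G.graph.edgeSet), (key _).mpr ?_⟩, ?_⟩
    · rw [h1]; exact e'.2
    · refine Subtype.ext ?_
      simp

/-- `G` has, up to isomorphism, the property `A`. -/
def HasProp (A : Set (RootedMultigraph ℕ ℕ)) (G : RootedMultigraph α β) : Prop :=
  ∃ H ∈ A, Isomorphic G H

theorem hasProp_congr (A : Set (RootedMultigraph ℕ ℕ)) {G : RootedMultigraph α β}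
    {H : RootedMultigraph α' β'} (h : Isomorphic G H) : HasProp A G ↔ HasProp A H :=
  ⟨fun ⟨K, hK, hi⟩ => ⟨K, hK, h.symm.trans hi⟩, fun ⟨K, hK, hi⟩ => ⟨K, hK, h.trans hi⟩⟩

theorem IsoInvariant.hasProp_iff {A : Set (RootedMultigraph ℕ ℕ)} (hA : IsoInvariant A)
    (G : RootedMultigraph ℕ ℕ) : HasProp A G ↔ G ∈ A :=
  ⟨fun ⟨_, hK, hi⟩ => hA _ _ hi.symm hK, fun h => ⟨G, h, .refl G⟩⟩

theorem IsoInvariant.compl {A : Set (RootedMultigraph ℕ ℕ)} (hA : IsoInvariant A) :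
    IsoInvariant Aᶜ := fun _ _ h hG hH => hG (hA _ _ h.symm hH)

/-- The same multigraph with vertices and edges renamed. -/
def map (G : RootedMultigraph α β) (f : α ↪ α') (g : β ↪ β') : RootedMultigraph α' β' where
  graph :=
    { vertexSet := f '' G.graph.vertexSet
      IsLink := fun e' x' y' => ∃ e x y, G.graph.IsLink e x y ∧ g e = e' ∧ f x = x' ∧ f y = y'
      isLink_symm := by
        intro e' _
        refine ⟨?_⟩
        rintro x' y' ⟨e, x, y, h, h1, h2, h3⟩
        exact ⟨e, y, x, h.symm, h1, h3, h2⟩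
      eq_or_eq_of_isLink_of_isLink := by
        rintro e' x' y' v' w' ⟨e, x, y, h, rfl, rfl, rfl⟩ ⟨e₁, v, w, h₁, he, rfl, rfl⟩
        have := g.injective he
        subst this
        rcases h.left_eq_or_eq h₁ with rfl | rfl
        · exact Or.inl rfl
        · exact Or.inr rfl
      left_mem_of_isLink := by
        rintro e' x' y' ⟨e, x, y, h, rfl, rfl, rfl⟩
        exact ⟨x, h.left_mem, rfl⟩ }
  root := f G.root
  root_mem := ⟨_, G.root_mem, rfl⟩
  loopless := by
    refine ⟨?_⟩
    rintro e' x' ⟨e, x, y, h, rfl, rfl, hxy⟩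
    have := f.injective hxy
    subst this
    exact G.loopless.not_isLoopAt e _ h
  connected := by
    rintro x' ⟨x, hx, rfl⟩
    have := G.connected x hx
    induction this with
    | refl => exact .refl
    | tail hy hz ih =>
      obtain ⟨e, he⟩ := hz
      exact (ih he.left_mem).tail ⟨g e, e, _, _, he, rfl, rfl, rfl⟩

/-- `f` and `g` embed `G` as `H`. -/
structure IsEmbedding (G : RootedMultigraph α β) (H : RootedMultigraph α' β') (f : α → α')
    (g : β → β') : Prop where
  inj_vertex : Function.Injective f
  inj_edge : Function.Injective g
  root : f G.root = H.root
  vertex_mem : ∀ x ∈ G.graph.vertexSet, f x ∈ H.graph.vertexSet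
  exists_vertex : ∀ x', x' ∈ H.graph.vertexSet → ∃ x ∈ G.graph.vertexSet, f x = x'
  link : ∀ e x y, G.graph.IsLink e x y → H.graph.IsLink (g e) (f x) (f y)
  exists_link : ∀ e' x' y', H.graph.IsLink e' x' y' →
    ∃ e x y, G.graph.IsLink e x y ∧ g e = e' ∧ f x = x' ∧ f y = y'

theorem isEmbedding_map (G : RootedMultigraph α β) (f : α ↪ α') (g : β ↪ β') :
    IsEmbedding G (G.map f g) f g where
  inj_vertex := f.injective
  inj_edge := g.injective
  root := rfl
  vertex_mem _ hx := ⟨_, hx, rfl⟩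
  exists_vertex _ hx := hx
  link _ _ _ h := ⟨_, _, _, h, rfl, rfl, rfl⟩
  exists_link _ _ _ h := h

theorem IsEmbedding.isLink_iff {G : RootedMultigraph α β} {H : RootedMultigraph α' β'} {f : α → α'}
    {g : β → β'} (h : IsEmbedding G H f g) (e : β) (x y : α) :
    G.graph.IsLink e x y ↔ H.graph.IsLink (g e) (f x) (f y) := by
  refine ⟨h.link e x y, fun hl => ?_⟩
  obtain ⟨e₁, x₁, y₁, hl₁, he, hx, hy⟩ := h.exists_link _ _ _ hl
  rwa [← h.inj_edge he, ← h.inj_vertex hx, ← h.inj_vertex hy]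

theorem IsEmbedding.isomorphic {G : RootedMultigraph α β} {H : RootedMultigraph α' β'} {f : α → α'}
    {g : β → β'} (h : IsEmbedding G H f g) : Isomorphic G H := by
  have hE : ∀ e ∈ G.graph.edgeSet, g e ∈ H.graph.edgeSet := fun e he => by
    obtain ⟨x, y, hxy⟩ := (Graph.edge_mem_iff_exists_isLink _ _).mp he
    exact (h.link _ _ _ hxy).edge_mem
  refine ⟨Equiv.ofBijective (fun x => ⟨f x, h.vertex_mem x x.2⟩) ⟨fun x y hxy =>
    Subtype.ext (h.inj_vertex (congrArg Subtype.val hxy)), fun x' => ?_⟩,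
    Equiv.ofBijective (fun e => ⟨g e, hE e e.2⟩) ⟨fun x y hxy =>
    Subtype.ext (h.inj_edge (congrArg Subtype.val hxy)), fun e' => ?_⟩, h.root,
    fun e x y => h.isLink_iff e x y⟩
  · obtain ⟨x, hx, hx'⟩ := h.exists_vertex x' x'.2
    exact ⟨⟨x, hx⟩, Subtype.ext hx'⟩
  · obtain ⟨x', y', hxy'⟩ := (Graph.edge_mem_iff_exists_isLink _ _).mp e'.2
    obtain ⟨e, x, y, hl, he, -⟩ := h.exists_link _ _ _ hxy'
    exact ⟨⟨e, hl.edge_mem⟩, Subtype.ext he⟩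

/-- The same multigraph on the types of its own vertices and edges. -/
def restrict (G : RootedMultigraph α β) :
    RootedMultigraph G.graph.vertexSet G.graph.edgeSet where
  graph :=
    { vertexSet := Set.univ
      IsLink := fun e x y => G.graph.IsLink e x y
      isLink_symm := fun e _ => ⟨fun x y h => h.symm⟩
      eq_or_eq_of_isLink_of_isLink := by
        intro e x y v w h h'
        exact (h.left_eq_or_eq h').imp Subtype.ext Subtype.ext
      left_mem_of_isLink := fun _ _ _ _ => trivial }
  root := ⟨G.root, G.root_mem⟩
  root_mem := trivial
  loopless := ⟨fun e x h => G.loopless.not_isLoopAt e x h⟩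
  connected := by
    rintro ⟨x, hx⟩ -
    have := G.connected x hx
    induction this with
    | refl => exact .refl
    | tail hy hz ih =>
      obtain ⟨e, he⟩ := hz
      exact (ih he.left_mem).tail ⟨⟨e, he.edge_mem⟩, he⟩

/-- An isomorphism is defined on actual vertices and edges only. On the types of these it becomes a
pair of total injections, which is what is needed to transport the random choices. -/
theorem exists_isEmbedding_restrict {G : RootedMultigraph α β} {H : RootedMultigraph α' β'}
    (h : Isomorphic G H) : ∃ f g, IsEmbedding G.restrict H f g := by
  obtain ⟨f, g, hr, hl⟩ := h
  refine ⟨fun x => f x, fun e => g e, Subtype.val_injective.comp f.injective,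
    Subtype.val_injective.comp g.injective, hr, fun x _ => (f x).2, fun x' hx' =>
    ⟨f.symm ⟨x', hx'⟩, trivial, by simp⟩, fun e x y hxy => (hl e x y).mp hxy,
    fun e' x' y' hxy' => ?_⟩
  refine ⟨g.symm ⟨e', hxy'.edge_mem⟩, f.symm ⟨x', hxy'.left_mem⟩, f.symm ⟨y', hxy'.right_mem⟩,
    (hl _ _ _).mpr ?_, ?_, ?_, ?_⟩ <;> simp [hxy']

end RootedMultigraph

/-! ### The process does not depend on the labels -/

namespace Choices

variable {α β α' β' : Type}

/-- The choices seen through an injection of the labels. -/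
def pull (f : α → α') (g : β → β') (c : Choices α' β') : Choices α β :=
  (fun p => c.1 (f p.1, p.2), fun p => c.2.1 (f p.1, p.2), c.2.2.1,
    fun q => c.2.2.2.1 (g q.1, f q.2), fun q => c.2.2.2.2 (((f q.1.1.1, q.1.1.2), q.1.2), q.2))

instance (lam : ℝ≥0) : IsProbabilityMeasure (choiceLaw α β lam) := by
  unfold choiceLaw; infer_instance

theorem measurePreserving_pull [Countable α] [Countable β] [Countable α'] [Countable β']
    {f : α → α'} {g : β → β'} (hf : Function.Injective f) (hg : Function.Injective g)
    (lam : ℝ≥0) : MeasurePreserving (pull f g) (choiceLaw α' β' lam) (choiceLaw α β lam) := by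
  have h1 : Function.Injective fun p : Descendant α => (f p.1, p.2) := fun p q h => by
    simp only [Prod.mk.injEq] at h
    exact Prod.ext (hf h.1) h.2
  have h2 : Function.Injective fun q : β × α => (g q.1, f q.2) := fun p q h => by
    simp only [Prod.mk.injEq] at h
    exact Prod.ext (hg h.1) (hf h.2)
  have h3 : Function.Injective fun q : (Descendant α × ℕ) × Bool =>
      (((f q.1.1.1, q.1.1.2), q.1.2), q.2) := fun p q h => by
    simp only [Prod.mk.injEq] at h
    exact Prod.ext (Prod.ext (Prod.ext (hf h.1.1.1) h.1.1.2) h.1.2) h.2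
  exact (measurePreserving_infinitePi_reindex _ h1).prod
    ((measurePreserving_infinitePi_reindex _ h1).prod
      ((MeasurePreserving.id _).prod ((measurePreserving_infinitePi_reindex _ h2).prod
        (measurePreserving_infinitePi_reindex _ h3))))

variable (f : α → α') (g : β → β') (c : Choices α' β')

end Choices

namespace RootedMultigraph

open Choices

variable {α β α' β' : Type}

/-- Split times and positions only refer to labels through `f` and `g`, so running the process
commutes with relabelling for each fixed realisation of the choices. -/
theorem IsEmbedding.cluster_pull {G : RootedMultigraph α β} {H : RootedMultigraph α' β'}
    {f : α → α'} {g : β → β'} (h : IsEmbedding G H f g) (c : Choices α' β') (t : ℝ) :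
    Isomorphic (G.cluster (c.pull f g) t) (H.cluster c t) := by
  set F : Descendant α → Descendant α' := fun p => (f p.1, p.2) with hF
  have hFi : Function.Injective F := fun p q hpq => by
    simp only [hF, Prod.mk.injEq] at hpq
    exact Prod.ext (h.inj_vertex hpq.1) hpq.2
  have hpos : ∀ p ξ, F ((c.pull f g).position t p ξ) = c.position t (F p) ξ := fun p ξ => rfl
  set E : EdgeLabel α β → EdgeLabel α' β' := Sum.map g fun q => (F q.1, q.2) with hE
  have hEi : Function.Injective E := Sum.map_injective.mpr ⟨h.inj_edge, fun p q hpq => by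
    simp only [Prod.mk.injEq] at hpq
    exact Prod.ext (hFi hpq.1) hpq.2⟩
  refine component_isomorphic _ _ F E ?_ (fun x y _ _ hxy => hFi hxy)
    (fun e x y e' x' y' _ _ _ _ hee => hEi hee) ?_ ?_
  · rw [rootAt, rootAt, hpos, ← h.root]; rfl
  · rintro (e | ⟨p, i⟩) x y -
    · rintro ⟨hx, hy, u, v, hl, rfl, rfl⟩
      exact ⟨hx, hy, f u, f v, h.link _ _ _ hl, rfl, rfl⟩
    · rintro ⟨hx, hy, h1, h2, h3, b, rfl, rfl⟩
      exact ⟨hx, hy, h.vertex_mem _ h1, h2, h3, b, rfl, rfl⟩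
  · rintro (e' | ⟨p', i⟩) x y' -
    · rintro ⟨hx, hy, u', v', hl, hxu, rfl⟩
      obtain ⟨e, u, v, hl', rfl, rfl, rfl⟩ := h.exists_link _ _ _ hl
      refine ⟨.inl e, (c.pull f g).oldEnd t e v, ⟨hx, hy, u, v, hl', hFi hxu, rfl⟩, rfl, rfl⟩
    · rintro ⟨hx, hy, h1, h2, h3, b, hxb, rfl⟩
      obtain ⟨q, hq, hq'⟩ := h.exists_vertex _ h1
      obtain ⟨p₁, w⟩ := p'
      simp only at hq'
      subst hq'
      exact ⟨.inr ((q, w), i), (c.pull f g).newEnd t (q, w) i (!b),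
        ⟨hx, hy, hq, h2, h3, b, hFi hxb, rfl⟩, rfl, rfl⟩

/-- The probability that the cluster process from `G` has the property `A` at time `t`. -/
def clusterLaw (lam : ℝ≥0) (t : ℝ) (G : RootedMultigraph α β) (A : Set (RootedMultigraph ℕ ℕ)) :
    ℝ≥0∞ := choiceLaw α β lam {c | HasProp A (G.cluster c t)}

theorem clusterLaw_of_isEmbedding [Countable α] [Countable β] [Countable α'] [Countable β']
    (lam : ℝ≥0) (t : ℝ) {G : RootedMultigraph α β} {H : RootedMultigraph α' β'} {f : α → α'}
    {g : β → β'} (h : IsEmbedding G H f g) {A : Set (RootedMultigraph ℕ ℕ)}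
    (hA : NullMeasurableSet {c | HasProp A (G.cluster c t)} (choiceLaw α β lam)) :
    clusterLaw lam t G A = clusterLaw lam t H A := by
  rw [clusterLaw, ← (measurePreserving_pull h.inj_vertex h.inj_edge lam).measure_preimage hA]
  refine congrArg _ (Set.ext fun c => ?_)
  exact hasProp_congr A (h.cluster_pull c t)

end RootedMultigraph

/-! ### Measurability -/

namespace Choices

variable {Ω α β : Type} [MeasurableSpace Ω] {c : Ω → Choices α β} {ξ : Ω → ℕ → Bool}

theorem measurable_birth (hc : Measurable c) (p : Descendant α) :
    Measurable fun ω => (c ω).birth p :=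
  Finset.measurable_sum _ fun _ _ => (measurable_pi_apply _).comp hc.fst

theorem measurable_splitTime (hc : Measurable c) (p : Descendant α) :
    Measurable fun ω => (c ω).splitTime p :=
  (measurable_birth hc p).add ((measurable_pi_apply _).comp hc.fst)

theorem measurable_present (hc : Measurable c) (t : ℝ) (p : Descendant α) :
    Measurable fun ω => (c ω).Present t p :=
  Measurable.and
    (measurableSet_setOfPred.mp (measurableSet_le (measurable_birth hc p) measurable_const))
    (measurableSet_setOfPred.mp (measurableSet_lt measurable_const (measurable_splitTime hc p)))

/-- The second alternative is the default `sInf ∅ = 0`. In `position` it concerns a marker all of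
whose successive vertices split by time `t`; this case is excluded only almost surely. -/
theorem _root_.Nat.sInf_eq_iff_or (S : Set ℕ) (n : ℕ) :
    sInf S = n ↔ (n ∈ S ∧ ∀ m < n, m ∉ S) ∨ (n = 0 ∧ ∀ m, m ∉ S) := by
  constructor
  · rintro rfl
    by_cases hS : S.Nonempty
    · exact Or.inl ⟨Nat.sInf_mem hS, fun m hm => Nat.notMem_of_lt_sInf hm⟩
    · rw [Set.not_nonempty_iff_eq_empty] at hS
      exact Or.inr ⟨by simp [hS], by simp [hS]⟩
  · rintro (⟨h1, h2⟩ | ⟨rfl, h2⟩)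
    · exact le_antisymm (Nat.sInf_le h1) (le_csInf ⟨n, h1⟩ fun m hm => not_lt.mp fun h => h2 m h hm)
    · rw [Set.eq_empty_iff_forall_notMem.mpr h2, Nat.sInf_empty]

theorem measurable_position_eq (hc : Measurable c) (hξ : Measurable ξ) (t : ℝ)
    (p x : Descendant α) : Measurable fun ω => (c ω).position t p (ξ ω) = x := by
  have hr : ∀ n l, Measurable fun ω => (List.range n).map (ξ ω) = l := fun n l =>
    measurable_map_range_eq hξ n l
  have h1 : ∀ n, Measurable fun ω => t < (c ω).splitTime (p.1, p.2 ++ (List.range n).map (ξ ω)) := by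
    intro n
    have : (fun ω => t < (c ω).splitTime (p.1, p.2 ++ (List.range n).map (ξ ω))) = fun ω =>
        ∃ l, (List.range n).map (ξ ω) = l ∧ t < (c ω).splitTime (p.1, p.2 ++ l) := by
      ext ω; simp
    rw [this]
    exact Measurable.exists fun l => (hr n l).and (measurableSet_setOfPred.mp
      (measurableSet_lt measurable_const (measurable_splitTime hc _)))
  have h2 : (fun ω => (c ω).position t p (ξ ω) = x) = fun ω => ∃ n,
      ((t < (c ω).splitTime (p.1, p.2 ++ (List.range n).map (ξ ω)) ∧
        ∀ m, m < n → ¬ t < (c ω).splitTime (p.1, p.2 ++ (List.range m).map (ξ ω))) ∨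
        (n = 0 ∧ ∀ m, ¬ t < (c ω).splitTime (p.1, p.2 ++ (List.range m).map (ξ ω)))) ∧
      ∃ l, (List.range n).map (ξ ω) = l ∧ (p.1, p.2 ++ l) = x := by
    ext ω
    have key := Nat.sInf_eq_iff_or
      {n : ℕ | t < (c ω).splitTime (p.1, p.2 ++ (List.range n).map (ξ ω))}
    simp only [Set.mem_ofPred_eq] at key
    constructor
    · intro h
      exact ⟨_, (key _).mp rfl, _, rfl, h⟩
    · rintro ⟨n, hn, l, rfl, h⟩
      rw [position, (key n).mpr hn]
      exact h
  rw [h2]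
  refine Measurable.exists fun n => Measurable.and (Measurable.or ((h1 n).and
    (Measurable.forall fun m => measurable_const.imp (h1 m).not))
    (measurable_const.and (Measurable.forall fun m => (h1 m).not)))
    (Measurable.exists fun l => (hr n l).and measurable_const)

theorem measurable_eq_position (hc : Measurable c) (hξ : Measurable ξ) (t : ℝ)
    (p x : Descendant α) : Measurable fun ω => x = (c ω).position t p (ξ ω) := by
  simpa only [eq_comm] using measurable_position_eq hc hξ t p x

end Choices

namespace RootedMultigraph

open Choices

variable {Ω α β : Type} [MeasurableSpace Ω]

/-- A random rooted multigraph is measurable. -/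
structure IsMeasurable (Γ : Ω → RootedMultigraph α β) : Prop where
  root : ∀ x, Measurable fun ω => (Γ ω).root = x
  vertex : ∀ x, Measurable fun ω => x ∈ (Γ ω).graph.vertexSet
  link : ∀ e x y, Measurable fun ω => (Γ ω).graph.IsLink e x y

theorem isMeasurable_const (G : RootedMultigraph α β) : IsMeasurable fun _ : Ω => G :=
  ⟨fun _ => measurable_const, fun _ => measurable_const, fun _ _ _ => measurable_const⟩

theorem isMeasurable_id : IsMeasurable fun G : RootedMultigraph ℕ ℕ => G := by
  have h := comap_measurable (m := inferInstance) (fun G : RootedMultigraph ℕ ℕ =>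
    (G.root, (fun x => x ∈ G.graph.vertexSet : ℕ → Prop),
      (fun e x y => G.graph.IsLink e x y : ℕ → ℕ → ℕ → Prop)))
  refine ⟨fun x => ?_, fun x => ?_, fun e x y => ?_⟩
  · exact measurableSet_setOfPred.mp (h.fst (measurableSet_singleton x))
  · exact (measurable_pi_apply x).comp h.snd.fst
  · exact (measurable_pi_apply y).comp ((measurable_pi_apply x).comp
      ((measurable_pi_apply e).comp h.snd.snd))

theorem IsMeasurable.comp {Ω' : Type} [MeasurableSpace Ω'] {Γ : Ω → RootedMultigraph α β}
    (h : IsMeasurable Γ) {φ : Ω' → Ω} (hφ : Measurable φ) : IsMeasurable fun ω => Γ (φ ω) :=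
  ⟨fun x => (h.root x).comp hφ, fun x => (h.vertex x).comp hφ, fun e x y => (h.link e x y).comp hφ⟩

theorem IsMeasurable.measurable {Γ : Ω → RootedMultigraph ℕ ℕ} (h : IsMeasurable Γ) :
    Measurable Γ := by
  refine measurable_comap_iff.mpr (Measurable.prodMk ?_ (Measurable.prodMk ?_ ?_))
  · exact measurable_to_countable' fun x => measurableSet_setOfPred.mpr (h.root x)
  · exact measurable_pi_lambda _ h.vertex
  · exact measurable_pi_lambda _ fun e => measurable_pi_lambda _ fun x =>
      measurable_pi_lambda _ fun y => h.link e x y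

theorem IsMeasurable.map [Countable α] [Countable β] {Γ : Ω → RootedMultigraph α β}
    (h : IsMeasurable Γ) {α' β' : Type} (f : α ↪ α') (g : β ↪ β') :
    IsMeasurable fun ω => (Γ ω).map f g := by
  refine ⟨fun x' => ?_, fun x' => ?_, fun e' x' y' => ?_⟩
  · have : (fun ω => ((Γ ω).map f g).root = x') = fun ω => ∃ x, (Γ ω).root = x ∧ f x = x' := by
      ext ω; simp [RootedMultigraph.map]
    rw [this]
    exact Measurable.exists fun x => (h.root x).and measurable_const
  · exact Measurable.exists fun x => (h.vertex x).and measurable_const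
  · exact Measurable.exists fun e => Measurable.exists fun x => Measurable.exists fun y =>
      (h.link e x y).and measurable_const

/-- An existential over isomorphisms is not visibly measurable. Relabelling by fixed injections into
`ℕ` replaces it by membership in `A`, since `A` is invariant. -/
theorem IsMeasurable.hasProp [Countable α] [Countable β] {Γ : Ω → RootedMultigraph α β}
    (h : IsMeasurable Γ) {A : Set (RootedMultigraph ℕ ℕ)} (hA : MeasurableSet A)
    (hi : IsoInvariant A) : Measurable fun ω => HasProp A (Γ ω) := by
  obtain ⟨f, hf⟩ := exists_injective_nat α
  obtain ⟨g, hg⟩ := exists_injective_nat β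
  have : (fun ω => HasProp A (Γ ω)) = fun ω => (Γ ω).map ⟨f, hf⟩ ⟨g, hg⟩ ∈ A := by
    ext ω
    rw [hasProp_congr A (isEmbedding_map (Γ ω) ⟨f, hf⟩ ⟨g, hg⟩).isomorphic, hi.hasProp_iff]
  rw [this]
  exact measurableSet_setOfPred.mp ((h.map _ _).measurable hA)

theorem IsMeasurable.cluster [Countable α] [Countable β] {Γ : Ω → RootedMultigraph α β}
    (h : IsMeasurable Γ) {c : Ω → Choices α β} (hc : Measurable c) (t : ℝ) :
    IsMeasurable fun ω => (Γ ω).cluster (c ω) t := by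
  have hroot : ∀ x, Measurable fun ω => (c ω).rootAt t (Γ ω).root = x := by
    intro x
    have : (fun ω => (c ω).rootAt t (Γ ω).root = x) = fun ω =>
        ∃ o, (Γ ω).root = o ∧ (c ω).rootAt t o = x := by
      ext ω; simp
    rw [this]
    exact Measurable.exists fun o => (h.root o).and
      (measurable_position_eq hc hc.snd.snd.fst t _ x)
  have hlink : ∀ e x y, Measurable fun ω => (Γ ω).fullLink (c ω) t e x y := by
    rintro (e | ⟨p, i⟩) x y
    · refine (measurable_present hc t x).and ((measurable_present hc t y).and
        (Measurable.exists fun u => Measurable.exists fun v => (h.link e u v).and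
          (Measurable.and ?_ ?_)))
      · exact measurable_eq_position hc
          ((measurable_pi_apply (e, u)).comp hc.snd.snd.snd.fst) t (u, []) x
      · exact measurable_eq_position hc
          ((measurable_pi_apply (e, v)).comp hc.snd.snd.snd.fst) t (v, []) y
    · refine (measurable_present hc t x).and ((measurable_present hc t y).and
        ((h.vertex _).and (Measurable.and ?_ (Measurable.and ?_
          (Measurable.exists fun b => Measurable.and ?_ ?_)))))
      · exact measurableSet_setOfPred.mp
          (measurableSet_le (measurable_splitTime hc p) measurable_const)
      · exact measurableSet_setOfPred.mp
          (measurableSet_lt measurable_const ((measurable_pi_apply p).comp hc.snd.fst))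
      · exact measurable_eq_position hc
          ((measurable_pi_apply ((p, i), b)).comp hc.snd.snd.snd.snd) t (p.1, p.2 ++ [b]) x
      · exact measurable_eq_position hc
          ((measurable_pi_apply ((p, i), !b)).comp hc.snd.snd.snd.snd) t (p.1, p.2 ++ [!b]) y
  have hreach : ∀ x, Measurable fun ω => Relation.ReflTransGen
      ((Γ ω).fullGraph (c ω) t).Adj ((c ω).rootAt t (Γ ω).root) x := by
    intro x
    have : (fun ω => Relation.ReflTransGen
        ((Γ ω).fullGraph (c ω) t).Adj ((c ω).rootAt t (Γ ω).root) x) = fun ω =>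
        ∃ o, (c ω).rootAt t (Γ ω).root = o ∧ Relation.ReflTransGen
          ((Γ ω).fullGraph (c ω) t).Adj o x := by
      ext ω; simp
    rw [this]
    exact Measurable.exists fun o => (hroot o).and (Env.measurable_reflTransGen
      (fun x y => Measurable.exists fun e => hlink e x y) o x)
  exact ⟨hroot, hreach, fun e x y => (hlink e x y).and (hreach x)⟩

/-- The law of the cluster process depends only on the isomorphism class of the start. -/
theorem clusterLaw_congr {α' β' : Type} [Countable α] [Countable β] [Countable α'] [Countable β']
    (lam : ℝ≥0) (t : ℝ) {G : RootedMultigraph α β} {H : RootedMultigraph α' β'}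
    (h : Isomorphic G H) {A : Set (RootedMultigraph ℕ ℕ)} (hA : MeasurableSet A)
    (hi : IsoInvariant A) : clusterLaw lam t G A = clusterLaw lam t H A := by
  -- `G.restrict` embeds both in `G` and in `H`, which compares their laws although no total
  -- injection between the original label types need exist.
  obtain ⟨f, g, hfg⟩ := exists_isEmbedding_restrict h
  obtain ⟨f', g', hfg'⟩ := exists_isEmbedding_restrict (Isomorphic.refl G)
  have hm : MeasurableSet {c | HasProp A (G.restrict.cluster c t)} := measurableSet_setOfPred.mpr
    (((isMeasurable_const G.restrict).cluster measurable_id t).hasProp hA hi)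
  rw [← clusterLaw_of_isEmbedding lam t hfg hm.nullMeasurableSet,
    clusterLaw_of_isEmbedding lam t hfg' hm.nullMeasurableSet]

theorem IsMeasurable.clusterLaw [Countable α] [Countable β] {Γ : Ω → RootedMultigraph α β}
    (h : IsMeasurable Γ) (lam : ℝ≥0) (t : ℝ) {A : Set (RootedMultigraph ℕ ℕ)}
    (hA : MeasurableSet A) (hi : IsoInvariant A) :
    Measurable fun ω => clusterLaw lam t (Γ ω) A := by
  have hm : MeasurableSet {p : Ω × Choices α β | HasProp A ((Γ p.1).cluster p.2 t)} :=
    measurableSet_setOfPred.mpr (((h.comp measurable_fst).cluster measurable_snd t).hasProp hA hi)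
  exact measurable_measure_prodMk_left hm

end RootedMultigraph

/-! ### The descendants of one vertex -/

namespace Choices

variable {α β : Type}

/-- This almost sure event makes split times increase strictly along lines of descent; the label
computations rest on it. -/
def Positive (c : Choices α β) : Prop := ∀ p, 0 < c.lifetime p

theorem ae_positive [Countable α] (lam : ℝ≥0) : ∀ᵐ c ∂(choiceLaw α β lam), c.Positive := by
  refine ae_all_iff.mpr fun p => ?_
  have h : MeasurePreserving (fun c : Choices α β => c.lifetime p) (choiceLaw α β lam)
      (expMeasure 1) :=
    (measurePreserving_eval_infinitePi (fun _ : Descendant α => expMeasure 1) p).comp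
      measurePreserving_fst
  refine h.quasiMeasurePreserving.ae (p := fun l => 0 < l) ?_
  rw [ae_iff]
  simpa [Set.Iic_def] using expMeasure_one_Iic le_rfl

variable (c : Choices α β)

theorem birth_nil (a : α) : c.birth (a, []) = 0 := rfl

theorem birth_concat (a : α) (w : List Bool) (b : Bool) :
    c.birth (a, w ++ [b]) = c.splitTime (a, w) := by
  rw [birth, splitTime, birth, List.length_append, List.length_singleton, Finset.sum_range_succ,
    List.take_left' rfl]
  refine congrArg (· + _) (Finset.sum_congr rfl fun k hk => ?_)
  rw [List.take_append_of_le_length (Finset.mem_range.mp hk).le]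

variable {c}

theorem Positive.birth_lt_splitTime (hc : c.Positive) (p : Descendant α) :
    c.birth p < c.splitTime p := lt_add_of_pos_right _ (hc p)

theorem Positive.birth_le_append (hc : c.Positive) (a : α) (w v : List Bool) :
    c.birth (a, w) ≤ c.birth (a, w ++ v) := by
  induction v generalizing w with
  | nil => simp
  | cons b v ih =>
    have h := ih (w ++ [b])
    rw [birth_concat, List.append_assoc, List.singleton_append] at h
    exact (hc.birth_lt_splitTime _).le.trans h

theorem Positive.splitTime_le_birth (hc : c.Positive) (a : α) (w : List Bool) (b : Bool)
    (v : List Bool) : c.splitTime (a, w) ≤ c.birth (a, w ++ b :: v) := by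
  have h := hc.birth_le_append a (w ++ [b]) v
  rwa [birth_concat, List.append_assoc, List.singleton_append] at h

theorem Positive.birth_nonneg (hc : c.Positive) (p : Descendant α) : 0 ≤ c.birth p :=
  hc.birth_le_append p.1 [] p.2

/-- A marker is at the present vertex `u` exactly if its coins lead to `u`. -/
theorem Positive.position_eq_iff (hc : c.Positive) {t : ℝ} {u : Descendant α} (hu : c.Present t u)
    (p : Descendant α) (ξ : ℕ → Bool) :
    c.position t p ξ = u ↔ ∃ n, u = (p.1, p.2 ++ (List.range n).map ξ) := by
  constructor
  · rintro rfl
    exact ⟨_, rfl⟩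
  · rintro ⟨n, rfl⟩
    have h : sInf {n : ℕ | t < c.splitTime (p.1, p.2 ++ (List.range n).map ξ)} = n := by
      refine (Nat.sInf_eq_iff_or _ n).mpr (Or.inl ⟨hu.2, fun m hm => ?_⟩)
      obtain ⟨k, rfl⟩ := Nat.exists_eq_add_of_lt hm
      refine not_lt.mpr (le_trans ?_ hu.1)
      rw [add_assoc, List.range_add, List.map_append, List.range_succ_eq_map, List.map_cons,
        List.map_cons, ← List.append_assoc]
      exact hc.splitTime_le_birth _ _ _ _
    rw [position, h]

/-- The environment of the descendants of `p`. -/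
def env (c : Choices α β) (p : Descendant α) : Env := fun w =>
  (c.lifetime (p.1, p.2 ++ w), c.newEdges (p.1, p.2 ++ w),
    fun q => c.newEndCoins (((p.1, p.2 ++ w), q.1), q.2))

theorem sub_env (c : Choices α β) (a : α) (w : List Bool) (b : Bool) :
    (c.env (a, w)).sub b = c.env (a, w ++ [b]) := by
  funext v
  simp [Env.sub, env]

theorem env_nil (c : Choices α β) (a : α) (w : List Bool) :
    c.env (a, w) [] = (c.lifetime (a, w), c.newEdges (a, w),
      fun q => c.newEndCoins (((a, w), q.1), q.2)) := by
  simp [env]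

theorem sub_birth (t : ℝ) (a : α) (w : List Bool) (b : Bool) :
    t - c.birth (a, w) - (c.env (a, w) []).1 = t - c.birth (a, w ++ [b]) := by
  rw [birth_concat, splitTime, env_nil]; ring

theorem Positive.lifetime_le (hc : c.Positive) {t : ℝ} {a : α} {w : List Bool} {b : Bool}
    {v : List Bool} (h : c.Present t (a, w ++ b :: v)) :
    (c.env (a, w) []).1 ≤ t - c.birth (a, w) := by
  have := hc.splitTime_le_birth a w b v
  have := h.1
  rw [env_nil]
  rw [splitTime] at *
  simp only
  linarith

/-- The translation from labelled vertices to the environment is needed in this direction only,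
because the environment serves to bound sizes, degrees and connection events from above. -/
theorem Positive.atLeaf_env (hc : c.Positive) {t : ℝ} {a : α} {w u : List Bool} {ξ : ℕ → Bool}
    (hu : c.Present t (a, w ++ u)) {n : ℕ} (hn : u = (List.range n).map ξ) :
    Env.AtLeaf u (t - c.birth (a, w)) (c.env (a, w)) ξ := by
  induction u generalizing w ξ n with
  | nil =>
    rw [Env.AtLeaf, env_nil]
    have h := hu.2
    rw [splitTime, List.append_nil] at h
    simp only
    linarith
  | cons b u ih =>
    cases n with
    | zero => simp at hn
    | succ n =>
      rw [List.range_succ_eq_map, List.map_cons, List.map_map, List.cons.injEq] at hn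
      refine ⟨hc.lifetime_le hu, hn.1.symm, ?_⟩
      rw [sub_env, sub_birth t a w b]
      refine ih (n := n) ?_ hn.2
      simpa using hu

theorem Positive.adj_env (hc : c.Positive) {t : ℝ} {a : α} {s w u v : List Bool} {b : Bool} {i : ℕ}
    (hu : c.Present t (a, s ++ w ++ b :: u)) (hv : c.Present t (a, s ++ w ++ (!b) :: v))
    (hi : i < c.newEdges (a, s ++ w)) {m n : ℕ}
    (hm : u = (List.range m).map (c.newEndCoins (((a, s ++ w), i), b)))
    (hn : v = (List.range n).map (c.newEndCoins (((a, s ++ w), i), !b))) :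
    Env.Adj (w ++ b :: u) (w ++ (!b) :: v) (t - c.birth (a, s)) (c.env (a, s)) := by
  induction w generalizing s with
  | nil =>
    simp only [List.append_nil, List.nil_append] at *
    refine ⟨hc.lifetime_le hu, Or.inr ⟨by simp, i, ?_, ?_, ?_⟩⟩
    · rw [env_nil]; exact hi
    · rw [sub_env, sub_birth t a s b, env_nil]
      exact hc.atLeaf_env (by simpa using hu) hm
    · rw [sub_env, sub_birth t a s (!b), env_nil]
      exact hc.atLeaf_env (by simpa using hv) hn
  | cons d w ih =>
    have e : ∀ z : List Bool, s ++ d :: w ++ z = s ++ [d] ++ w ++ z := fun z => by simp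
    have e' : s ++ d :: w = s ++ [d] ++ w := by simp
    refine ⟨hc.lifetime_le (b := d) (v := w ++ b :: u) (by simpa using hu), Or.inl ⟨rfl, ?_⟩⟩
    rw [sub_env, sub_birth t a s d]
    rw [e'] at hi hm hn
    exact ih (by rwa [← e]) (by rwa [← e]) hi hm hn

theorem Positive.inc_env (hc : c.Positive) {t : ℝ} {a : α} {s w u : List Bool} {b : Bool} {i : ℕ}
    (hu : c.Present t (a, s ++ w ++ b :: u))
    (hi : i < c.newEdges (a, s ++ w)) {m : ℕ}
    (hm : u = (List.range m).map (c.newEndCoins (((a, s ++ w), i), b))) :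
    Env.Inc w i (w ++ b :: u) (t - c.birth (a, s)) (c.env (a, s)) := by
  induction w generalizing s with
  | nil =>
    simp only [List.append_nil, List.nil_append] at *
    refine ⟨hc.lifetime_le hu, ?_, ?_⟩
    · rw [env_nil]; exact hi
    · rw [sub_env, sub_birth t a s b, env_nil]
      exact hc.atLeaf_env (by simpa using hu) hm
  | cons d w ih =>
    have e : ∀ z : List Bool, s ++ d :: w ++ z = s ++ [d] ++ w ++ z := fun z => by simp
    have e' : s ++ d :: w = s ++ [d] ++ w := by simp
    refine ⟨hc.lifetime_le (b := d) (v := w ++ b :: u) (by simpa using hu), rfl, ?_⟩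
    rw [sub_env, sub_birth t a s d]
    rw [e'] at hi hm
    exact ih (by rwa [← e]) hi hm

theorem Positive.atLeaf_of_present (hc : c.Positive) {t : ℝ} {a : α} {ξ : ℕ → Bool}
    (h : c.Present t (c.position t (a, []) ξ)) :
    Env.AtLeaf (c.position t (a, []) ξ).2 t (c.env (a, [])) ξ := by
  have := hc.atLeaf_env (w := []) (ξ := ξ) (by exact h) rfl
  rwa [birth_nil, sub_zero] at this

end Choices

/-! ### The cluster of a single vertex and its environment -/

namespace RootedMultigraph

open Choices

variable {α β : Type}

/-- The multigraph with one vertex. -/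
def single (β : Type) (o : α) : RootedMultigraph α β where
  graph :=
    { vertexSet := {o}
      IsLink := fun _ _ _ => False
      isLink_symm := fun _ _ => ⟨fun _ _ h => h⟩
      eq_or_eq_of_isLink_of_isLink := fun _ _ _ _ _ h => h.elim
      left_mem_of_isLink := fun _ _ _ h => h.elim }
  root := o
  root_mem := rfl
  loopless := ⟨fun _ _ h => h⟩
  connected := by
    rintro x rfl
    exact .refl

theorem single_link {c : Choices α β} {t : ℝ} {o : α} {e : EdgeLabel α β} {x y : Descendant α}
    (h : ((single β o).fullGraph c t).IsLink e x y) : ∃ w i b, e = .inr ((o, w), i) ∧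
      c.Present t x ∧ c.Present t y ∧ c.splitTime (o, w) ≤ t ∧ i < c.newEdges (o, w) ∧
      x = c.newEnd t (o, w) i b ∧ y = c.newEnd t (o, w) i (!b) := by
  obtain e | ⟨⟨a, w⟩, i⟩ := e
  · obtain ⟨-, -, u, v, h, -⟩ := h
    exact h.elim
  · obtain ⟨hx, hy, h1, h2, h3, b, h4, h5⟩ := h
    have h1 : a = o := h1
    subst h1
    exact ⟨w, i, b, rfl, hx, hy, h2, h3, h4, h5⟩

theorem single_adj {c : Choices α β} (hc : c.Positive) {t : ℝ} {o : α} {x y : Descendant α}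
    (h : ((single β o).fullGraph c t).Adj x y) : Env.Adj x.2 y.2 t (c.env (o, [])) := by
  obtain ⟨e, h⟩ := h
  obtain ⟨w, i, b, rfl, hx, hy, -, hi, rfl, rfl⟩ := single_link h
  obtain ⟨m, hm⟩ := (hc.position_eq_iff hx (o, w ++ [b]) (c.newEndCoins (((o, w), i), b))).mp rfl
  obtain ⟨n, hn⟩ := (hc.position_eq_iff hy (o, w ++ [!b])
    (c.newEndCoins (((o, w), i), !b))).mp rfl
  simp only [List.append_assoc, List.singleton_append] at hm hn
  rw [hm] at hx ⊢
  rw [hn] at hy ⊢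
  have := hc.adj_env (s := []) (w := w) hx hy hi rfl rfl
  rwa [birth_nil, sub_zero] at this

theorem single_inc {c : Choices α β} (hc : c.Positive) {t : ℝ} {o : α} {x : Descendant α}
    {e : EdgeLabel α β} (h : ((single β o).fullGraph c t).Inc e x) :
    ∃ w i, e = .inr ((o, w), i) ∧ Env.Inc w i x.2 t (c.env (o, [])) ∧ c.Present t x := by
  obtain ⟨y, h⟩ := h
  obtain ⟨w, i, b, rfl, hx, hy, -, hi, rfl, rfl⟩ := single_link h
  obtain ⟨m, hm⟩ := (hc.position_eq_iff hx (o, w ++ [b]) (c.newEndCoins (((o, w), i), b))).mp rfl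
  simp only [List.append_assoc, List.singleton_append] at hm
  refine ⟨w, i, rfl, ?_, hx⟩
  rw [hm] at hx ⊢
  have := hc.inc_env (s := []) (w := w) hx hi rfl
  rwa [birth_nil, sub_zero] at this

/-- Links join present vertices only, so a path that leaves `x` certifies that `x` is present. This
matters because the default position of a marker need not be. -/
theorem single_reach {c : Choices α β} (hc : c.Positive) {t : ℝ} {o : α} {x y : Descendant α}
    (h : Relation.ReflTransGen ((single β o).fullGraph c t).Adj x y) :
    Env.Conn x.2 y.2 t (c.env (o, [])) ∧ (y ≠ x → c.Present t x ∧ y.1 = o) := by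
  induction h with
  | refl => exact ⟨.refl, fun h => absurd rfl h⟩
  | @tail y z hy hz ih =>
    have hz' := hz
    obtain ⟨e, he⟩ := hz
    obtain ⟨w, i, b, -, hy', -, -, -, hyb, hzb⟩ := single_link he
    refine ⟨ih.1.tail (single_adj hc hz'), fun _ => ⟨?_, by rw [hzb]; rfl⟩⟩
    by_cases hyx : y = x
    · rwa [← hyx]
    · exact (ih.2 hyx).1

theorem encard_le_tsum_ind {ι κ : Type*} (s : Set ι) (φ : ι → κ) (hφ : Set.InjOn φ s)
    {P : κ → Prop} (hP : ∀ x ∈ s, P (φ x)) : (s.encard : ℝ≥0∞) ≤ ∑' k, ind (P k) := by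
  rw [← ENNReal.tsum_set_one]
  refine (ENNReal.tsum_le_tsum fun x : s => ?_).trans
    (ENNReal.tsum_comp_le_tsum_of_injective (f := fun x : s => φ x) (fun x y h =>
      Subtype.ext (hφ x.2 y.2 h)) fun k => ind (P k))
  exact (ind_of (hP x x.2)).ge

/-- The cluster of a single vertex is at most a single vertex or the component in the
environment. -/
theorem size_cluster_single_le {c : Choices α β} (hc : c.Positive) (t : ℝ) (o : α) :
    (((single β o).cluster c t).size : ℝ≥0∞) ≤
      1 + ∑' v, ind (Env.Reach t (c.env (o, [])) c.rootCoins v) := by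
  set V := ((single β o).cluster c t).graph.vertexSet with hV
  set r := c.rootAt t o with hr
  have h1 : ∀ x ∈ V \ {r}, c.Present t r ∧ x.1 = o ∧ Env.Conn r.2 x.2 t (c.env (o, [])) := by
    rintro x ⟨hx, hxr⟩
    have h := single_reach hc hx
    exact ⟨(h.2 hxr).1, (h.2 hxr).2, h.1⟩
  -- The root belongs to its component by definition, even when it is not a present vertex; it is
  -- counted separately, which accounts for the extra 1.
  have h2 : V ⊆ {r} ∪ V \ {r} := fun x hx => by
    by_cases h : x = r
    · exact Or.inl h
    · exact Or.inr ⟨hx, h⟩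
  have h3 : V.encard ≤ 1 + (V \ {r}).encard :=
    (Set.encard_le_encard h2).trans ((Set.encard_union_le _ _).trans (by simp))
  have h4 : ((V \ {r}).encard : ℝ≥0∞) ≤
      ∑' v, ind (Env.Reach t (c.env (o, [])) c.rootCoins v) :=
    encard_le_tsum_ind _ Prod.snd (fun x hx y hy h =>
      Prod.ext ((h1 x hx).2.1.trans (h1 y hy).2.1.symm) h)
      fun x hx => ⟨r.2, hc.atLeaf_of_present (h1 x hx).1, (h1 x hx).2.2⟩
  calc ((V.encard : ℕ∞) : ℝ≥0∞) ≤ ((1 + (V \ {r}).encard : ℕ∞) : ℝ≥0∞) := by exact_mod_cast h3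
    _ = 1 + ((V \ {r}).encard : ℝ≥0∞) := by simp
    _ ≤ _ := by gcongr

theorem rootDegree_cluster_single_le {c : Choices α β} (hc : c.Positive) (t : ℝ) (o : α) :
    (((single β o).cluster c t).rootDegree : ℝ≥0∞) ≤
      ∑' (w : List Bool) (i : ℕ), ind (∃ u, Env.AtLeaf u t (c.env (o, [])) c.rootCoins ∧
        Env.Inc w i u t (c.env (o, []))) := by
  rw [← ENNReal.tsum_prod (f := fun (w : List Bool) (i : ℕ) => ind (∃ u,
    Env.AtLeaf u t (c.env (o, [])) c.rootCoins ∧ Env.Inc w i u t (c.env (o, []))))]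
  have h1 : ∀ e, ((single β o).cluster c t).graph.Inc e ((single β o).cluster c t).root →
      ∃ w i, e = .inr ((o, w), i) ∧
        Env.Inc w i (c.rootAt t o).2 t (c.env (o, [])) ∧ c.Present t (c.rootAt t o) := by
    rintro e ⟨y, hy⟩
    exact single_inc hc ⟨y, hy.1⟩
  refine encard_le_tsum_ind _ (fun e : EdgeLabel α β => match e with
    | .inl _ => ([], 0)
    | .inr q => (q.1.2, q.2)) ?_ ?_
  · intro e he e' he' h
    obtain ⟨w, i, rfl, -⟩ := h1 e he
    obtain ⟨w', i', rfl, -⟩ := h1 e' he'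
    simp only [Prod.mk.injEq] at h
    rw [h.1, h.2]
  · intro e he
    obtain ⟨w, i, rfl, hi, hp⟩ := h1 e he
    exact ⟨_, hc.atLeaf_of_present hp, hi⟩

/-- Markers at present vertices of the same component, in the environment. -/
theorem mconn_of_single {c : Choices α β} (hc : c.Positive) {t : ℝ} {o : α} {ξ : ℕ → Bool}
    (hp : c.Present t (c.position t (o, []) ξ))
    (h : Relation.ReflTransGen ((single β o).fullGraph c t).Adj (c.rootAt t o)
      (c.position t (o, []) ξ)) : Env.MConn t (c.env (o, [])) c.rootCoins ξ := by
  have hr := single_reach hc h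
  have hp' : c.Present t (c.rootAt t o) := by
    by_cases he : c.position t (o, []) ξ = c.rootAt t o
    · rwa [← he]
    · exact (hr.2 he).1
  exact ⟨_, _, hc.atLeaf_of_present hp', hr.1, hc.atLeaf_of_present hp⟩

/-- Unless a starting edge meets the cluster of the starting root, the cluster only depends on the
descendants of the starting root. -/
theorem cluster_isomorphic_single (G : RootedMultigraph α β) {c : Choices α β} (hc : c.Positive)
    (t : ℝ) (hno : ∀ e, G.graph.Inc e G.root →
      ¬ Env.MConn t (c.env (G.root, [])) c.rootCoins (c.oldEndCoins (e, G.root))) :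
    Isomorphic ((single β G.root).cluster c t) (G.cluster c t) := by
  have hfst : ∀ x, Relation.ReflTransGen ((single β G.root).fullGraph c t).Adj
      (c.rootAt t G.root) x → x.1 = G.root := by
    intro x hx
    induction hx with
    | refl => rfl
    | tail _ hz _ =>
      obtain ⟨e, he⟩ := hz
      obtain ⟨w, i, b, -, -, -, -, -, -, rfl⟩ := single_link he
      rfl
  refine component_isomorphic _ _ id id rfl (fun _ _ _ _ h => h) (fun _ _ _ _ _ _ _ _ _ _ h => h)
    ?_ ?_
  · intro e x y _ h
    obtain ⟨w, i, b, rfl, hx, hy, h1, h2, h3, h4⟩ := single_link h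
    exact ⟨hx, hy, G.root_mem, h1, h2, b, h3, h4⟩
  · rintro (e | ⟨⟨a, w⟩, i⟩) x y hx
    · rintro ⟨hpx, -, u, v, hl, rfl, -⟩
      -- So far the cluster consists of descendants of the starting root, so a starting edge
      -- attached to it began at that root, and its end there is a marker connected to the current
      -- root, against `hno`.
      have hu : u = G.root := hfst _ hx
      subst hu
      exact (hno e ⟨v, hl⟩ (mconn_of_single hc hpx hx)).elim
    · rintro ⟨hpx, hpy, h1, h2, h3, b, rfl, rfl⟩
      have ha : a = G.root := hfst _ hx
      exact ⟨.inr ((a, w), i), _, ⟨hpx, hpy, ha, h2, h3, b, rfl, rfl⟩, rfl, rfl⟩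

end RootedMultigraph

/-! ### The law of the environment and the comparison with a single vertex -/

theorem measurePreserving_prod_rearrange {X₁ X₂ X₃ X₄ X₅ : Type*} [MeasurableSpace X₁]
    [MeasurableSpace X₂] [MeasurableSpace X₃] [MeasurableSpace X₄] [MeasurableSpace X₅]
    (μ₁ : Measure X₁) (μ₂ : Measure X₂) (μ₃ : Measure X₃) (μ₄ : Measure X₄) (μ₅ : Measure X₅)
    [SFinite μ₁] [SFinite μ₂] [SFinite μ₃] [SFinite μ₄] [SFinite μ₅] :
    MeasurePreserving (fun x : X₁ × X₂ × X₃ × X₄ × X₅ =>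
      ((x.1, (x.2.1, x.2.2.2.2)), (x.2.2.1, x.2.2.2.1)))
      (μ₁.prod (μ₂.prod (μ₃.prod (μ₄.prod μ₅))))
      ((μ₁.prod (μ₂.prod μ₅)).prod (μ₃.prod μ₄)) := by
  have h1 := (MeasurePreserving.id μ₁).prod ((MeasurePreserving.id μ₂).prod
    (measurePreserving_prodAssoc μ₃ μ₄ μ₅).symm)
  have h2 := (MeasurePreserving.id μ₁).prod ((MeasurePreserving.id μ₂).prod
    (Measure.measurePreserving_swap (μ := μ₃.prod μ₄) (ν := μ₅)))
  have h3 := (MeasurePreserving.id μ₁).prod (measurePreserving_prodAssoc μ₂ μ₅ (μ₃.prod μ₄)).symm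
  have h4 := (measurePreserving_prodAssoc μ₁ (μ₂.prod μ₅) (μ₃.prod μ₄)).symm
  exact h4.comp (h3.comp (h2.comp h1))

namespace Choices

variable {α β : Type}

/-- The law of the environment of a starting vertex, with the choices of the root and of the ends
of the starting edges. -/
theorem measurePreserving_env (o : α) (lam : ℝ≥0) :
    MeasurePreserving (fun c : Choices α β => (c.env (o, []), c.rootCoins, c.oldEndCoins))
      (choiceLaw α β lam) ((Env.law lam).prod
        (coinTosses.prod (Measure.infinitePi fun _ => coinTosses))) := by
  have h1 : Function.Injective fun w : List Bool => (o, w) := fun w w' h => (Prod.ext_iff.mp h).2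
  have h2 : Function.Injective fun q : List Bool × (ℕ × Bool) => (((o, q.1), q.2.1), q.2.2) := by
    rintro ⟨w, i, b⟩ ⟨w', i', b'⟩ h
    simp only [Prod.mk.injEq, true_and] at h
    rw [h.1.1, h.1.2, h.2]
  have hcurry : MeasurePreserving (MeasurableEquiv.curry (List Bool) (ℕ × Bool) (ℕ → Bool))
      (Measure.infinitePi fun _ => coinTosses)
      (Measure.infinitePi fun _ => Measure.infinitePi fun _ => coinTosses) :=
    ⟨MeasurableEquiv.measurable _, Measure.infinitePi_map_curry (fun _ _ => coinTosses)⟩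
  have hidx := measurePreserving_infinitePi_reindex coinTosses h2
  have hnew := hcurry.comp hidx
  have hE := measurePreserving_infinitePi_reindex (expMeasure 1) h1
  have hN := measurePreserving_infinitePi_reindex (poissonMeasure (lam / 2)) h1
  have hzip1 := measurePreserving_infinitePi_prod_coord (ι := List Bool) (poissonMeasure (lam / 2))
    (Measure.infinitePi fun _ : ℕ × Bool => coinTosses) (Env.splitLaw lam) (U := fun _ => id)
    (fun _ => MeasurePreserving.id _)
  have hzip2 := measurePreserving_infinitePi_prod_coord (ι := List Bool) (expMeasure 1)
    (Env.splitLaw lam) (Env.nodeLaw lam) (U := fun _ => id)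
    (fun _ => MeasurePreserving.id _)
  have hfinal := (hzip2.comp (hE.prod (hzip1.comp (hN.prod hnew)))).prod
    (MeasurePreserving.id (coinTosses.prod (Measure.infinitePi fun _ : β × α => coinTosses)))
  exact hfinal.comp (measurePreserving_prod_rearrange _ _ _ _ _)

theorem lintegral_env_root (o : α) (lam : ℝ≥0) {F : Env × (ℕ → Bool) → ℝ≥0∞} (hF : Measurable F) :
    ∫⁻ c : Choices α β, F (c.env (o, []), c.rootCoins) ∂(choiceLaw α β lam) =
      ∫⁻ z, F z ∂((Env.law lam).prod coinTosses) :=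
  (((MeasurePreserving.id _).prod measurePreserving_fst).comp
    (measurePreserving_env o lam)).lintegral_comp hF

/-- The end of a starting edge at `o` has its own coins, independent of the root's coins and of the
environment below `o`: it is exactly the independent marker in the definition of `weight`. -/
theorem measure_mconn_oldEnd (o : α) (e : β) (lam : ℝ≥0) (t : ℝ) :
    choiceLaw α β lam {c | Env.MConn t (c.env (o, [])) c.rootCoins (c.oldEndCoins (e, o))} =
      Env.connProb lam t := by
  have hE : MeasurePreserving (fun x : β × α → ℕ → Bool => x (e, o))
      (Measure.infinitePi fun _ => coinTosses) coinTosses :=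
    measurePreserving_eval_infinitePi (fun _ : β × α => coinTosses) (e, o)
  have h := ((MeasurePreserving.id (Env.law lam)).prod
    ((MeasurePreserving.id coinTosses).prod hE)).comp (measurePreserving_env o lam)
  have hm : Measurable fun z : Env × (ℕ → Bool) × (ℕ → Bool) => Env.MConn t z.1 z.2.1 z.2.2 :=
    Env.measurable_mconn measurable_const measurable_fst measurable_snd.fst measurable_snd.snd
  have h1 := h.measure_preimage (measurableSet_setOfPred.mpr hm).nullMeasurableSet
  refine h1.trans ?_
  have h2 := (measurePreserving_prodAssoc (Env.law lam) coinTosses coinTosses).measure_preimage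
    (measurableSet_setOfPred.mpr hm).nullMeasurableSet
  rw [← h2, Measure.prod_apply ((MeasurableEquiv.measurable _) (measurableSet_setOfPred.mpr hm))]
  rfl

end Choices

namespace RootedMultigraph

open Choices

variable {α β : Type} [Countable α] [Countable β]

theorem exists_lintegral_cluster_single_le {lam : ℝ≥0} (hlam : 0 < lam) :
    ∃ B : ℝ≥0, ∀ (t : ℝ), 0 ≤ t → ∀ (α β : Type) [Countable α] [Countable β] (o : α),
      ∫⁻ c, (((single β o).cluster c t).size : ℝ≥0∞) ∂(choiceLaw α β lam) ≤ B ∧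
      ∫⁻ c, (((single β o).cluster c t).rootDegree : ℝ≥0∞) ∂(choiceLaw α β lam) ≤ B := by
  obtain ⟨B, hB⟩ := Env.exists_lintegral_total_le hlam
  have hfst : Measurable fun z : Env × (ℕ → Bool) => z.1 := measurable_fst
  have hsnd : Measurable fun z : Env × (ℕ → Bool) => z.2 := measurable_snd
  refine ⟨1 + B, fun t ht α β _ _ o => ⟨?_, ?_⟩⟩
  · have hm : Measurable fun z : Env × (ℕ → Bool) => 1 + ∑' v, ind (Env.Reach t z.1 z.2 v) :=
      measurable_const.add (Measurable.tsum fun v => measurable_ind (Measurable.exists fun u =>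
        (Env.measurable_atLeaf measurable_const hfst hsnd u).and
          (Env.measurable_conn measurable_const hfst u v)))
    refine (lintegral_mono_ae ((ae_positive lam).mono fun c hc =>
      size_cluster_single_le hc t o)).trans ?_
    rw [lintegral_env_root o lam hm, lintegral_add_left measurable_const, lintegral_one,
      measure_univ]
    push_cast
    gcongr
    exact (hB t ht).1
  · have hm : Measurable fun z : Env × (ℕ → Bool) => ∑' (w : List Bool) (i : ℕ),
        ind (∃ u, Env.AtLeaf u t z.1 z.2 ∧ Env.Inc w i u t z.1) :=
      Measurable.tsum fun w => Measurable.tsum fun i => measurable_ind (Measurable.exists fun u =>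
        (Env.measurable_atLeaf measurable_const hfst hsnd u).and
          (Env.measurable_inc measurable_const hfst w i u))
    refine (lintegral_mono_ae ((ae_positive lam).mono fun c hc =>
      rootDegree_cluster_single_le hc t o)).trans ?_
    rw [lintegral_env_root o lam hm]
    push_cast
    exact (hB t ht).2.trans le_add_self

/-- The cluster process from a multigraph is close to the one from a single vertex. -/
theorem clusterLaw_le (lam : ℝ≥0) (t : ℝ) (G : RootedMultigraph α β)
    (A : Set (RootedMultigraph ℕ ℕ)) :
    clusterLaw lam t G A ≤ clusterLaw lam t (single β G.root) A +
      G.rootDegree * Env.connProb lam t := by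
  have h1 : (G.rootDegree : ℝ≥0∞) * Env.connProb lam t =
      ∑' e : {e | G.graph.Inc e G.root}, choiceLaw α β lam
        {c | Env.MConn t (c.env (G.root, [])) c.rootCoins (c.oldEndCoins (e.1, G.root))} := by
    simp only [measure_mconn_oldEnd]
    rw [ENNReal.tsum_set_const]
    rfl
  rw [h1]
  -- Outside the union, over edges at the root, of the events of meeting the root's component, the
  -- two clusters are isomorphic; the union bound also covers an infinite root degree.
  refine le_trans (measure_mono_ae ?_) ((measure_union_le _ _).trans
    (add_le_add_right (measure_iUnion_le _) _))
  filter_upwards [ae_positive lam] with c hc hA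
  by_cases hno : ∀ e, G.graph.Inc e G.root →
      ¬ Env.MConn t (c.env (G.root, [])) c.rootCoins (c.oldEndCoins (e, G.root))
  · exact Or.inl ((hasProp_congr A (cluster_isomorphic_single G hc t hno)).mpr hA)
  · push Not at hno
    obtain ⟨e, he, hM⟩ := hno
    exact Or.inr (Set.mem_iUnion.mpr ⟨⟨e, he⟩, hM⟩)

/-- The law of the cluster process from a single vertex. -/
def singleLaw (lam : ℝ≥0) (t : ℝ) (A : Set (RootedMultigraph ℕ ℕ)) : ℝ≥0∞ :=
  clusterLaw lam t (single Empty ()) A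

theorem clusterLaw_single (lam : ℝ≥0) (t : ℝ) (o : α) {A : Set (RootedMultigraph ℕ ℕ)}
    (hA : MeasurableSet A) (hi : IsoInvariant A) :
    clusterLaw lam t (single β o) A = singleLaw lam t A := by
  have h : IsEmbedding (single Empty ()) (single β o) (fun _ => o) Empty.elim :=
    ⟨fun _ _ _ => rfl, fun x => x.elim, rfl, fun _ _ => rfl, fun x' hx => ⟨(), rfl, hx.symm⟩,
      fun e => e.elim, fun _ _ _ h => h.elim⟩
  exact (clusterLaw_congr lam t h.isomorphic hA hi).symm

end RootedMultigraph

/-! ### The Markov property -/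

namespace Choices

variable {α : Type}

/-- The ancestor of `q` that is present at time `s`, and the position of `q` among its
descendants; if `q` has split before, it is taken as its own ancestor. -/
def cut (s : ℝ) (c : Choices α Empty) (q : Descendant α) : Descendant (Descendant α) :=
  if s < c.splitTime q then
    ((q.1, q.2.take (sInf {n | s < c.splitTime (q.1, q.2.take n)})),
      q.2.drop (sInf {n | s < c.splitTime (q.1, q.2.take n)}))
  else (q, [])

/-- The choices `c'` made after time `s`, labelled by the descendants of the starting vertices. -/
def restart (s : ℝ) (c : Choices α Empty) (c' : Choices (Descendant α) (EdgeLabel α Empty)) :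
    Choices α Empty :=
  (fun q => c'.lifetime (cut s c q), fun q => c'.newEdges (cut s c q), c'.rootCoins,
    fun e => e.1.elim,
    -- An edge created by time `s` is a starting edge of the restarted process, so its coins are
    -- those indexed by the edge and the location of its end at time `s`.
    fun k => if s < c.splitTime k.1.1 then c'.newEndCoins ((cut s c k.1.1, k.1.2), k.2)
      else c'.oldEndCoins (.inr k.1, c.newEnd s k.1.1 k.1.2 k.2))

/-- The choices `c` up to time `s`, and the choices `η` afterwards. -/
def concat (s : ℝ) (o : α) (c η : Choices α Empty) : Choices α Empty :=
  (fun q => if c.lifetime q ≤ s - c.birth q then c.lifetime q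
      else max (s - c.birth q) 0 + η.lifetime q,
    fun q => if c.splitTime q ≤ s then c.newEdges q else η.newEdges q,
    splice (fun w => s < c.splitTime (o, w)) c.rootCoins η.rootCoins,
    η.oldEndCoins,
    -- The first alternative holds already for the empty word: the ends of an edge created after
    -- time `s` follow the later coins from the outset.
    fun k => splice (fun w => s < c.splitTime k.1.1 ∨
      s < c.splitTime (k.1.1.1, k.1.1.2 ++ [k.2] ++ w)) (c.newEndCoins k) (η.newEndCoins k))

section

variable {s t : ℝ} {o : α} {c η : Choices α Empty}
  {c' : Choices (Descendant α) (EdgeLabel α Empty)}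

theorem Positive.splitTime_le_append (hc : c.Positive) (a : α) (w r : List Bool) :
    c.splitTime (a, w) ≤ c.splitTime (a, w ++ r) := by
  cases r with
  | nil => simp
  | cons b r => exact (hc.splitTime_le_birth a w b r).trans (hc.birth_lt_splitTime _).le

/-- Split times increase along prefixes, so the first prefix surviving beyond `s` is the ancestor
present at `s`. -/
theorem Positive.cut_append (hc : c.Positive) {a : α} {w : List Bool} (h : c.Present s (a, w))
    (r : List Bool) : cut s c (a, w ++ r) = ((a, w), r) := by
  have hlen : sInf {n | s < c.splitTime (a, (w ++ r).take n)} = w.length := by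
    refine (Nat.sInf_eq_iff_or _ _).mpr (Or.inl ⟨?_, fun m hm => ?_⟩)
    · rw [Set.mem_ofPred_eq, List.take_left' rfl]
      exact h.2
    · rw [Set.mem_ofPred_eq, List.take_append_of_le_length hm.le, not_lt]
      refine le_trans ?_ h.1
      have h1 := hc.splitTime_le_birth a (w.take m) w[m] (w.drop (m + 1))
      rwa [List.getElem_cons_drop, List.take_append_drop] at h1
  rw [cut, if_pos (h.2.trans_le (hc.splitTime_le_append a w r))]
  simp only [hlen, List.take_left' rfl, List.drop_left' rfl]

/-- The descendants of `a` present at a given time form an antichain for the prefix order, so a word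
determines its present ancestor and the remainder. -/
theorem Positive.append_inj (hc : c.Positive) {a : α} {w w' r r' : List Bool}
    (h : c.Present s (a, w)) (h' : c.Present s (a, w')) (he : w ++ r = w' ++ r') :
    w = w' ∧ r = r' := by
  have h1 := hc.cut_append h r
  rw [he, hc.cut_append h' r'] at h1
  simp only [Prod.mk.injEq, true_and] at h1
  exact ⟨h1.1.symm, h1.2.symm⟩

theorem exists_present_append (hs : 0 ≤ s) (a : α) (l : List Bool)
    (h : s < c.splitTime (a, l)) : ∃ w r, l = w ++ r ∧ c.Present s (a, w) := by
  induction l using List.reverseRecOn with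
  | nil => exact ⟨[], [], rfl, hs, h⟩
  | append_singleton l b ih =>
    by_cases hl : s < c.splitTime (a, l)
    · obtain ⟨w, r, rfl, hw⟩ := ih hl
      exact ⟨w, r ++ [b], by simp, hw⟩
    · refine ⟨l ++ [b], [], by simp, ?_, h⟩
      rw [birth_concat]
      exact not_lt.mp hl

theorem concat_lifetime (q : Descendant α) : (concat s o c η).lifetime q =
    if c.lifetime q ≤ s - c.birth q then c.lifetime q
      else max (s - c.birth q) 0 + η.lifetime q := rfl

theorem Positive.concat (hc : c.Positive) (hη : η.Positive) : (concat s o c η).Positive := by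
  intro q
  rw [concat_lifetime]
  split_ifs
  · exact hc q
  · exact add_pos_of_nonneg_of_pos (le_max_right _ _) (hη q)

theorem Positive.restart (hc' : c'.Positive) : (restart s c c').Positive := fun _ => hc' _

theorem Positive.concat_splitTime_of_le (hc : c.Positive) {a : α} {w : List Bool}
    (h : c.splitTime (a, w) ≤ s) : (Choices.concat s o c η).splitTime (a, w) = c.splitTime (a, w) ∧
      (Choices.concat s o c η).birth (a, w) = c.birth (a, w) := by
  have key : ∀ w, c.splitTime (a, w) ≤ s →
      (Choices.concat s o c η).lifetime (a, w) = c.lifetime (a, w) := fun w hw => by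
    rw [concat_lifetime, if_pos]
    rw [splitTime] at hw
    linarith
  induction w using List.reverseRecOn with
  | nil => exact ⟨by rw [splitTime, splitTime, key _ h]; rfl, rfl⟩
  | append_singleton l b ih =>
    have hl : c.splitTime (a, l) ≤ s := (hc.splitTime_le_append a l [b]).trans h
    have hb : (Choices.concat s o c η).birth (a, l ++ [b]) = c.birth (a, l ++ [b]) := by
      rw [birth_concat, birth_concat, (ih hl).1]
    exact ⟨by rw [splitTime, splitTime, key _ h, hb], hb⟩

theorem Positive.concat_birth_of_le (hc : c.Positive) {a : α} {w : List Bool}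
    (h : c.birth (a, w) ≤ s) : (Choices.concat s o c η).birth (a, w) = c.birth (a, w) := by
  induction w using List.reverseRecOn with
  | nil => rfl
  | append_singleton l b _ =>
    rw [birth_concat] at h ⊢
    rw [birth_concat, (hc.concat_splitTime_of_le h).1]

/-- The descendants of a vertex present at time `s` evolve according to the restarted process. -/
theorem Positive.concat_splitTime (hc : c.Positive) {a : α} {w : List Bool}
    (h : c.Present s (a, w)) (r : List Bool) :
    (Choices.concat s o c (Choices.restart s c c')).splitTime (a, w ++ r) =
      s + c'.splitTime ((a, w), r) := by
  have hlife : ∀ r, (Choices.restart s c c').lifetime (a, w ++ r) = c'.lifetime ((a, w), r) :=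
    fun r => by
      show c'.lifetime (cut s c (a, w ++ r)) = _
      rw [hc.cut_append h r]
  induction r using List.reverseRecOn with
  | nil =>
    have h0 : ¬ c.lifetime (a, w) ≤ s - c.birth (a, w) := by
      have := h.2
      rw [splitTime] at this
      linarith
    have h1 := hlife []
    rw [List.append_nil] at h1 ⊢
    rw [splitTime, hc.concat_birth_of_le h.1, concat_lifetime, if_neg h0, h1,
      max_eq_left (sub_nonneg.mpr h.1), splitTime, birth_nil]
    ring
  | append_singleton r b ih =>
    have h0 : s < c.birth (a, w ++ (r ++ [b])) := by
      rw [← List.append_assoc, birth_concat]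
      exact h.2.trans_le (hc.splitTime_le_append a w r)
    have h1 : ¬ c.lifetime (a, w ++ (r ++ [b])) ≤ s - c.birth (a, w ++ (r ++ [b])) := by
      have := hc (a, w ++ (r ++ [b]))
      linarith
    have h2 : (Choices.concat s o c (Choices.restart s c c')).birth (a, w ++ (r ++ [b])) =
        s + c'.splitTime ((a, w), r) := by
      rw [← List.append_assoc, birth_concat, ih]
    rw [splitTime, h2, concat_lifetime, if_neg h1, hlife, max_eq_right (by linarith), zero_add]
    change _ = s + (c'.birth ((a, w), r ++ [b]) + _)
    rw [birth_concat]
    ring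

theorem Positive.concat_present (hc : c.Positive) (ht : 0 ≤ t) {a : α} {w : List Bool}
    (h : c.Present s (a, w)) (r : List Bool) :
    (Choices.concat s o c (Choices.restart s c c')).Present (s + t) (a, w ++ r) ↔
      c'.Present t ((a, w), r) := by
  rw [Present, Present, hc.concat_splitTime h, add_lt_add_iff_left]
  refine and_congr_left fun _ => ?_
  induction r using List.reverseRecOn with
  | nil =>
    rw [List.append_nil, hc.concat_birth_of_le h.1, birth_nil]
    exact iff_of_true (h.1.trans (by linarith)) ht
  | append_singleton r b _ =>
    rw [← List.append_assoc, birth_concat, hc.concat_splitTime h, birth_concat,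
      add_le_add_iff_left]

/-- The location at time `s + t` of a marker that is at a present vertex at time `s`. -/
theorem Positive.concat_position_iff (hc : c.Positive) (hc' : c'.Positive)
    (ht : 0 ≤ t) {a : α} {l : List Bool} (hl : c.birth (a, l) ≤ s) (ξ ξ' : ℕ → Bool)
    {D : List Bool → Prop} (hD : ∀ w, D w ↔ s < c.splitTime (a, l ++ w)) {w r : List Bool}
    (hw : c.Present s (a, w)) (hr : c'.Present t ((a, w), r)) :
    (a, w ++ r) = (Choices.concat s o c (Choices.restart s c c')).position (s + t) (a, l)
      (splice D ξ ξ') ↔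
    (a, w) = c.position s (a, l) ξ ∧ ((a, w), r) = c'.position t ((a, w), []) ξ' := by
  have hp := (hc.concat_present (o := o) ht hw r).mpr hr
  have hcat : (Choices.concat s o c (Choices.restart s c c')).Positive := hc.concat hc'.restart
  rw [eq_comm, hcat.position_eq_iff hp, eq_comm (a := (a, w)), hc.position_eq_iff hw,
    eq_comm (a := ((a, w), r)), hc'.position_eq_iff hr]
  simp only [Prod.mk.injEq, true_and, List.nil_append]
  -- At a vertex present at time `s` the stopping rule holds, and it fails at every earlier vertex
  -- on the way; hence the splice switches coins exactly there.
  have hsplice : ∀ n, w = l ++ (List.range n).map ξ → ∀ k,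
      (List.range (n + k)).map (splice D ξ ξ') = (List.range n).map ξ ++ (List.range k).map ξ' := by
    intro n hn k
    have hDn : D ((List.range n).map ξ) := by rw [hD, ← hn]; exact hw.2
    have hlt : ∀ m < n, ¬ D ((List.range m).map ξ) := by
      intro m hm
      rw [hD, not_lt]
      obtain ⟨j, rfl⟩ := Nat.exists_eq_add_of_lt hm
      refine le_trans ?_ hw.1
      rw [hn, add_assoc, List.range_add, List.map_append, List.range_succ_eq_map, List.map_cons,
        List.map_cons, ← List.append_assoc]
      exact hc.splitTime_le_birth _ _ _ _
    rw [List.range_add, List.map_append, List.map_map]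
    congr 1
    · exact List.map_congr_left fun m hm => splice_of_lt fun j hj =>
        hlt j (hj.trans_lt (List.mem_range.mp hm))
    · exact List.map_congr_left fun m _ => splice_add hDn hlt m
  constructor
  · rintro ⟨m, hm⟩
    have hex : ∃ n, D ((List.range n).map (splice D ξ ξ')) := by
      refine ⟨m, ?_⟩
      rw [hD, ← hm]
      exact hw.2.trans_le (hc.splitTime_le_append a w r)
    classical
    -- The first stopping index along the spliced coins. Up to it they agree with `ξ`, so the vertex
    -- reached is present at `s`, and unique decomposition identifies it with `w`.
    set n := Nat.find hex with hn
    have hmin : ∀ j < n, ¬ D ((List.range j).map (splice D ξ ξ')) := fun j hj => Nat.find_min hex hj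
    have heq : ∀ j, j ≤ n → (List.range j).map (splice D ξ ξ') = (List.range j).map ξ := by
      intro j
      induction j with
      | zero => intro _; rfl
      | succ j ih =>
        intro hj
        rw [List.range_succ, List.map_append, List.map_append, ih (by omega)]
        simp only [List.map_cons, List.map_nil]
        congr 2
        refine splice_of_lt fun i hi => ?_
        have h1 : (List.range i).map (splice D ξ ξ') = (List.range i).map ξ := by
          have h2 := congrArg (List.take i) (ih (by omega))
          simpa [← List.map_take, List.take_range, min_eq_left hi] using h2
        rw [← h1]
        exact hmin i (by omega)
    have hDn : D ((List.range n).map ξ) := by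
      rw [← heq n le_rfl]; exact Nat.find_spec hex
    have hpres : c.Present s (a, l ++ (List.range n).map ξ) := by
      refine ⟨?_, (hD _).mp hDn⟩
      rcases Nat.eq_zero_or_pos n with h0 | h0
      · rw [h0]; simpa using hl
      · obtain ⟨j, hj⟩ := Nat.exists_eq_succ_of_ne_zero h0.ne'
        rw [hj, List.range_succ, List.map_append, ← List.append_assoc]
        have := hmin j (by omega)
        rw [heq j (by omega), hD, not_lt] at this
        simpa only [List.map_cons, List.map_nil, birth_concat] using this
    have hnm : n ≤ m := Nat.find_min' hex (by
      rw [hD, ← hm]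
      exact hw.2.trans_le (hc.splitTime_le_append a w r))
    obtain ⟨k, rfl⟩ := Nat.exists_eq_add_of_le hnm
    rw [List.range_add, List.map_append, heq n le_rfl, ← List.append_assoc] at hm
    obtain ⟨h1, h2⟩ := hc.append_inj hw hpres hm
    refine ⟨⟨n, h1⟩, k, ?_⟩
    have h3 := hsplice n h1 k
    rw [List.range_add, List.map_append, heq n le_rfl] at h3
    rw [h2]
    exact List.append_cancel_left h3
  · rintro ⟨⟨n, hn⟩, k, hk⟩
    refine ⟨n + k, ?_⟩
    rw [hsplice n hn k, ← List.append_assoc, ← hn, ← hk]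

end

end Choices

namespace RootedMultigraph

open Choices

variable {α : Type} {s t : ℝ} {o : α} {c : Choices α Empty}
  {c' : Choices (Descendant α) (EdgeLabel α Empty)}

theorem present_of_mem_cluster_single (h0 : c.Present s (c.rootAt s o)) {p : Descendant α}
    (hp : p ∈ ((single Empty o).cluster c s).graph.vertexSet) : c.Present s p ∧ p.1 = o := by
  induction hp with
  | refl => exact ⟨h0, rfl⟩
  | tail _ hz _ =>
    obtain ⟨e, he⟩ := hz
    obtain ⟨w, i, b, -, -, h, -, -, -, rfl⟩ := single_link he
    exact ⟨h, rfl⟩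

/-- The cluster process from the cluster of a single vertex at time `s` is the cluster process from
the single vertex, continued after time `s`. -/
theorem cluster_cluster_single (hc : c.Positive) (hc' : c'.Positive) (hs : 0 ≤ s) (ht : 0 ≤ t)
    (h0 : c.Present s (c.rootAt s o))
    (h1 : c'.Present t (c'.rootAt t (c.rootAt s o))) :
    Isomorphic (((single Empty o).cluster c s).cluster c' t)
      ((single Empty o).cluster (concat s o c (restart s c c')) (s + t)) := by
  set H := (single Empty o).cluster c s with hH
  set c'' := concat s o c (restart s c c') with hc''
  have hVp : ∀ p ∈ H.graph.vertexSet, c.Present s p ∧ p.1 = o := fun p hp =>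
    present_of_mem_cluster_single h0 hp
  have hreach : ∀ x, Relation.ReflTransGen (H.fullGraph c' t).Adj (c'.rootAt t H.root) x →
      x.1 ∈ H.graph.vertexSet ∧ c'.Present t x := by
    intro x hx
    induction hx with
    | refl => exact ⟨H.root_mem, h1⟩
    | tail _ hz _ =>
      obtain ⟨e, he⟩ := hz
      exact he.right_mem
  have hinj : ∀ (p p' : Descendant α) (r r' : List Bool), c.Present s p → c.Present s p' →
      ((p.1, p.2 ++ r) : Descendant α) = (p'.1, p'.2 ++ r') → p = p' ∧ r = r' := by
    rintro ⟨a, w⟩ ⟨a', w'⟩ r r' hp hp' he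
    simp only [Prod.mk.injEq] at he
    obtain ⟨rfl, he⟩ := he
    obtain ⟨rfl, rfl⟩ := hc.append_inj hp hp' he
    exact ⟨rfl, rfl⟩
  -- the ends of the edges present at time `s`
  have hold : ∀ (w : List Bool) (i : ℕ) (b : Bool), c.splitTime (o, w) ≤ s →
      ∀ (p : Descendant α) (r : List Bool), c.Present s p → c'.Present t (p, r) →
      (((p.1, p.2 ++ r) : Descendant α) = c''.newEnd (s + t) (o, w) i b ↔
        p = c.newEnd s (o, w) i b ∧ (p, r) = c'.oldEnd t (.inr ((o, w), i)) p) := by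
    rintro w i b hw ⟨a, v⟩ r hp hr
    by_cases ha : a = o
    · subst ha
      have hl : c.birth (a, w ++ [b]) ≤ s := by rwa [birth_concat]
      have key := hc.concat_position_iff (o := a) hc' ht hl (c.newEndCoins (((a, w), i), b))
        ((restart s c c').newEndCoins (((a, w), i), b))
        (D := fun z => s < c.splitTime (a, w) ∨ s < c.splitTime (a, w ++ [b] ++ z))
        (fun z => or_iff_right (not_lt.mpr hw)) hp hr
      have hcoins : (restart s c c').newEndCoins (((a, w), i), b) =
          c'.oldEndCoins (.inr ((a, w), i), c.newEnd s (a, w) i b) := if_neg (not_lt.mpr hw)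
      refine key.trans (and_congr_right fun he => ?_)
      rw [hcoins, oldEnd]
      change _ ↔ _ = c'.position t _ (c'.oldEndCoins (.inr ((a, w), i), (a, v)))
      rw [show c.newEnd s (a, w) i b = (a, v) from he.symm]
    · refine iff_of_false (fun h => ha (congrArg Prod.fst h)) fun h => ha ?_
      exact congrArg Prod.fst h.1
  have hnew : ∀ (p : Descendant α) (r : List Bool) (i : ℕ) (b : Bool), c.Present s p →
      ∀ (p' : Descendant α) (r' : List Bool), c.Present s p' → c'.Present t (p', r') →
      (((p'.1, p'.2 ++ r') : Descendant α) = c''.newEnd (s + t) (p.1, p.2 ++ r) i b ↔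
        (p', r') = c'.newEnd t (p, r) i b) := by
    rintro ⟨a, w⟩ r i b hp ⟨a', w'⟩ r' hp' hr'
    have hD : s < c.splitTime (a, w ++ r) := hp.2.trans_le (hc.splitTime_le_append a w r)
    have hcoins : c''.newEndCoins (((a, w ++ r), i), b) =
        c'.newEndCoins ((((a, w), r), i), b) := by
      have h2 : (restart s c c').newEndCoins (((a, w ++ r), i), b) =
          c'.newEndCoins ((((a, w), r), i), b) := by
        refine (if_pos hD).trans ?_
        simp only [hc.cut_append hp r]
      rw [← h2]
      funext k
      -- The creating vertex splits after `s`, so the rule stops at index 0 and none of the earlier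
      -- coins is used.
      have h3 := splice_add (D := fun z => s < c.splitTime (a, w ++ r) ∨
        s < c.splitTime (a, w ++ r ++ [b] ++ z)) (ξ := c.newEndCoins (((a, w ++ r), i), b))
        (ξ' := (restart s c c').newEndCoins (((a, w ++ r), i), b)) (n := 0) (Or.inl hD)
        (fun m hm => absurd hm (Nat.not_lt_zero m)) k
      rwa [zero_add] at h3
    have hpp := (hc.concat_present (o := o) ht hp' r').mpr hr'
    have hcat : c''.Positive := hc.concat hc'.restart
    rw [eq_comm, newEnd, hcat.position_eq_iff hpp, eq_comm (a := ((a', w'), r')), newEnd,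
      hc'.position_eq_iff hr', hcoins]
    refine exists_congr fun n => ?_
    simp only [Prod.mk.injEq]
    constructor
    · rintro ⟨rfl, he⟩
      rw [List.append_assoc, List.append_assoc] at he
      obtain ⟨rfl, rfl⟩ := hc.append_inj hp' hp he
      exact ⟨⟨rfl, rfl⟩, by rw [List.append_assoc]⟩
    · rintro ⟨⟨rfl, rfl⟩, rfl⟩
      exact ⟨rfl, by simp⟩
  have hcut : ∀ x : Descendant α, c''.Present (s + t) x → ∃ (p : Descendant α) (r : List Bool),
      x = (p.1, p.2 ++ r) ∧ c.Present s p ∧ c'.Present t (p, r) := by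
    rintro ⟨a, l⟩ hx
    have h2 : s < c.splitTime (a, l) := by
      by_contra hn
      have := hx.2
      rw [(hc.concat_splitTime_of_le (not_lt.mp hn)).1] at this
      linarith [not_lt.mp hn]
    obtain ⟨w, r, rfl, hw⟩ := exists_present_append hs a l h2
    exact ⟨(a, w), r, rfl, hw, (hc.concat_present ht hw r).mp hx⟩
  have hpres : ∀ (p : Descendant α) (r : List Bool), c.Present s p → c'.Present t (p, r) →
      c''.Present (s + t) (p.1, p.2 ++ r) := fun p r hp hr => (hc.concat_present ht hp r).mpr hr
  refine component_isomorphic _ _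
    (fun x : Descendant (Descendant α) => ((x.1.1, x.1.2 ++ x.2) : Descendant α))
    (Sum.elim id fun q => .inr ((q.1.1.1, q.1.1.2 ++ q.1.2), q.2)) ?_ ?_ ?_ ?_ ?_
  · refine (hc.concat_position_iff (o := o) hc' ht (l := [])
      (by rw [birth_nil]; exact hs) c.rootCoins
      (restart s c c').rootCoins (D := fun w => s < c.splitTime (o, w)) (fun w => Iff.rfl)
      (w := (c.rootAt s o).2) (r := (c'.rootAt t (c.rootAt s o)).2) h0 h1).mpr ⟨rfl, rfl⟩
  · rintro ⟨p, r⟩ ⟨p', r'⟩ hx hy he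
    obtain ⟨rfl, rfl⟩ := hinj p p' r r' (hVp _ (hreach _ hx).1).1 (hVp _ (hreach _ hy).1).1 he
    rfl
  -- Labels of old and new edges share one type after the identification. They cannot collide: an
  -- old edge comes from a vertex split by time `s`, a new one from a descendant of a vertex still
  -- present then.
  · have aux : ∀ (q : Descendant α) (i : ℕ) (p : Descendant α) (r : List Bool),
        (∃ u v, H.graph.IsLink (.inr (q, i)) u v) → p ∈ H.graph.vertexSet →
        q ≠ (p.1, p.2 ++ r) := by
      rintro q i ⟨a, w⟩ r ⟨u, v, hl⟩ hp rfl
      obtain ⟨w', i', b, he, -, -, h2, -⟩ := single_link hl.1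
      simp only [Sum.inr.injEq, Prod.mk.injEq] at he
      rw [← he.1.1, ← he.1.2] at h2
      have hp1 := (hVp _ hp).1
      exact absurd (hp1.2.trans_le (hc.splitTime_le_append a w r)) (not_lt.mpr h2)
    rintro (e | ⟨⟨p, r⟩, i⟩) x y (e' | ⟨⟨p', r'⟩, i'⟩) x' y' hx hl hx' hl' he
    · exact congrArg Sum.inl he
    · simp only [Sum.elim_inl, Sum.elim_inr, id_eq] at he
      subst he
      obtain ⟨-, -, u, v, hl, -, -⟩ := hl
      obtain ⟨-, -, hp', -⟩ := hl'
      exact absurd rfl (aux _ _ p' r' ⟨u, v, hl⟩ hp')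
    · simp only [Sum.elim_inl, Sum.elim_inr, id_eq] at he
      subst he
      obtain ⟨-, -, u, v, hl₂, -, -⟩ := hl'
      obtain ⟨-, -, hp, -⟩ := hl
      exact absurd rfl (aux _ _ p r ⟨u, v, hl₂⟩ hp)
    · simp only [Sum.elim_inr, Sum.inr.injEq, Prod.mk.injEq] at he
      obtain ⟨-, -, hp, -⟩ := hl
      obtain ⟨-, -, hp', -⟩ := hl'
      obtain ⟨rfl, rfl⟩ := hinj p p' r r' (hVp _ hp).1 (hVp _ hp').1 (Prod.ext he.1.1 he.1.2)
      rw [he.2]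
  · rintro (e | ⟨⟨p, r⟩, i⟩) x y hx
    · rintro ⟨hpx, hpy, u, v, hl, rfl, rfl⟩
      obtain ⟨w, i, b, rfl, hu, hv, h2, h3, rfl, rfl⟩ := single_link hl.1
      refine ⟨hpres _ _ hu hpx, hpres _ _ hv hpy, rfl, ?_, ?_, b, ?_, ?_⟩
      · rw [(hc.concat_splitTime_of_le h2).1]; linarith
      · exact lt_of_lt_of_eq h3 (if_pos h2).symm
      · exact (hold w i b h2 _ _ hu hpx).mpr ⟨rfl, rfl⟩
      · exact (hold w i (!b) h2 _ _ hv hpy).mpr ⟨rfl, rfl⟩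
    · rintro ⟨hpx, hpy, hp, h2, h3, b, rfl, rfl⟩
      have hp1 := hVp _ hp
      have hD : s < c.splitTime (p.1, p.2 ++ r) :=
        hp1.1.2.trans_le (hc.splitTime_le_append p.1 p.2 r)
      refine ⟨hpres _ _ hp1.1 hpx, hpres _ _ hp1.1 hpy, hp1.2, ?_, ?_, b, ?_, ?_⟩
      · change c''.splitTime (p.1, p.2 ++ r) ≤ s + t
        rw [hc.concat_splitTime hp1.1]; linarith
      · change i < c''.newEdges (p.1, p.2 ++ r)
        refine lt_of_lt_of_eq h3 (Eq.symm ((if_neg (not_le.mpr hD)).trans ?_))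
        change c'.newEdges (cut s c (p.1, p.2 ++ r)) = _
        rw [hc.cut_append hp1.1 r]
      · exact (hnew p r i b hp1.1 _ _ hp1.1 hpx).mpr rfl
      · exact (hnew p r i (!b) hp1.1 _ _ hp1.1 hpy).mpr rfl
  · rintro (e | ⟨q, i⟩) ⟨p, r⟩ y' hx hl
    · exact e.elim
    · obtain ⟨hpV, hpr⟩ := hreach _ hx
      obtain ⟨w, i', b, he, hpx, hpy, h2, h3, h4, h5⟩ := single_link hl
      simp only [Sum.inr.injEq, Prod.mk.injEq] at he
      obtain ⟨rfl, rfl⟩ := he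
      have hp1 := hVp _ hpV
      obtain ⟨p', r', rfl, hp', hpr'⟩ := hcut _ hpy
      rcases le_or_gt (c.splitTime (o, w)) s with hw | hw
      · have hx1 := (hold w i b hw p r hp1.1 hpr).mp h4
        have hy1 := (hold w i (!b) hw p' r' hp' hpr').mp h5
        refine ⟨.inl (.inr ((o, w), i)), (p', r'), ⟨hpr, hpr', p, p', ⟨⟨hp1.1, hp', rfl, hw, ?_, b,
          hx1.1, hy1.1⟩, hpV⟩, hx1.2, hy1.2⟩, rfl, rfl⟩
        exact lt_of_lt_of_eq h3 (if_pos hw)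
      · obtain ⟨v, r₁, rfl, hv⟩ := exists_present_append hs o w hw
        have hx1 := (hnew (o, v) r₁ i b hv p r hp1.1 hpr).mp h4
        have hy1 := (hnew (o, v) r₁ i (!b) hv p' r' hp' hpr').mp h5
        have hpv : p = (o, v) := congrArg Prod.fst hx1
        subst hpv
        refine ⟨.inr (((o, v), r₁), i), (p', r'), ⟨hpr, hpr', hpV, ?_, ?_, b, hx1, hy1⟩, rfl, rfl⟩
        · rw [hc.concat_splitTime hv] at h2
          linarith
        · refine lt_of_lt_of_eq h3 ((if_neg (not_le.mpr hw)).trans ?_)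
          change c'.newEdges (cut s c (o, v ++ r₁)) = _
          rw [hc.cut_append hv r₁]

end RootedMultigraph

/-! ### The law of the choices after a restart -/

theorem measurePreserving_prodProdProdComm {X₁ X₂ X₃ X₄ : Type*} [MeasurableSpace X₁]
    [MeasurableSpace X₂] [MeasurableSpace X₃] [MeasurableSpace X₄]
    (μ₁ : Measure X₁) (μ₂ : Measure X₂) (μ₃ : Measure X₃) (μ₄ : Measure X₄)
    [SFinite μ₁] [SFinite μ₂] [SFinite μ₃] [SFinite μ₄] :
    MeasurePreserving (fun x : (X₁ × X₂) × (X₃ × X₄) => ((x.1.1, x.2.1), (x.1.2, x.2.2)))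
      ((μ₁.prod μ₂).prod (μ₃.prod μ₄)) ((μ₁.prod μ₃).prod (μ₂.prod μ₄)) := by
  have h1 := measurePreserving_prodAssoc μ₁ μ₂ (μ₃.prod μ₄)
  have h2 := (MeasurePreserving.id μ₁).prod (measurePreserving_prodAssoc μ₂ μ₃ μ₄).symm
  have h3 := (MeasurePreserving.id μ₁).prod
    ((Measure.measurePreserving_swap (μ := μ₂) (ν := μ₃)).prod (MeasurePreserving.id μ₄))
  have h4 := (MeasurePreserving.id μ₁).prod (measurePreserving_prodAssoc μ₃ μ₂ μ₄)
  have h5 := (measurePreserving_prodAssoc μ₁ μ₃ (μ₂.prod μ₄)).symm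
  exact h5.comp (h4.comp (h3.comp (h2.comp h1)))

namespace Choices

variable {α : Type}

theorem cut_append_eq (s : ℝ) (c : Choices α Empty) (q : Descendant α) :
    ((cut s c q).1.1, (cut s c q).1.2 ++ (cut s c q).2) = q := by
  rw [cut]
  split_ifs <;> simp

theorem cut_injective (s : ℝ) (c : Choices α Empty) : Function.Injective (cut s c) :=
  fun q q' h => by rw [← cut_append_eq s c q, ← cut_append_eq s c q', h]

theorem newEnd_injective (s : ℝ) (c : Choices α Empty) (p : Descendant α) (i : ℕ) :
    Function.Injective (c.newEnd s p i) := by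
  intro b b' h
  have h := congrArg Prod.snd h
  simp only [newEnd, position, List.append_assoc, List.singleton_append] at h
  exact (List.cons_eq_cons.mp (List.append_cancel_left h)).1

/-- For a fixed past `c`, each output reads a single input coordinate, and different outputs read
different ones. For the two ends of an old edge this uses that they sit at different vertices, by
`newEnd_injective`. -/
theorem measurePreserving_restart [Countable α] (lam : ℝ≥0) (s : ℝ) (c : Choices α Empty) :
    MeasurePreserving (restart s c) (choiceLaw (Descendant α) (EdgeLabel α Empty) lam)
      (choiceLaw α Empty lam) := by
  let σ : (Descendant α × ℕ) × Bool →
      (EdgeLabel α Empty × Descendant α) ⊕ ((Descendant (Descendant α) × ℕ) × Bool) := fun k =>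
    if s < c.splitTime k.1.1 then .inr ((cut s c k.1.1, k.1.2), k.2)
      else .inl (.inr k.1, c.newEnd s k.1.1 k.1.2 k.2)
  have hσ : Function.Injective σ := by
    rintro ⟨⟨q, i⟩, b⟩ ⟨⟨q', i'⟩, b'⟩ h
    simp only [σ] at h
    split_ifs at h with h1 h2 h2
    · simp only [Sum.inr.injEq, Prod.mk.injEq] at h
      rw [cut_injective s c h.1.1, h.1.2, h.2]
    · simp only [Sum.inl.injEq, Sum.inr.injEq, Prod.mk.injEq] at h
      obtain ⟨⟨rfl, rfl⟩, h⟩ := h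
      rw [newEnd_injective s c q i h]
  have h1 := measurePreserving_infinitePi_prod_reindex coinTosses hσ
  -- There are no starting edges, so the coins indexed by `Empty × α` form a one-point space and may
  -- be adjoined freely.
  have h2 : MeasurePreserving (fun x : (Descendant α × ℕ) × Bool → ℕ → Bool =>
      ((fun e => e.1.elim : Empty × α → ℕ → Bool), x)) (Measure.infinitePi fun _ => coinTosses)
      ((Measure.infinitePi fun _ => coinTosses).prod (Measure.infinitePi fun _ => coinTosses)) := by
    refine ⟨measurable_const.prodMk measurable_id, ?_⟩
    refine (Measure.prod_eq fun S T hS hT => ?_).symm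
    have hm : Measurable fun x : (Descendant α × ℕ) × Bool → ℕ → Bool =>
      ((fun e => e.1.elim : Empty × α → ℕ → Bool), x) := measurable_const.prodMk measurable_id
    rw [Measure.map_apply hm (hS.prod hT)]
    by_cases hmem : (fun e => e.1.elim : Empty × α → ℕ → Bool) ∈ S
    · have : S = Set.univ := Set.eq_univ_of_forall fun x => by
        rwa [Subsingleton.elim x (fun e => e.1.elim)]
      subst this
      simp
    · have : S = ∅ := Set.eq_empty_of_forall_notMem fun x hx => hmem (by
        rwa [Subsingleton.elim (fun e => e.1.elim) x])
      subst this
      simp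
  have h3 := (measurePreserving_infinitePi_reindex (expMeasure 1) (cut_injective s c)).prod
    ((measurePreserving_infinitePi_reindex (poissonMeasure (lam / 2)) (cut_injective s c)).prod
      ((MeasurePreserving.id coinTosses).prod (h2.comp h1)))
  have key : ∀ f, f = restart s c → MeasurePreserving f (choiceLaw (Descendant α)
      (EdgeLabel α Empty) lam) (choiceLaw α Empty lam) →
      MeasurePreserving (restart s c) (choiceLaw (Descendant α) (EdgeLabel α Empty) lam)
        (choiceLaw α Empty lam) := fun f hf h => hf ▸ h
  refine key _ ?_ h3
  funext c'
  simp only [restart, Prod.map, id]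
  refine Prod.ext rfl (Prod.ext rfl (Prod.ext rfl (Prod.ext rfl ?_)))
  funext k
  simp only [Function.comp, σ]
  split_ifs <;> rfl

/-- The birth time as a function of the lifetimes. -/
def birthOf (ℓ : Descendant α → ℝ) (p : Descendant α) : ℝ :=
  ∑ k ∈ Finset.range p.2.length, ℓ (p.1, p.2.take k)

theorem birthOf_update [DecidableEq α] (ℓ : Descendant α → ℝ) {p q : Descendant α}
    (h : p.2.length ≤ q.2.length) (x : ℝ) : birthOf (Function.update ℓ q x) p = birthOf ℓ p := by
  refine Finset.sum_congr rfl fun k hk => Function.update_of_ne (fun he => ?_) _ _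
  have h1 := congrArg (fun z : Descendant α => z.2.length) he
  have h2 := Finset.mem_range.mp hk
  simp only [List.length_take] at h1
  omega

theorem measurable_birthOf (p : Descendant α) : Measurable fun ℓ => birthOf ℓ p :=
  Finset.measurable_sum _ fun _ _ => measurable_pi_apply _

/-- Lack of memory at each vertex with threshold `s - birth`. The birth time involves proper
ancestors only, so depth is a rank in the sense of `map_infinitePi_prod_of_rank`. -/
theorem measurePreserving_concat_lifetime [Countable α] (s : ℝ) :
    MeasurePreserving (fun (z : (Descendant α → ℝ) × (Descendant α → ℝ)) (q : Descendant α) =>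
      if z.1 q ≤ s - birthOf z.1 q then z.1 q else max (s - birthOf z.1 q) 0 + z.2 q)
      ((Measure.infinitePi fun _ => expMeasure 1).prod (Measure.infinitePi fun _ => expMeasure 1))
      (Measure.infinitePi fun _ => expMeasure 1) := by
  classical
  refine map_infinitePi_prod_of_rank _ _ _ (fun q => q.2.length) ?_ ?_ ?_
  · refine measurable_pi_lambda _ fun q => ?_
    have h1 : Measurable fun z : (Descendant α → ℝ) × (Descendant α → ℝ) => z.1 q :=
      (measurable_pi_apply q).comp measurable_fst
    have h2 : Measurable fun z : (Descendant α → ℝ) × (Descendant α → ℝ) => z.2 q :=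
      (measurable_pi_apply q).comp measurable_snd
    have h3 : Measurable fun z : (Descendant α → ℝ) × (Descendant α → ℝ) => s - birthOf z.1 q :=
      measurable_const.sub ((measurable_birthOf q).comp measurable_fst)
    exact Measurable.ite (measurableSet_le h1 h3) h1 ((h3.max measurable_const).add h2)
  · intro x y i
    simp only [Function.update_self, birthOf_update x le_rfl]
    exact (measurePreserving_exp_resample _).map_eq
  · intro x y i j a b hij hr
    simp only [Function.update_of_ne hij, birthOf_update x hr]

/-- All switching rules are functions of the earlier lifetimes. Given the lifetimes, the edge
numbers and coins are recombined by fixed rules that preserve their law, so the whole map is a skew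
product over the lifetimes. -/
theorem measurePreserving_concat [Countable α] (lam : ℝ≥0) (s : ℝ) (o : α) :
    MeasurePreserving (fun z : Choices α Empty × Choices α Empty => concat s o z.1 z.2)
      ((choiceLaw α Empty lam).prod (choiceLaw α Empty lam)) (choiceLaw α Empty lam) := by
  let D : (Descendant α → ℝ) → Descendant α → Prop := fun ℓ q => s < birthOf ℓ q + ℓ q
  have hD : ∀ q, Measurable fun ℓ => D ℓ q := fun q => measurableSet_setOfPred.mp
    (measurableSet_lt measurable_const ((measurable_birthOf q).add (measurable_pi_apply q)))
  let R := (Descendant α → ℕ) × (ℕ → Bool) × (Empty × α → ℕ → Bool) ×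
    ((Descendant α × ℕ) × Bool → ℕ → Bool)
  let ρ : Measure R := (Measure.infinitePi fun _ => poissonMeasure (lam / 2)).prod <|
      coinTosses.prod <|
        (Measure.infinitePi fun _ => coinTosses).prod (Measure.infinitePi fun _ => coinTosses)
  let g : (Descendant α → ℝ) × (Descendant α → ℝ) → R × R → R := fun a z =>
    (fun q => if birthOf a.1 q + a.1 q ≤ s then z.1.1 q else z.2.1 q,
      splice (fun w => D a.1 (o, w)) z.1.2.1 z.2.2.1, z.2.2.2.1,
      fun k => splice (fun w => D a.1 k.1.1 ∨ D a.1 (k.1.1.1, k.1.1.2 ++ [k.2] ++ w))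
        (z.1.2.2.2 k) (z.2.2.2.2 k))
  have hgm : Measurable (Function.uncurry g) := by
    have hℓ : Measurable fun p : ((Descendant α → ℝ) × (Descendant α → ℝ)) × (R × R) => p.1.1 :=
      measurable_fst.fst
    have hz1 : Measurable fun p : ((Descendant α → ℝ) × (Descendant α → ℝ)) × (R × R) => p.2.1 :=
      measurable_snd.fst
    have hz2 : Measurable fun p : ((Descendant α → ℝ) × (Descendant α → ℝ)) × (R × R) => p.2.2 :=
      measurable_snd.snd
    refine Measurable.prodMk (measurable_pi_lambda _ fun q => ?_) (Measurable.prodMk ?_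
      (Measurable.prodMk hz2.snd.snd.fst (measurable_pi_lambda _ fun k => ?_)))
    · exact Measurable.ite (measurableSet_le (((measurable_birthOf q).add
        (measurable_pi_apply q)).comp hℓ) measurable_const)
        ((measurable_pi_apply q).comp hz1.fst) ((measurable_pi_apply q).comp hz2.fst)
    · exact measurable_splice_uncurry (fun w => measurableSet_setOfPred.mpr ((hD _).comp hℓ))
        hz1.snd.fst hz2.snd.fst
    · exact measurable_splice_uncurry (fun w => measurableSet_setOfPred.mpr
        (((hD _).comp hℓ).or ((hD _).comp hℓ)))
        ((measurable_pi_apply k).comp hz1.snd.snd.snd)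
        ((measurable_pi_apply k).comp hz2.snd.snd.snd)
  have hg : ∀ a, (ρ.prod ρ).map (g a) = ρ := by
    intro a
    have hN := measurePreserving_infinitePi_prod_coord (ι := Descendant α)
      (poissonMeasure (lam / 2)) (poissonMeasure (lam / 2)) (poissonMeasure (lam / 2))
      (U := fun q z => if birthOf a.1 q + a.1 q ≤ s then z.1 else z.2) (fun q => by
        by_cases h : birthOf a.1 q + a.1 q ≤ s
        · simp only [h, if_true]; exact measurePreserving_fst
        · simp only [h, if_false]; exact measurePreserving_snd)
    have hW := measurePreserving_infinitePi_prod_coord (ι := (Descendant α × ℕ) × Bool)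
      coinTosses coinTosses coinTosses
      (U := fun k z => splice (fun w => D a.1 k.1.1 ∨ D a.1 (k.1.1.1, k.1.1.2 ++ [k.2] ++ w))
        z.1 z.2) (fun k => measurePreserving_splice _)
    have hO : MeasurePreserving (Prod.snd : (Empty × α → ℕ → Bool) × (Empty × α → ℕ → Bool) → _)
      ((Measure.infinitePi fun _ => coinTosses).prod (Measure.infinitePi fun _ => coinTosses))
      (Measure.infinitePi fun _ => coinTosses) := measurePreserving_snd
    have hR := measurePreserving_splice fun w => D a.1 (o, w)
    have h1 := (hO.prod hW).comp (measurePreserving_prodProdProdComm _ _ _ _)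
    have h2 := (hR.prod h1).comp (measurePreserving_prodProdProdComm _ _ _ _)
    have h3 := (hN.prod h2).comp (measurePreserving_prodProdProdComm _ _ _ _)
    exact h3.map_eq
  have h := ((measurePreserving_concat_lifetime s).skew_product hgm
    (Filter.Eventually.of_forall hg)).comp (measurePreserving_prodProdProdComm
      (Measure.infinitePi fun _ : Descendant α => expMeasure 1) ρ
      (Measure.infinitePi fun _ : Descendant α => expMeasure 1) ρ)
  exact h

/-- No marker is carried through infinitely many splits in finite time. -/
theorem ae_present_rootAt {β : Type} [Countable α] [Countable β] (lam : ℝ≥0) {t : ℝ} (ht : 0 ≤ t)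
    (o : α) : ∀ᵐ c ∂(choiceLaw α β lam), c.Present t (c.rootAt t o) := by
  have hmp : MeasurePreserving (fun c : Choices α β => (c.1, c.2.2.1)) (choiceLaw α β lam)
      ((Measure.infinitePi fun _ => expMeasure 1).prod coinTosses) :=
    (MeasurePreserving.id _).prod (measurePreserving_fst.comp measurePreserving_snd)
  set S : Set ((Descendant α → ℝ) × (ℕ → Bool)) :=
    {z | ∀ n : ℕ, z.1 (o, (List.range n).map z.2) ≤ t} with hS
  have hSm : MeasurableSet S := by
    refine measurableSet_setOfPred.mpr (Measurable.forall fun n => ?_)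
    have : (fun z : (Descendant α → ℝ) × (ℕ → Bool) => z.1 (o, (List.range n).map z.2) ≤ t) =
        fun z => ∃ l, (List.range n).map z.2 = l ∧ z.1 (o, l) ≤ t := by
      ext z; simp
    rw [this]
    exact Measurable.exists fun l => (measurable_map_range_eq measurable_snd n l).and
      (measurableSet_setOfPred.mp (measurableSet_le
        ((measurable_pi_apply _).comp measurable_fst) measurable_const))
  -- A marker that never settles by time `t` has only lifetimes at most `t` on its path. For fixed
  -- coins these are i.i.d. variables at distinct vertices, so the probability is at most `q ^ n`
  -- for every `n`, with `q < 1`.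
  have hS0 : ((Measure.infinitePi fun _ => expMeasure 1).prod coinTosses) S = 0 := by
    rw [Measure.prod_apply_symm hSm]
    refine (lintegral_congr fun ξ => ?_).trans lintegral_zero
    have hlt : expMeasure 1 (Set.Iic t) < 1 := by
      rw [← Set.compl_Ioi, prob_compl_eq_one_sub measurableSet_Ioi, expMeasure_one_Ioi ht]
      exact ENNReal.sub_lt_self ENNReal.one_ne_top one_ne_zero
        (ENNReal.ofReal_pos.mpr (Real.exp_pos _)).ne'
    refine le_antisymm (ge_of_tendsto' (ENNReal.tendsto_pow_atTop_nhds_zero_of_lt_one hlt)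
      fun n => ?_) zero_le
    have hinj : Function.Injective fun n : ℕ => ((o, (List.range n).map ξ) : Descendant α) :=
      fun m n h => by
        have := congrArg (fun z : Descendant α => z.2.length) h
        simpa using this
    calc (Measure.infinitePi fun _ : Descendant α => expMeasure 1) ((fun ℓ => (ℓ, ξ)) ⁻¹' S)
        ≤ (Measure.infinitePi fun _ : Descendant α => expMeasure 1)
          (Set.pi ((Finset.range n).map ⟨_, hinj⟩ : Finset (Descendant α)) fun _ => Set.Iic t) := by
          refine measure_mono fun ℓ hℓ => ?_
          intro p hp
          obtain ⟨k, -, rfl⟩ := Finset.mem_map.mp (Finset.mem_coe.mp hp)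
          exact hℓ k
      _ = expMeasure 1 (Set.Iic t) ^ n := by
          rw [Measure.infinitePi_pi _ fun _ _ => measurableSet_Iic]
          simp
  have hae : ∀ᵐ z ∂((Measure.infinitePi fun _ => expMeasure 1).prod coinTosses), z ∉ S :=
    measure_eq_zero_iff_ae_notMem.mp hS0
  filter_upwards [hmp.quasiMeasurePreserving.ae hae, ae_positive lam] with c hc hpos
  have hex : ∃ n : ℕ, t < c.splitTime (o, [] ++ (List.range n).map c.rootCoins) := by
    simp only [hS, Set.mem_ofPred_eq, not_forall, not_le] at hc
    obtain ⟨n, hn⟩ := hc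
    exact ⟨n, hn.trans_le (le_add_of_nonneg_left (hpos.birth_nonneg _))⟩
  have hne : {n : ℕ | t < c.splitTime (o, [] ++ (List.range n).map c.rootCoins)}.Nonempty := hex
  refine ⟨?_, Nat.sInf_mem hne⟩
  rw [rootAt, position]
  rcases hn : sInf {n : ℕ | t < c.splitTime (o, [] ++ (List.range n).map c.rootCoins)} with _ | m
  · exact ht
  · have h1 : m ∉ {n : ℕ | t < c.splitTime (o, [] ++ (List.range n).map c.rootCoins)} :=
      Nat.notMem_of_lt_sInf (by omega)
    rw [List.range_succ, List.map_append, ← List.append_assoc, List.map_singleton, birth_concat]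
    exact not_lt.mp h1

end Choices

namespace RootedMultigraph

open Choices

/-- The Markov property of the cluster process from a single vertex. -/
theorem lintegral_clusterLaw_cluster_single {α : Type} [Countable α] (lam : ℝ≥0) {s t : ℝ}
    (hs : 0 ≤ s) (ht : 0 ≤ t) (o : α) {A : Set (RootedMultigraph ℕ ℕ)} (hA : MeasurableSet A)
    (hi : IsoInvariant A) :
    ∫⁻ c, clusterLaw lam t ((single Empty o).cluster c s) A ∂(choiceLaw α Empty lam) =
      clusterLaw lam (s + t) (single Empty o) A := by
  have hm : MeasurableSet {c | HasProp A ((single Empty o).cluster c (s + t))} :=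
    measurableSet_setOfPred.mpr
      (((isMeasurable_const (single Empty o)).cluster measurable_id (s + t)).hasProp hA hi)
  have hcat := measurePreserving_concat (α := α) lam s o
  rw [clusterLaw, ← hcat.measure_preimage hm.nullMeasurableSet,
    Measure.prod_apply (hcat.measurable hm)]
  refine lintegral_congr_ae ?_
  filter_upwards [ae_positive lam, ae_present_rootAt lam hs o] with c hc h0
  have hmc : MeasurableSet (Prod.mk c ⁻¹' ((fun z : Choices α Empty × Choices α Empty =>
      concat s o z.1 z.2) ⁻¹' {c | HasProp A ((single Empty o).cluster c (s + t))})) :=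
    measurable_prodMk_left (hcat.measurable hm)
  rw [← (measurePreserving_restart lam s c).measure_preimage hmc.nullMeasurableSet, clusterLaw]
  refine measure_congr ?_
  filter_upwards [ae_positive lam, ae_present_rootAt lam ht (c.rootAt s o)] with c' hc' h1
  exact propext (hasProp_congr A (cluster_cluster_single hc hc' hs ht h0 h1))

theorem lintegral_clusterLaw_single (lam : ℝ≥0) {s t : ℝ}
    (hs : 0 ≤ s) (ht : 0 ≤ t) {A : Set (RootedMultigraph ℕ ℕ)} (hA : MeasurableSet A)
    (hi : IsoInvariant A) :
    ∫⁻ c, clusterLaw lam t ((single Empty ()).cluster c s) A ∂(choiceLaw Unit Empty lam) =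
      singleLaw lam (s + t) A :=
  lintegral_clusterLaw_cluster_single lam hs ht () hA hi

end RootedMultigraph

/-! ### Limits of laws -/

/-- Closeness uniform over events makes the setwise limit countably additive. It is controlled on
the smaller σ-algebra `𝓘` only, so it is first built there and then extended to the full one by a
density. -/
theorem exists_measure_of_cauchy {Ω : Type*} {𝓘 m₀ : MeasurableSpace Ω}
    (h𝓘 : 𝓘 ≤ m₀) (m : ℝ → Measure Ω) [∀ t, IsProbabilityMeasure (m t)] (ε : ℝ → ℝ≥0∞)
    (hε : ∀ a b K : ℝ≥0∞, K ≠ ∞ → (∀ t, 0 ≤ t → a ≤ b + K * ε t) → a ≤ b)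
    (hm : ∀ s t, 0 ≤ s → 0 ≤ t → ∀ A, MeasurableSet[𝓘] A → m (s + t) A ≤ m t A + ε t) :
    ∃ μ : Measure Ω, IsProbabilityMeasure μ ∧ ∀ t, 0 ≤ t → ∀ A, MeasurableSet[𝓘] A →
      μ A ≤ m t A + ε t ∧ m t A ≤ μ A + ε t := by
  -- The reverse inequality comes from the complement, as all masses are one.
  have hm' : ∀ s t, 0 ≤ s → 0 ≤ t → ∀ A, MeasurableSet[𝓘] A → m t A ≤ m (s + t) A + ε t := by
    intro s t hs ht A hA
    have h := hm s t hs ht Aᶜ hA.compl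
    rw [prob_compl_eq_one_sub (h𝓘 _ hA), prob_compl_eq_one_sub (h𝓘 _ hA),
      tsub_le_iff_right] at h
    have h2 : m t A + (1 - m t A) = 1 := add_tsub_cancel_of_le prob_le_one
    have h3 : 1 - m t A ≠ ∞ := (tsub_le_self.trans_lt ENNReal.one_lt_top).ne
    refine (ENNReal.add_le_add_iff_right h3).mp ?_
    rw [h2]
    exact h.trans (le_of_eq (by ring))
  set L : Set Ω → ℝ≥0∞ := fun A => Filter.limsup (fun n : ℕ => m n A) Filter.atTop with hL
  have hL1 : ∀ t, 0 ≤ t → ∀ A, MeasurableSet[𝓘] A → L A ≤ m t A + ε t := by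
    intro t ht A hA
    refine Filter.limsup_le_of_le (by isBoundedDefault) ?_
    filter_upwards [Filter.eventually_ge_atTop ⌈t⌉₊] with n hn
    have h : t ≤ n := (Nat.le_ceil t).trans (by exact_mod_cast hn)
    simpa using hm (n - t) t (by linarith) ht A hA
  have hL2 : ∀ t, 0 ≤ t → ∀ A, MeasurableSet[𝓘] A → m t A ≤ L A + ε t := by
    intro t ht A hA
    rw [← tsub_le_iff_right]
    refine Filter.le_limsup_of_frequently_le' (Filter.Eventually.frequently ?_)
    filter_upwards [Filter.eventually_ge_atTop ⌈t⌉₊] with n hn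
    have h : t ≤ n := (Nat.le_ceil t).trans (by exact_mod_cast hn)
    rw [tsub_le_iff_right]
    simpa using hm' (n - t) t (by linarith) ht A hA
  have hL0 : L ∅ = 0 := by simp [hL]
  have hLu : L Set.univ = 1 := by simp [hL]
  have hadd : ∀ A B, MeasurableSet[𝓘] A → MeasurableSet[𝓘] B → Disjoint A B →
      L (A ∪ B) = L A + L B := by
    intro A B hA hB hd
    refine le_antisymm (hε _ _ 3 (by simp) fun t ht => ?_) (hε _ _ 3 (by simp) fun t ht => ?_)
    · calc L (A ∪ B) ≤ m t (A ∪ B) + ε t := hL1 t ht _ (hA.union hB)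
        _ ≤ m t A + m t B + ε t := by gcongr; exact measure_union_le _ _
        _ ≤ (L A + ε t) + (L B + ε t) + ε t := by gcongr <;> exact hL2 t ht _ ‹_›
        _ = L A + L B + 3 * ε t := by ring
    · calc L A + L B ≤ (m t A + ε t) + (m t B + ε t) := by gcongr <;> exact hL1 t ht _ ‹_›
        _ = m t (A ∪ B) + (ε t + ε t) := by rw [measure_union hd (h𝓘 _ hB)]; ring
        _ ≤ (L (A ∪ B) + ε t) + (ε t + ε t) := by gcongr; exact hL2 t ht _ (hA.union hB)
        _ = L (A ∪ B) + 3 * ε t := by ring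
  have hmono : ∀ A B, MeasurableSet[𝓘] A → MeasurableSet[𝓘] B → A ⊆ B → L A ≤ L B := by
    intro A B hA hB hAB
    have := hadd A (B \ A) hA (hB.diff hA) Set.disjoint_sdiff_right
    rw [Set.union_sdiff_cancel hAB] at this
    rw [this]
    exact le_self_add
  have hsum : ∀ f : ℕ → Set Ω, (∀ i, MeasurableSet[𝓘] (f i)) → Pairwise (Function.onFun Disjoint f) →
      ∀ n, L (⋃ i ∈ Finset.range n, f i) = ∑ i ∈ Finset.range n, L (f i) := by
    intro f hf hd n
    induction n with
    | zero => simp [hL0]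
    | succ n ih =>
      rw [Finset.sum_range_succ, ← ih, ← hadd _ _
        (Finset.measurableSet_biUnion _ fun i _ => hf i) (hf n)]
      · congr 1
        ext x
        simp only [Finset.mem_range, Set.mem_iUnion, exists_prop, Set.mem_union]
        constructor
        · rintro ⟨i, hi, hx⟩
          rcases Nat.lt_succ_iff_lt_or_eq.mp hi with h | rfl
          · exact Or.inl ⟨i, h, hx⟩
          · exact Or.inr hx
        · rintro (⟨i, hi, hx⟩ | hx)
          · exact ⟨i, by omega, hx⟩
          · exact ⟨n, by omega, hx⟩
      · simp only [Set.disjoint_iUnion_left]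
        intro i hi
        exact hd (Finset.mem_range.mp hi).ne
  let ν : @Measure Ω 𝓘 := @Measure.ofMeasurable Ω 𝓘 (fun A _ => L A) hL0 (by
    intro f hf hd
    have hU : MeasurableSet[𝓘] (⋃ i, f i) := MeasurableSet.iUnion hf
    have hP : ∀ n, MeasurableSet[𝓘] (⋃ i ∈ Finset.range n, f i) := fun n =>
      Finset.measurableSet_biUnion _ fun i _ => hf i
    have hsub : ∀ n, (⋃ i ∈ Finset.range n, f i) ⊆ ⋃ i, f i := fun n =>
      Set.iUnion₂_subset fun i _ => Set.subset_iUnion f i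
    refine le_antisymm ?_ ?_
    · refine hε _ _ 1 (by simp) fun t ht => ?_
      -- The tail of the union is compared with one fixed measure `m t`, under which it tends to
      -- zero; `hε` then removes the error `ε t`.
      have h1 : ∀ n, L (⋃ i, f i) ≤ ∑' i, L (f i) +
          (m t ((⋃ i, f i) \ ⋃ i ∈ Finset.range n, f i) + ε t) := by
        intro n
        have h2 := hadd _ _ (hP n) (hU.diff (hP n)) Set.disjoint_sdiff_right
        rw [Set.union_sdiff_cancel (hsub n), hsum f hf hd] at h2
        rw [h2]
        exact add_le_add (ENNReal.sum_le_tsum _) (hL1 t ht _ (hU.diff (hP n)))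
      have h3 : Filter.Tendsto (fun n => m t ((⋃ i, f i) \ ⋃ i ∈ Finset.range n, f i))
          Filter.atTop (nhds 0) := by
        have h4 := tendsto_measure_iInter_atTop (μ := m t)
          (s := fun n => (⋃ i, f i) \ ⋃ i ∈ Finset.range n, f i)
          (fun n => (h𝓘 _ (hU.diff (hP n))).nullMeasurableSet)
          (fun a b hab => Set.sdiff_subset_sdiff_right
            (Set.biUnion_subset_biUnion_left fun i hi => by
              simp only [Finset.coe_range, Set.mem_Iio] at hi ⊢; omega))
          ⟨0, measure_ne_top _ _⟩
        have h5 : ⋂ n, (⋃ i, f i) \ ⋃ i ∈ Finset.range n, f i = ∅ := by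
          refine Set.eq_empty_of_forall_notMem fun x hx => ?_
          obtain ⟨i, hi⟩ := Set.mem_iUnion.mp (Set.mem_iInter.mp hx 0).1
          exact (Set.mem_iInter.mp hx (i + 1)).2
            (Set.mem_iUnion₂.mpr ⟨i, Finset.mem_range.mpr (by omega), hi⟩)
        rwa [h5, measure_empty] at h4
      have h6 := (h3.add_const (ε t)).const_add (∑' i, L (f i))
      rw [zero_add] at h6
      rw [one_mul]
      exact ge_of_tendsto' h6 h1
    · rw [ENNReal.tsum_eq_iSup_nat]
      refine iSup_le fun n => ?_
      rw [← hsum f hf hd]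
      exact hmono _ _ (hP n) hU (hsub n))
  have hν : ∀ A, MeasurableSet[𝓘] A → ν A = L A := fun A hA =>
    @Measure.ofMeasurable_apply Ω 𝓘 _ _ _ A hA
  -- A finite measure on the full σ-algebra dominating every `m n`, hence the limit `ν`. The
  -- derivative of `ν` with respect to the trace of `M` is `𝓘`-measurable, and used as a density of
  -- `M` it extends `ν`.
  let M : Measure Ω := Measure.sum fun n : ℕ => ((2 : ℝ≥0∞)⁻¹ ^ n) • m n
  have hMfin : IsFiniteMeasure M := by
    refine ⟨?_⟩
    simp only [M, Measure.sum_apply _ MeasurableSet.univ, Measure.smul_apply, measure_univ,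
      smul_eq_mul, mul_one, ENNReal.tsum_geometric]
    simp
  have hνfin : @IsFiniteMeasure Ω 𝓘 ν := by
    refine @IsFiniteMeasure.mk Ω 𝓘 ν ?_
    rw [hν _ MeasurableSet.univ, hLu]
    exact ENNReal.one_lt_top
  have hac : ν ≪ M.trim h𝓘 := by
    refine Measure.AbsolutelyContinuous.mk fun A hA h0 => ?_
    rw [trim_measurableSet_eq h𝓘 hA] at h0
    have h1 : ∀ n : ℕ, m n A = 0 := by
      intro n
      simp only [M, Measure.sum_apply _ (h𝓘 _ hA), Measure.smul_apply, smul_eq_mul,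
        ENNReal.tsum_eq_zero] at h0
      exact (mul_eq_zero.mp (h0 n)).resolve_left (pow_ne_zero _ (by simp))
    rw [hν A hA]
    simp [hL, h1]
  have hdens := Measure.withDensity_rnDeriv_eq ν (M.trim h𝓘) hac
  have hfm : Measurable[𝓘] (ν.rnDeriv (M.trim h𝓘)) := Measure.measurable_rnDeriv _ _
  let μ : Measure Ω := M.withDensity (ν.rnDeriv (M.trim h𝓘))
  have hμ : ∀ A, MeasurableSet[𝓘] A → μ A = L A := by
    intro A hA
    rw [← hν A hA, ← hdens, withDensity_apply _ hA, withDensity_apply _ (h𝓘 _ hA),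
      restrict_trim h𝓘 _ hA, lintegral_trim h𝓘 hfm]
  refine ⟨μ, ⟨?_⟩, fun t ht A hA => ?_⟩
  · rw [hμ _ MeasurableSet.univ, hLu]
  · rw [hμ A hA]
    exact ⟨hL1 t ht A hA, hL2 t ht A hA⟩

/-! ### The invariant law -/

/-- Comparison of integrals from a comparison of the measures of the superlevel sets. -/
theorem lintegral_le_of_superlevel {Ω : Type*} [MeasurableSpace Ω] {μ m : Measure Ω} {ε : ℝ≥0∞}
    {F : Ω → ℝ≥0∞} (hF : Measurable F) (n : ℕ) (hn : ∀ x, F x ≤ n)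
    (h : ∀ a : ℝ≥0∞, μ {x | a < F x} ≤ m {x | a < F x} + ε) :
    ∫⁻ x, F x ∂μ ≤ ∫⁻ x, F x ∂m + n * ε := by
  -- The layer-cake formula, cut off at the upper bound of `F`: the error per level is `ε` and the
  -- levels have total length `n`.
  have key : ∀ ρ : Measure Ω, ∫⁻ x, F x ∂ρ =
      ∫⁻ u in Set.Ioc (0 : ℝ) n, ρ {x | ENNReal.ofReal u < F x} := by
    intro ρ
    have hlt : ∀ x, F x ≠ ∞ := fun x => ((hn x).trans_lt (ENNReal.natCast_lt_top n)).ne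
    have h1 := lintegral_eq_lintegral_meas_lt ρ (f := fun x => (F x).toReal)
      (Filter.Eventually.of_forall fun x => ENNReal.toReal_nonneg) hF.ennreal_toReal.aemeasurable
    simp only [ENNReal.ofReal_toReal (hlt _)] at h1
    have h3 : ∀ u ∈ Set.Ioi (0 : ℝ), ρ {x | u < (F x).toReal} =
        ρ {x | ENNReal.ofReal u < F x} := by
      intro u hu
      congr 1
      ext x
      exact (ENNReal.ofReal_lt_iff_lt_toReal (le_of_lt hu) (hlt x)).symm
    rw [h1, setLIntegral_congr_fun measurableSet_Ioi h3,
      ← Set.Ioc_union_Ioi_eq_Ioi (Nat.cast_nonneg n), lintegral_union measurableSet_Ioi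
      (Set.Ioc_disjoint_Ioi le_rfl)]
    have h2 : ∀ u ∈ Set.Ioi (n : ℝ), ρ {x | ENNReal.ofReal u < F x} = 0 := by
      intro u hu
      have : {x | ENNReal.ofReal u < F x} = ∅ := by
        refine Set.eq_empty_of_forall_notMem fun x hx => ?_
        have h4 : (n : ℝ≥0∞) ≤ ENNReal.ofReal u := by
          rw [← ENNReal.ofReal_natCast]
          exact ENNReal.ofReal_le_ofReal (le_of_lt hu)
        exact absurd (h4.trans_lt hx) (not_lt.mpr (hn x))
      rw [this, measure_empty]
    rw [setLIntegral_congr_fun measurableSet_Ioi h2]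
    simp
  rw [key μ, key m]
  refine (lintegral_mono fun u => h (ENNReal.ofReal u)).trans ?_
  rw [lintegral_add_right _ measurable_const]
  simp [mul_comm]

namespace RootedMultigraph

open Choices

/-- The events that concern rooted multigraphs up to isomorphism. -/
abbrev isoEvents : MeasurableSpace (RootedMultigraph ℕ ℕ) where
  MeasurableSet' A := MeasurableSet A ∧ IsoInvariant A
  measurableSet_empty := ⟨MeasurableSet.empty, fun _ _ _ h => h⟩
  measurableSet_compl _ h := ⟨h.1.compl, h.2.compl⟩
  measurableSet_iUnion f h := ⟨MeasurableSet.iUnion fun i => (h i).1, fun G H hi hG => by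
    obtain ⟨i, hG⟩ := Set.mem_iUnion.mp hG
    exact Set.mem_iUnion.mpr ⟨i, (h i).2 G H hi hG⟩⟩

theorem isoEvents_le : isoEvents ≤ (inferInstance : MeasurableSpace (RootedMultigraph ℕ ℕ)) :=
  fun _ h => h.1

def label (α : Type) [Countable α] : α ↪ ℕ := (nonempty_embedding_nat α).some

theorem exists_isomorphic_nat {α β : Type} [Countable α] [Countable β] (G : RootedMultigraph α β) :
    ∃ H : RootedMultigraph ℕ ℕ, Isomorphic G H :=
  ⟨_, (isEmbedding_map G (label α) (label β)).isomorphic⟩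

theorem hasProp_compl {α β : Type} [Countable α] [Countable β] {A : Set (RootedMultigraph ℕ ℕ)}
    (hA : IsoInvariant A) (G : RootedMultigraph α β) : HasProp Aᶜ G ↔ ¬ HasProp A G := by
  obtain ⟨H, hH⟩ := exists_isomorphic_nat G
  rw [hasProp_congr _ hH, hasProp_congr _ hH, hA.compl.hasProp_iff, hA.hasProp_iff]
  rfl

/-- The law of the cluster process from a single vertex, with labels in `ℕ`. -/
def singleMeasure (lam : ℝ≥0) (t : ℝ) : Measure (RootedMultigraph ℕ ℕ) :=
  (choiceLaw Unit Empty lam).map fun c => ((single Empty ()).cluster c t).map (label _) (label _)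

theorem measurable_single_map (t : ℝ) : Measurable fun c : Choices Unit Empty =>
    ((single Empty ()).cluster c t).map (label (Descendant Unit)) (label (EdgeLabel Unit Empty)) :=
  (((isMeasurable_const (single Empty ())).cluster measurable_id t).map _ _).measurable

instance (lam : ℝ≥0) (t : ℝ) : IsProbabilityMeasure (singleMeasure lam t) :=
  Measure.isProbabilityMeasure_map (measurable_single_map t).aemeasurable

theorem singleMeasure_apply (lam : ℝ≥0) (t : ℝ) {A : Set (RootedMultigraph ℕ ℕ)}
    (hA : MeasurableSet A) (hi : IsoInvariant A) : singleMeasure lam t A = singleLaw lam t A := by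
  rw [singleMeasure, Measure.map_apply (measurable_single_map t) hA]
  refine congrArg _ (Set.ext fun c => ?_)
  change _ ↔ HasProp A _
  rw [hasProp_congr A (isEmbedding_map ((single Empty ()).cluster c t) (label (Descendant Unit))
    (label (EdgeLabel Unit Empty))).isomorphic, hi.hasProp_iff]
  rfl

theorem lintegral_singleMeasure (lam : ℝ≥0) (t : ℝ) {F : RootedMultigraph ℕ ℕ → ℝ≥0∞}
    (hF : Measurable F) : ∫⁻ G, F G ∂(singleMeasure lam t) =
      ∫⁻ c, F (((single Empty ()).cluster c t).map (label _) (label _))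
        ∂(choiceLaw Unit Empty lam) :=
  lintegral_map hF (measurable_single_map t)

theorem measurable_size : Measurable fun G : RootedMultigraph ℕ ℕ => (G.size : ℝ≥0∞) := by
  have : (fun G : RootedMultigraph ℕ ℕ => (G.size : ℝ≥0∞)) =
      fun G => ∑' x, ind (x ∈ G.graph.vertexSet) := by
    funext G
    rw [size, ← ENNReal.tsum_set_one, tsum_subtype G.graph.vertexSet fun _ => (1 : ℝ≥0∞)]
    refine tsum_congr fun x => ?_
    by_cases h : x ∈ G.graph.vertexSet
    · rw [ind_of h, Set.indicator_of_mem h]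
    · rw [ind_not h, Set.indicator_of_notMem h]
  rw [this]
  exact Measurable.tsum fun x => measurable_ind (isMeasurable_id.vertex x)

theorem measurable_rootDegree :
    Measurable fun G : RootedMultigraph ℕ ℕ => (G.rootDegree : ℝ≥0∞) := by
  have : (fun G : RootedMultigraph ℕ ℕ => (G.rootDegree : ℝ≥0∞)) =
      fun G => ∑' e, ind (∃ r y, G.root = r ∧ G.graph.IsLink e r y) := by
    funext G
    rw [rootDegree, ← ENNReal.tsum_set_one,
      tsum_subtype {e | G.graph.Inc e G.root} fun _ => (1 : ℝ≥0∞)]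
    refine tsum_congr fun e => ?_
    by_cases h : G.graph.Inc e G.root
    · obtain ⟨y, hy⟩ := h
      rw [ind_of ⟨_, y, rfl, hy⟩, Set.indicator_of_mem (show e ∈ {e | G.graph.Inc e G.root} from
        ⟨y, hy⟩)]
    · rw [ind_not (by rintro ⟨r, y, rfl, hy⟩; exact h ⟨y, hy⟩), Set.indicator_of_notMem (by exact h)]
  rw [this]
  exact Measurable.tsum fun e => measurable_ind (Measurable.exists fun r => Measurable.exists
    fun y => (isMeasurable_id.root r).and (isMeasurable_id.link e r y))

/-- A suitable time makes the error smaller than any `δ`; `K + 1` avoids a division by zero. -/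
theorem le_of_forall_le_add_connProb {lam : ℝ≥0} (hlam : 0 < lam) {a b K : ℝ≥0∞} (hK : K ≠ ∞)
    (h : ∀ t, 0 ≤ t → a ≤ b + K * Env.connProb lam t) : a ≤ b := by
  refine ENNReal.le_of_forall_pos_le_add fun δ hδ _ => ?_
  have h1 : (δ : ℝ≥0∞) / (K + 1) ≠ 0 := (ENNReal.div_pos (by exact_mod_cast hδ.ne')
    (ENNReal.add_ne_top.mpr ⟨hK, ENNReal.one_ne_top⟩)).ne'
  obtain ⟨t, ht, hp⟩ := Env.exists_connProb_le hlam h1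
  refine (h t ht).trans (add_le_add_right ?_ b)
  calc K * Env.connProb lam t ≤ (K + 1) * (δ / (K + 1)) := by gcongr; exact le_self_add
    _ = δ := ENNReal.mul_div_cancel (by simp) (ENNReal.add_ne_top.mpr ⟨hK, ENNReal.one_ne_top⟩)

section

variable {lam : ℝ≥0} {t : ℝ} {A : Set (RootedMultigraph ℕ ℕ)}

theorem clusterLaw_add_compl {α β : Type} [Countable α] [Countable β] (lam : ℝ≥0) (t : ℝ)
    (G : RootedMultigraph α β) (hA : MeasurableSet A) (hi : IsoInvariant A) :
    clusterLaw lam t G A + clusterLaw lam t G Aᶜ = 1 := by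
  have hm : MeasurableSet {c | HasProp A (G.cluster c t)} := measurableSet_setOfPred.mpr
    (((isMeasurable_const G).cluster measurable_id t).hasProp hA hi)
  have h : {c | HasProp Aᶜ (G.cluster c t)} = {c | HasProp A (G.cluster c t)}ᶜ :=
    Set.ext fun c => hasProp_compl hi _
  rw [clusterLaw, clusterLaw, h, measure_add_measure_compl hm, measure_univ]

theorem prod_choiceLaw_apply (μ : Measure (RootedMultigraph ℕ ℕ)) [SFinite μ] (lam : ℝ≥0) (t : ℝ)
    (hA : MeasurableSet A) (hi : IsoInvariant A) :
    (μ.prod (choiceLaw ℕ ℕ lam)) {p | ∃ H ∈ A, Isomorphic (p.1.cluster p.2 t) H} =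
      ∫⁻ G, clusterLaw lam t G A ∂μ := by
  have hm : MeasurableSet {p : RootedMultigraph ℕ ℕ × Choices ℕ ℕ |
      HasProp A (p.1.cluster p.2 t)} := measurableSet_setOfPred.mpr
    (((isMeasurable_id.comp measurable_fst).cluster measurable_snd t).hasProp hA hi)
  exact Measure.prod_apply hm

theorem lintegral_clusterLaw_add_compl (μ : Measure (RootedMultigraph ℕ ℕ))
    [IsProbabilityMeasure μ] (lam : ℝ≥0) (t : ℝ) (hA : MeasurableSet A) (hi : IsoInvariant A) :
    ∫⁻ G, clusterLaw lam t G A ∂μ + ∫⁻ G, clusterLaw lam t G Aᶜ ∂μ = 1 := by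
  rw [← lintegral_add_left (isMeasurable_id.clusterLaw lam t hA hi),
    lintegral_congr fun G => clusterLaw_add_compl lam t G hA hi, lintegral_one, measure_univ]

/-- Two finite additive set functions of total mass one that are comparable are equal. -/
theorem eq_of_le_of_compl_le {a b a' b' : ℝ≥0∞} (h : a + a' = 1) (h' : b + b' = 1) (hab : a ≤ b)
    (hab' : a' ≤ b') : a = b := by
  refine le_antisymm hab ?_
  have hb' : b' ≠ ∞ := ((le_add_self.trans h'.le).trans_lt ENNReal.one_lt_top).ne
  refine (ENNReal.add_le_add_iff_right hb').mp ?_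
  rw [h', ← h]
  gcongr

/-- The Chapman–Kolmogorov identity: the Markov property survives relabelling by `ℕ` because
`clusterLaw` depends on the isomorphism class only. -/
theorem lintegral_singleMeasure_clusterLaw {s : ℝ} (lam : ℝ≥0) (hs : 0 ≤ s) (ht : 0 ≤ t)
    (hA : MeasurableSet A) (hi : IsoInvariant A) :
    ∫⁻ G, clusterLaw lam t G A ∂(singleMeasure lam s) = singleMeasure lam (s + t) A := by
  rw [singleMeasure_apply lam _ hA hi, lintegral_singleMeasure lam s
    (isMeasurable_id.clusterLaw lam t hA hi), ← lintegral_clusterLaw_single lam hs ht hA hi]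
  exact lintegral_congr fun c => (clusterLaw_congr lam t
    (isEmbedding_map ((single Empty ()).cluster c s) (label _) (label _)).isomorphic hA hi).symm

end

/-- The law of the cluster process from a random multigraph is close to the law from a single
vertex. -/
theorem lintegral_clusterLaw_le (μ : Measure (RootedMultigraph ℕ ℕ)) [IsProbabilityMeasure μ]
    (lam : ℝ≥0) (t : ℝ) {A : Set (RootedMultigraph ℕ ℕ)} (hA : MeasurableSet A)
    (hi : IsoInvariant A) :
    ∫⁻ G, clusterLaw lam t G A ∂μ ≤ singleMeasure lam t A +
      (∫⁻ G, (G.rootDegree : ℝ≥0∞) ∂μ) * Env.connProb lam t := by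
  have h : ∀ G : RootedMultigraph ℕ ℕ, clusterLaw lam t G A ≤
      singleMeasure lam t A + G.rootDegree * Env.connProb lam t := fun G => by
    rw [singleMeasure_apply lam t hA hi, ← clusterLaw_single (α := ℕ) (β := ℕ) lam t G.root hA hi]
    exact clusterLaw_le lam t G A
  refine (lintegral_mono h).trans ?_
  rw [lintegral_add_left measurable_const, lintegral_const, measure_univ, mul_one,
    lintegral_mul_const _ measurable_rootDegree]

/-- The law is the limit of the single-vertex laws. Their mean degrees are bounded, so the
comparison with a single vertex gives a Cauchy property at rate `B * connProb`; that rate is also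
returned, as uniqueness needs it. -/
theorem exists_invariantLaw {lam : ℝ≥0} (hlam : 0 < lam) :
    ∃ μ : Measure (RootedMultigraph ℕ ℕ), IsInvariantLaw lam μ ∧
      (∃ B : ℝ≥0, ∀ t, 0 ≤ t → ∀ A, MeasurableSet A → IsoInvariant A →
        singleMeasure lam t A ≤ μ A + B * Env.connProb lam t) ∧
      ∫⁻ G, (G.size : ℝ≥0∞) ∂μ < ∞ := by
  obtain ⟨B, hB⟩ := exists_lintegral_cluster_single_le hlam
  have hdeg : ∀ t, 0 ≤ t → ∫⁻ G, (G.rootDegree : ℝ≥0∞) ∂(singleMeasure lam t) ≤ B := by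
    intro t ht
    rw [lintegral_singleMeasure lam t measurable_rootDegree]
    refine le_trans (le_of_eq (lintegral_congr fun c => ?_)) (hB t ht Unit Empty ()).2
    rw [rootDegree_congr (isEmbedding_map ((single Empty ()).cluster c t) (label _)
      (label _)).isomorphic]
  have hsize : ∀ t, 0 ≤ t → ∫⁻ G, (G.size : ℝ≥0∞) ∂(singleMeasure lam t) ≤ B := by
    intro t ht
    rw [lintegral_singleMeasure lam t measurable_size]
    refine le_trans (le_of_eq (lintegral_congr fun c => ?_)) (hB t ht Unit Empty ()).1
    rw [size_congr (isEmbedding_map ((single Empty ()).cluster c t) (label _)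
      (label _)).isomorphic]
  have hCauchy : ∀ s t, 0 ≤ s → 0 ≤ t → ∀ A, MeasurableSet[isoEvents] A →
      singleMeasure lam (s + t) A ≤ singleMeasure lam t A + B * Env.connProb lam t := by
    rintro s t hs ht A ⟨hA, hi⟩
    rw [← lintegral_singleMeasure_clusterLaw lam hs ht hA hi]
    refine (lintegral_clusterLaw_le _ lam t hA hi).trans ?_
    gcongr
    exact hdeg s hs
  obtain ⟨μ, hμ, hclose⟩ := exists_measure_of_cauchy isoEvents_le (singleMeasure lam)
    (fun t => B * Env.connProb lam t) (fun a b K hK h => le_of_forall_le_add_connProb hlam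
      (K := K * B) (ENNReal.mul_ne_top hK ENNReal.coe_ne_top) fun t ht => by
        rw [mul_assoc]; exact h t ht) hCauchy
  have hcmp : ∀ F : RootedMultigraph ℕ ℕ → ℝ≥0∞, Measurable F →
      (∀ G H, Isomorphic G H → F G = F H) → ∀ n : ℕ, (∀ G, F G ≤ n) → ∀ t, 0 ≤ t →
      ∫⁻ G, F G ∂μ ≤ ∫⁻ G, F G ∂(singleMeasure lam t) + n * (B * Env.connProb lam t) :=
    fun F hF hFi n hn t ht => lintegral_le_of_superlevel hF n hn fun a =>
      (hclose t ht _ ⟨measurableSet_lt measurable_const hF, fun G H hGH (hG : a < F G) => by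
        change a < F H
        rwa [← hFi G H hGH]⟩).1
  have hbound : ∀ F : RootedMultigraph ℕ ℕ → ℝ≥0∞, Measurable F →
      (∀ G H, Isomorphic G H → F G = F H) →
      (∀ t, 0 ≤ t → ∫⁻ G, F G ∂(singleMeasure lam t) ≤ B) → ∫⁻ G, F G ∂μ ≤ B := by
    -- Closeness of measures controls bounded integrands only. The function is truncated at `n`, the
    -- error is removed for each `n`, and monotone convergence restores `F`.
    intro F hF hFi hFB
    have h1 : ∀ n : ℕ, ∫⁻ G, min (F G) n ∂μ ≤ B := by
      intro n
      refine le_of_forall_le_add_connProb hlam (K := n * B) (ENNReal.mul_ne_top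
        (ENNReal.natCast_ne_top n) ENNReal.coe_ne_top) fun t ht => ?_
      refine (hcmp (fun G => min (F G) n) (hF.min measurable_const)
        (fun G H hGH => by rw [hFi G H hGH]) n (fun G => min_le_right _ _) t ht).trans ?_
      rw [mul_assoc]
      gcongr
      exact (lintegral_mono fun G => min_le_left _ _).trans (hFB t ht)
    have h2 : ∀ G, F G = ⨆ n : ℕ, min (F G) n := fun G => by
      rw [← inf_iSup_eq (F G), ENNReal.iSup_natCast, inf_top_eq]
    rw [lintegral_congr h2, lintegral_iSup (fun n => hF.min measurable_const)
      (fun m n hmn G => min_le_min_left _ (by exact_mod_cast hmn))]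
    exact iSup_le h1
  have hle : ∀ t, 0 ≤ t → ∀ A, MeasurableSet A → IsoInvariant A →
      ∫⁻ G, clusterLaw lam t G A ∂μ ≤ μ A := by
    intro t ht A hA hi
    refine le_of_forall_le_add_connProb hlam (K := 3 * B) (ENNReal.mul_ne_top (by simp)
      ENNReal.coe_ne_top) fun s hs => ?_
    -- Evolving `μ` for time `t` is close to evolving the law at time `s`, which gives the law at `s
    -- + t`; this is close to the law at `s`, and that to `μ`. Each comparison costs one `B *
    -- connProb lam s`, whence the 3.
    have h1 := hcmp (fun G => clusterLaw lam t G A) (isMeasurable_id.clusterLaw lam t hA hi)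
      (fun G H hGH => clusterLaw_congr lam t hGH hA hi) 1
      (fun G => by rw [Nat.cast_one]; exact prob_le_one) s hs
    rw [lintegral_singleMeasure_clusterLaw lam hs ht hA hi, add_comm s t, Nat.cast_one,
      one_mul] at h1
    have h2 := hCauchy t s ht hs A ⟨hA, hi⟩
    have h3 := (hclose s hs A ⟨hA, hi⟩).2
    calc _ ≤ _ := h1
      _ ≤ (singleMeasure lam s A + B * Env.connProb lam s) + B * Env.connProb lam s := by gcongr
      _ ≤ ((μ A + B * Env.connProb lam s) + B * Env.connProb lam s) +
          B * Env.connProb lam s := by gcongr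
      _ = _ := by ring
  refine ⟨μ, ⟨hμ, ?_, fun t ht A hA hi => ?_⟩, ⟨B, fun t ht A hA hi => (hclose t ht A ⟨hA, hi⟩).2⟩,
    ?_⟩
  · exact (hbound _ measurable_rootDegree (fun G H h => by rw [rootDegree_congr h])
      hdeg).trans_lt ENNReal.coe_lt_top
  · rw [prod_choiceLaw_apply μ lam t hA hi]
    exact eq_of_le_of_compl_le (lintegral_clusterLaw_add_compl μ lam t hA hi)
      (by rw [measure_add_measure_compl hA, measure_univ]) (hle t ht A hA hi)
      (hle t ht Aᶜ hA.compl hi.compl)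
  · exact (hbound _ measurable_size (fun G H h => by rw [size_congr h])
      hsize).trans_lt ENNReal.coe_lt_top

end RootedMultigraph

end

theorem theorem2 (lam : ℝ≥0) (hlam : 0 < lam) :
    ∃ μ : Measure (RootedMultigraph ℕ ℕ),
      RootedMultigraph.IsInvariantLaw lam μ ∧
      (∀ ν : Measure (RootedMultigraph ℕ ℕ),
        RootedMultigraph.IsInvariantLaw lam ν → RootedMultigraph.SameLaw ν μ) ∧
      ∫⁻ G, (G.size : ℝ≥0∞) ∂μ < ∞ := by
  obtain ⟨μ, hμ, ⟨B, hB⟩, hsize⟩ := RootedMultigraph.exists_invariantLaw hlam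
  have := hμ.isProbabilityMeasure
  refine ⟨μ, hμ, fun ν hν => ?_, hsize⟩
  have := hν.isProbabilityMeasure
  have hle : ∀ A, MeasurableSet A → RootedMultigraph.IsoInvariant A → ν A ≤ μ A := by
    intro A hA hi
    refine RootedMultigraph.le_of_forall_le_add_connProb hlam
      (K := B + ∫⁻ G, (G.rootDegree : ℝ≥0∞) ∂ν)
      (ENNReal.add_ne_top.mpr ⟨ENNReal.coe_ne_top, hν.expected_rootDegree.ne⟩) fun t ht => ?_
    -- Invariance allows `ν` to be evolved up to a time when `connProb` is small, where it nearly
    -- agrees with the law from a single vertex and hence with `μ`. One inequality suffices, applied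
    -- to `A` and to its complement.
    rw [← hν.invariant t ht A hA hi, RootedMultigraph.prod_choiceLaw_apply ν lam t hA hi]
    refine (RootedMultigraph.lintegral_clusterLaw_le ν lam t hA hi).trans ?_
    rw [add_mul, ← add_assoc]
    gcongr
    exact hB t ht A hA hi
  intro A hA hi
  exact RootedMultigraph.eq_of_le_of_compl_le
    (by rw [measure_add_measure_compl hA, measure_univ])
    (by rw [measure_add_measure_compl hA, measure_univ]) (hle A hA hi) (hle _ hA.compl hi.compl)
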